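/- Let $N\ge 1$ and let $\mu$ be a probability measure on $\mathbb R^N$ with density $0\le\rho\in L^1(\mathbb R^N)$ with respect to Lebesgue measure. Assume that $\rho\in H^1_{\rm loc}(\mathbb R^N)$, that $\frac{\nabla\rho}{\rho}\in L^r_{\rm loc}(\mathbb R^N;\mathbb R^N)$ for some real $r>N$ (with $\nabla\rho$ the weak gradient), and that the (essential) infimum of $\rho$ over every compact subset of $\mathbb R^N$ is positive. Let $L^2_\mu=L^2(\mathbb R^N,\mu)$, with complex (or real) scalars. Let $(L,D(L))$ be the closure in $L^2_\mu$ of the operator $\varphi\mapsto\Delta\varphi+\frac{\nabla\rho}{\rho}\cdot\nabla\varphi$ with domain $C_c^\infty(\mathbb R^N)$, and let $(A,D(A))$ be the operator in $L^2_\mu$ associated with the form $a_L(u,v)=\int Lu\,\overline{Lv}\,d\mu$, $D(a_L)=D(L)$. That is, $u\in D(A)$ and $Au=w$ if and only if $u\in D(L)$, $w\in L^2_\mu$ and $a_L(u,v)=\int w\,\overline v\,d\mu$ for all $v\in D(L)$. Then $-A$ generates a (unique) $C_0$-semigroup $(e^{-tA})_{t\ge0}$ of bounded operators on $L^2_\mu$,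 every $\lambda>0$ lies in the resolvent set of $-A$, and, with $R(\lambda,-A)=(\lambda+A)^{-1}$: (i) for every $f\in L^2_\mu$, $e^{-tA}f\to\int f\,d\mu$ (a constant function) in $L^2_\mu$ as $t\to+\infty$; (ii) for every $f\in L^2_\mu$, $\lambda R(\lambda,-A)f\to\int f\,d\mu$ in $L^2_\mu$ as $\lambda\to0^+$; (iii) $(e^{-tA})_{t\ge0}$ is asymptotically irreducible: let $L^2_{\mu,>}$ be the set of all $f\in L^2_\mu$ with $f\ge0$ such that $f>0$ on some Borel set of positive Lebesgue measure; then for every $f\in L^2_{\mu,>}$ the distance in $L^2_\mu$ from $e^{-tA}f$ to $L^2_{\mu,>}$ tends to $0$ as $t\to+\infty$. -/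

import Mathlib

open MeasureTheory Filter Topology
open scoped NNReal ENNReal ContDiff

namespace BiKolmogorov

/-- `ℝ^N` with its Euclidean structure. -/
abbrev Space (N : ℕ) : Type := EuclideanSpace ℝ (Fin N)

/-- `f ∈ L^p_loc(ℝ^N)`: `f` is in `L^p` (Lebesgue measure) on every compact set. -/
def MemLpLoc {N : ℕ} {F : Type*} [NormedAddCommGroup F] (f : Space N → F) (p : ℝ≥0∞) : Prop :=
  ∀ K : Set (Space N), IsCompact K → MemLp f p (volume.restrict K)

/-- `G` is the weak (distributional) gradient of `ρ`. -/
def IsWeakGradient {N : ℕ} (ρ : Space N → ℝ) (G : Space N → Space N) : Prop :=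
  ∀ φ : Space N → ℝ, ContDiff ℝ ∞ φ → HasCompactSupport φ → ∀ i : Fin N,
    ∫ x, ρ x * fderiv ℝ φ x (EuclideanSpace.single i 1) = - ∫ x, G x i * φ x

/-- The assumptions on the density `ρ` of the probability measure `μ` and on its weak gradient `G`:
`0 ≤ ρ ∈ L^1`, `dμ = ρ dx`, `ρ ∈ H^1_loc` with `∇ρ = G`, `∇ρ / ρ ∈ L^r_loc` for some (finite)
`r > N`, and the (essential) infimum of `ρ` over each compact set is positive. -/
structure IsAdmissible {N : ℕ} (ρ : Space N → ℝ) (G : Space N → Space N)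
    (μ : Measure (Space N)) : Prop where
  integrable : Integrable ρ volume
  nonneg : ∀ᵐ x, 0 ≤ ρ x
  measure_eq : μ = volume.withDensity (fun x => ENNReal.ofReal (ρ x))
  memLpLoc : MemLpLoc ρ 2
  gradient_memLpLoc : MemLpLoc G 2
  isWeakGradient : IsWeakGradient ρ G
  logGradient_memLpLoc : ∃ r : ℝ, (N : ℝ) < r ∧
    MemLpLoc (fun x => (ρ x)⁻¹ • G x) (ENNReal.ofReal r)
  locally_bounded_below : ∀ K : Set (Space N), IsCompact K →
    ∃ c : ℝ, 0 < c ∧ ∀ᵐ x ∂(volume.restrict K), c ≤ ρ x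

section Operators

variable (𝕜 : Type*) [RCLike 𝕜] {N : ℕ}

/-- The differential expression `Δφ + (∇ρ / ρ) · ∇φ`. -/
noncomputable def diffExpr {𝕜 : Type*} [RCLike 𝕜] {N : ℕ} (ρ : Space N → ℝ)
    (G : Space N → Space N) (φ : Space N → 𝕜) (x : Space N) : 𝕜 :=
  Laplacian.laplacian φ x + fderiv ℝ φ x ((ρ x)⁻¹ • G x)

/-- The graph of the expression `Δφ + (∇ρ / ρ) · ∇φ` on `C_c^∞(ℝ^N)` in `L²_μ × L²_μ`. -/
noncomputable def minimalGraph (ρ : Space N → ℝ) (G : Space N → Space N)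
    (μ : Measure (Space N)) : Submodule 𝕜 (Lp 𝕜 2 μ × Lp 𝕜 2 μ) where
  carrier := {p | ∃ φ : Space N → 𝕜, ContDiff ℝ ∞ φ ∧ HasCompactSupport φ ∧
    (p.1 =ᵐ[μ] φ) ∧ (p.2 =ᵐ[μ] diffExpr ρ G φ)}
  add_mem' := by
    rintro ⟨f, g⟩ ⟨f', g'⟩ ⟨φ, hφ, hc, h1, h2⟩ ⟨φ', hφ', hc', h1', h2'⟩
    refine ⟨φ + φ', hφ.add hφ', hc.add hc', (Lp.coeFn_add f f').trans (h1.add h1'), ?_⟩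
    refine (Lp.coeFn_add g g').trans ((h2.add h2').trans (Eventually.of_forall fun x => ?_))
    have a := (hφ.of_le (m := 2) (by norm_cast)).contDiffAt (x := x)
    have a' := (hφ'.of_le (m := 2) (by norm_cast)).contDiffAt (x := x)
    have b := (a.differentiableAt (by norm_num))
    have b' := (a'.differentiableAt (by norm_num))
    simp only [diffExpr, Pi.add_apply, a.laplacian_add a', fderiv_add b b',
      add_apply]
    ring
  zero_mem' := by
    refine ⟨0, contDiff_const, HasCompactSupport.zero, Lp.coeFn_zero _ _ _, ?_⟩
    refine (Lp.coeFn_zero _ _ _).trans (Eventually.of_forall fun x => ?_)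
    have hl : Laplacian.laplacian (0 : Space N → 𝕜) x = 0 := by
      have h := InnerProductSpace.laplacian_smul (0 : ℝ) (f := (0 : Space N → 𝕜)) (x := x)
        contDiff_const.contDiffAt
      simpa using h
    simp [diffExpr, hl]
  smul_mem' := by
    rintro c ⟨f, g⟩ ⟨φ, hφ, hc, h1, h2⟩
    refine ⟨c • φ, hφ.const_smul c, hc.smul_left (f := fun _ => c),
      (Lp.coeFn_smul c f).trans (h1.const_smul c), ?_⟩
    refine (Lp.coeFn_smul c g).trans ((h2.const_smul c).trans (Eventually.of_forall fun x => ?_))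
    have a := (hφ.of_le (m := 2) (by norm_cast)).contDiffAt (x := x)
    have b := (a.differentiableAt (by norm_num))
    simp only [diffExpr, Pi.smul_apply, InnerProductSpace.laplacian_smul c a,
      fderiv_const_smul b c, smul_add]
    rfl

/-- The operator `(L, C_c^∞(ℝ^N))` in `L²_μ`. -/
noncomputable def minimalOperator (ρ : Space N → ℝ) (G : Space N → Space N)
    (μ : Measure (Space N)) : Lp 𝕜 2 μ →ₗ.[𝕜] Lp 𝕜 2 μ :=
  (minimalGraph 𝕜 ρ G μ).toLinearPMap

/-- The Kolmogorov operator `(L, D(L))`: the closure of `(L, C_c^∞(ℝ^N))` in `L²_μ`. -/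
noncomputable def kolmogorovOperator (ρ : Space N → ℝ) (G : Space N → Space N)
    (μ : Measure (Space N)) : Lp 𝕜 2 μ →ₗ.[𝕜] Lp 𝕜 2 μ :=
  (minimalOperator 𝕜 ρ G μ).closure

end Operators

section Abstract

variable {𝕜 : Type*} [RCLike 𝕜] {H : Type*} [NormedAddCommGroup H] [InnerProductSpace 𝕜 H]

/-- For an operator `B`, the graph of the operator associated with the form
`a_B(u,v) = (Bu, Bv)`, `D(a_B) = D(B)` (here `(u, v)` is linear in `u`, that is `⟪v, u⟫`):
all `(u, w)` with `u ∈ D(B)` and `a_B(u, v) = (w, v)` for all `v ∈ D(B)`. -/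
def formGraph (B : H →ₗ.[𝕜] H) : Submodule 𝕜 (H × H) where
  carrier := {p | ∃ u : B.domain, (u : H) = p.1 ∧
    ∀ v : B.domain, inner 𝕜 (B v) (B u) = inner 𝕜 (v : H) p.2}
  add_mem' := by
    rintro ⟨f, g⟩ ⟨f', g'⟩ ⟨u, rfl, h⟩ ⟨u', rfl, h'⟩
    exact ⟨u + u', rfl, fun v => by simp [LinearPMap.map_add, inner_add_right, h v, h' v]⟩
  zero_mem' := ⟨0, rfl, fun v => by simp [LinearPMap.map_zero]⟩
  smul_mem' := by
    rintro c ⟨f, g⟩ ⟨u, rfl, h⟩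
    exact ⟨c • u, rfl, fun v => by simp [LinearPMap.map_smul, inner_smul_right, h v]⟩

/-- The operator associated with the form `a_B(u,v) = (Bu, Bv)`, `D(a_B) = D(B)`. -/
noncomputable def formOperator (B : H →ₗ.[𝕜] H) : H →ₗ.[𝕜] H :=
  (formGraph B).toLinearPMap

/-- Strongly continuous one-parameter semigroups of bounded operators. -/
structure IsC0Semigroup (T : ℝ≥0 → H →L[𝕜] H) : Prop where
  map_zero : T 0 = ContinuousLinearMap.id 𝕜 H
  map_add : ∀ s t, T (s + t) = (T s).comp (T t)
  continuous : ∀ f, Continuous fun t => T t f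

/-- `T` is a strongly continuous semigroup whose infinitesimal generator is exactly `B`. -/
def IsSemigroupGeneratedBy (T : ℝ≥0 → H →L[𝕜] H) (B : H →ₗ.[𝕜] H) : Prop :=
  IsC0Semigroup T ∧ ∀ f g : H, (f, g) ∈ B.graph ↔
    Tendsto (fun t : ℝ≥0 => (((t : ℝ)⁻¹ : ℝ) : 𝕜) • (T t f - f)) (𝓝[>] 0) (𝓝 g)

/-- `z` is in the resolvent set of `B` and `R = R(z, B) = (z - B)⁻¹`. -/
def IsResolventOf (B : H →ₗ.[𝕜] H) (z : 𝕜) (R : H →L[𝕜] H) : Prop :=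
  (∀ f : H, ∃ u : B.domain, (u : H) = R f ∧ z • (u : H) - B u = f) ∧
    ∀ u : B.domain, R (z • (u : H) - B u) = u

end Abstract

section BiKolmogorovOperator

/-- The bi-Kolmogorov operator `(A, D(A))`: the operator associated with the form
`a_L(u,v) = ∫ Lu conj(Lv) dμ`, `D(a_L) = D(L)`. -/
noncomputable def biKolmogorovOperator (𝕜 : Type*) [RCLike 𝕜] {N : ℕ} (ρ : Space N → ℝ)
    (G : Space N → Space N) (μ : Measure (Space N)) : Lp 𝕜 2 μ →ₗ.[𝕜] Lp 𝕜 2 μ :=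
  formOperator (kolmogorovOperator 𝕜 ρ G μ)

/-- `L²_μ(ℝ^N)_>`: the nonnegative functions in `L²_μ` that are positive on some Borel set of
positive Lebesgue measure. -/
def positivePart (𝕜 : Type*) [RCLike 𝕜] {N : ℕ} (μ : Measure (Space N)) : Set (Lp 𝕜 2 μ) :=
  {f | (∀ᵐ x ∂μ, 0 ≤ RCLike.re (f x) ∧ RCLike.im (f x) = 0) ∧
    ∃ S : Set (Space N), MeasurableSet S ∧ 0 < (volume : Measure (Space N)) S ∧
      ∀ᵐ x ∂μ, x ∈ S → 0 < RCLike.re (f x)}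

/-- Asymptotic irreducibility of a semigroup on `L²_μ(ℝ^N)`. -/
def IsAsymptoticallyIrreducible {𝕜 : Type*} [RCLike 𝕜] {N : ℕ} {μ : Measure (Space N)}
    (T : ℝ≥0 → Lp 𝕜 2 μ →L[𝕜] Lp 𝕜 2 μ) : Prop :=
  ∀ f ∈ positivePart 𝕜 μ,
    Tendsto (fun t => Metric.infDist (T t f) (positivePart 𝕜 μ)) atTop (𝓝 0)

end BiKolmogorovOperator

end BiKolmogorov

/-! Write `L` for the Kolmogorov operator and `β = ∇ρ/ρ`. The form operator is `A = L*L`. If `L` is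
closed and densely defined, `A` is symmetric, nonnegative and has all resolvents `(l + A)⁻¹`, `l >
0`; moreover `Au = 0` iff `Lu = 0`, because `(Au, u) = ‖Lu‖²`. When `ker L` is spanned by a unit
vector `e`, both `e^{-tA}` and `l(l + A)⁻¹` converge strongly to the orthogonal projection onto `e`.
With `e = 1` and `μ` a probability measure, this projection is `f ↦ ∫ f dμ`. For `f` in the positive
cone the limit is a positive constant, hence in the cone too, which is asymptotic irreducibility.

The abstract part (`formOperator_generation`) uses no spectral theorem. Resolvents come from
orthogonal projection onto a rescaled graph of `L`, the semigroup from Yosida approximation, and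
convergence from the identity `(T_s f, T_t f) = ‖T_{(s+t)/2} f‖²` together with monotonicity of
`‖T_t f‖`.

Four facts about `L` remain. Closability and density of the domain follow from symmetry on test
functions. The kernel contains only constants, since `∫ |∂ᵢφ|² dμ ≤ ‖Lφ‖ ‖φ‖` passes to the closure
and makes the weak gradient vanish (`IsAdmissible.exists_eq_const`).

The hard fact is that `1` lies in `D(L)` with `L1 = 0` (`IsAdmissible.const_mem_graph`). Cutoffs
`χ_n` alone do not give it, because `Lχ_n` involves `β`, which is uncontrolled at infinity. By
duality it suffices that every weak `L²_μ` solution of `Lh = f` has `∫ f dμ = 0`. If `∇h` is locally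
square integrable, testing with `χ_n² h` bounds `∫ χ_n² |∇h|² dμ`, and testing with `χ_n²` then
gives `∫ χ_n² f dμ = O(1/n)` (`IsAdmissible.abs_integral_cutoff_le`).

Local regularity of `h` is again a duality argument (`IsAdmissible.exists_gradient_bound`): to
estimate `∫ ηh ∂ᵢψ` by `‖ψ‖`, one solves `lφ - Δφ - β·∇φ = ζ ∂ᵢψ/ρ` approximately by test functions,
bounds the energy of `φ` by `‖ψ‖²`, and tests the equation of `h` with `ηφ`. Solvability for large
`l` holds because a weight in `L^r`, `r > N`, is form bounded with bound zero with respect to the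
gradient (`exists_weight_bound`). The same exponent makes `log ρ`, hence `ρ`, locally bounded by a
Morrey argument (`ae_bounded_of_gradient`). -/

namespace BiKolmogorov

/-! ### Dissipative curves and exponentials of bounded operators. -/

section NormSq

variable {𝕜 : Type*} [RCLike 𝕜] {H : Type*} [NormedAddCommGroup H] [InnerProductSpace 𝕜 H]
  [NormedSpace ℝ H] [IsScalarTower ℝ 𝕜 H]

variable (𝕜) in
theorem hasDerivWithinAt_norm_sq {u : ℝ → H} {u' : H} {s : Set ℝ} {t : ℝ}
    (h : HasDerivWithinAt u u' s t) :
    HasDerivWithinAt (fun t => ‖u t‖ ^ 2) (2 * RCLike.re (inner 𝕜 (u t) u')) s t := by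
  have h1 := h.inner 𝕜 h
  have h2 := (RCLike.reCLM (K := 𝕜)).hasFDerivAt.comp_hasDerivWithinAt t h1
  have e1 : (fun t => ‖u t‖ ^ 2) = RCLike.reCLM ∘ fun t => inner 𝕜 (u t) (u t) := by
    funext t
    simp [Function.comp]
  have e2 : 2 * RCLike.re (inner 𝕜 (u t) u') =
      RCLike.reCLM (inner 𝕜 (u t) u' + inner 𝕜 u' (u t)) := by
    rw [map_add]
    simp only [RCLike.reCLM_apply, inner_re_symm (𝕜 := 𝕜) u']
    ring
  rw [e1, e2]
  exact h2

variable (𝕜) in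
/-- A curve whose right derivative is dissipative has nonincreasing norm. -/
theorem norm_le_of_dissipative {u u' : ℝ → H} {a : ℝ}
    (hc : ContinuousOn u (Set.Ici a))
    (hd : ∀ t, a ≤ t → HasDerivWithinAt u (u' t) (Set.Ici t) t)
    (hn : ∀ t, a ≤ t → RCLike.re (inner 𝕜 (u t) (u' t)) ≤ 0) {t : ℝ} (ht : a ≤ t) :
    ‖u t‖ ≤ ‖u a‖ := by
  have := image_le_of_deriv_right_le_deriv_boundary (f := fun t => ‖u t‖ ^ 2)
    (f' := fun t => 2 * RCLike.re (inner 𝕜 (u t) (u' t))) (a := a) (b := t)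
    (((hc.mono Set.Icc_subset_Ici_self).norm).pow 2)
    (fun x hx => hasDerivWithinAt_norm_sq 𝕜 (hd x hx.1))
    (B := fun _ => ‖u a‖ ^ 2) (B' := fun _ => 0) le_rfl continuousOn_const
    (fun x _ => hasDerivWithinAt_const _ _ _)
    (fun x hx => by have := hn x hx.1; linarith) (Set.right_mem_Icc.2 ht)
  exact (pow_le_pow_iff_left₀ (norm_nonneg _) (norm_nonneg _) two_ne_zero).1 this

variable [CompleteSpace H]

theorem hasDerivAt_exp_apply (a : H →L[𝕜] H) (f : H) (t : ℝ) :
    HasDerivAt (fun t : ℝ => NormedSpace.exp ((t : 𝕜) • a) f)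
      (NormedSpace.exp ((t : 𝕜) • a) (a f)) t := by
  have h1 := (hasDerivAt_exp_smul_const a (t : 𝕜)).clm_apply (hasDerivAt_const (t : 𝕜) f)
  have h2 : HasDerivAt (fun t : ℝ => (t : 𝕜)) 1 t := by
    simpa using (RCLike.ofRealCLM (K := 𝕜)).hasDerivAt (x := t)
  have h3 := HasDerivAt.scomp t h1 h2
  simpa [Function.comp_def] using h3

theorem exp_add_of_commute_smul {a b : H →L[𝕜] H} (h : Commute a b) (s t : ℝ) :
    NormedSpace.exp (((s : 𝕜) • a) + ((t : 𝕜) • b)) =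
      NormedSpace.exp ((s : 𝕜) • a) * NormedSpace.exp ((t : 𝕜) • b) := by
  -- The addition formula for `NormedSpace.exp` needs a `ℚ`-algebra structure, obtained by
  -- restricting scalars.
  let _ : NormedAlgebra ℚ (H →L[𝕜] H) := NormedAlgebra.restrictScalars ℚ 𝕜 _
  exact NormedSpace.exp_add_of_commute ((h.smul_left _).smul_right _)

/-- The exponential of a bounded dissipative operator is a contraction. -/
theorem norm_exp_apply_le {a : H →L[𝕜] H} (ha : ∀ f, RCLike.re (inner 𝕜 f (a f)) ≤ 0) (f : H)
    {t : ℝ} (ht : 0 ≤ t) : ‖NormedSpace.exp ((t : 𝕜) • a) f‖ ≤ ‖f‖ := by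
  have hcomm : ∀ t : ℝ, NormedSpace.exp ((t : 𝕜) • a) (a f) =
      a (NormedSpace.exp ((t : 𝕜) • a) f) := by
    intro t
    have h : Commute ((t : 𝕜) • a) a := (Commute.refl a).smul_left _
    let _ : NormedAlgebra ℚ (H →L[𝕜] H) := NormedAlgebra.restrictScalars ℚ 𝕜 _
    have := h.exp_left
    exact DFunLike.congr_fun this f
  have := norm_le_of_dissipative 𝕜 (u := fun t : ℝ => NormedSpace.exp ((t : 𝕜) • a) f)
    (u' := fun t => NormedSpace.exp ((t : 𝕜) • a) (a f)) (a := 0)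
    (fun t _ => (hasDerivAt_exp_apply a f t).continuousAt.continuousWithinAt)
    (fun t _ => (hasDerivAt_exp_apply a f t).hasDerivWithinAt)
    (fun t _ => by rw [hcomm]; exact ha _) ht
  simpa using this

/-- Comparison of the exponentials of two commuting bounded dissipative operators. -/
theorem norm_exp_sub_exp_le {a b : H →L[𝕜] H} (h : Commute a b)
    (ha : ∀ f, RCLike.re (inner 𝕜 f (a f)) ≤ 0) (hb : ∀ f, RCLike.re (inner 𝕜 f (b f)) ≤ 0)
    (f : H) {t : ℝ} (ht : 0 ≤ t) :
    ‖NormedSpace.exp ((t : 𝕜) • b) f - NormedSpace.exp ((t : 𝕜) • a) f‖ ≤ t * ‖b f - a f‖ := by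
  have hc : Commute a (b - a) := h.sub_right (Commute.refl a)
  -- The curve runs from `exp(ta) f` at `s = 0` to `exp(tb) f` at `s = t`. By commutativity it is
  -- also `exp((t-s)a) exp(sb) f`, a product of contractions for `0 ≤ s ≤ t`, so its speed is at
  -- most `‖bf - af‖`.
  set v : ℝ → H := fun s =>
    NormedSpace.exp ((t : 𝕜) • a) (NormedSpace.exp ((s : 𝕜) • (b - a)) f) with hv
  have hd : ∀ s : ℝ, HasDerivAt v (NormedSpace.exp ((t : 𝕜) • a)
      (NormedSpace.exp ((s : 𝕜) • (b - a)) ((b - a) f))) s := fun s =>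
    ((NormedSpace.exp ((t : 𝕜) • a) : H →L[𝕜] H).restrictScalars ℝ).hasFDerivAt.comp_hasDerivAt s
      (hasDerivAt_exp_apply (b - a) f s)
  have key : ∀ s : ℝ, ∀ g : H, NormedSpace.exp ((t : 𝕜) • a)
      (NormedSpace.exp ((s : 𝕜) • (b - a)) g) =
      NormedSpace.exp (((t - s : ℝ) : 𝕜) • a) (NormedSpace.exp ((s : 𝕜) • b) g) := by
    intro s g
    have h1 := exp_add_of_commute_smul hc t s
    have h2 := exp_add_of_commute_smul h (t - s) s
    have h3 : ((t : 𝕜) • a) + ((s : 𝕜) • (b - a)) =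
        (((t - s : ℝ) : 𝕜) • a) + ((s : 𝕜) • b) := by
      push_cast
      module
    rw [h3, h2] at h1
    exact (DFunLike.congr_fun h1 g).symm
  have := norm_image_sub_le_of_norm_deriv_le_segment' (f := v) (a := 0) (b := t)
    (C := ‖b f - a f‖) (fun s _ => (hd s).hasDerivWithinAt)
    (fun s hs => by
      rw [key]
      exact (norm_exp_apply_le ha _ (by linarith [hs.2])).trans
        (norm_exp_apply_le hb _ hs.1)) t (Set.right_mem_Icc.2 ht)
  have e0 : v 0 = NormedSpace.exp ((t : 𝕜) • a) f := by simp [hv]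
  have e1 : v t = NormedSpace.exp ((t : 𝕜) • b) f := by rw [hv]; simp only [key]; simp
  rw [e0, e1] at this
  linarith

end NormSq

/-! ### Orbits of a semigroup and uniqueness. -/

section Semigroups

variable {𝕜 : Type*} [RCLike 𝕜] {H : Type*} [NormedAddCommGroup H] [InnerProductSpace 𝕜 H]

/-- The generator maps the orbit of a point of its domain along the orbit of the image. -/
theorem IsSemigroupGeneratedBy.mem_graph {T : ℝ≥0 → H →L[𝕜] H} {B : H →ₗ.[𝕜] H}
    (hT : IsSemigroupGeneratedBy T B) {f g : H} (h : (f, g) ∈ B.graph) (s : ℝ≥0) :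
    (T s f, T s g) ∈ B.graph := by
  rw [hT.2] at h ⊢
  refine (((T s).continuous.tendsto g).comp h).congr fun t => ?_
  have : T t (T s f) = T s (T t f) := by
    have h1 := DFunLike.congr_fun (hT.1.map_add t s) f
    have h2 := DFunLike.congr_fun (hT.1.map_add s t) f
    rw [add_comm] at h1
    exact h1.symm.trans h2
  simp [this]

/-- The generator is a right limit at `0`, so the semigroup law gives right derivatives directly,
and `norm_le_of_dissipative` asks for nothing more. -/
theorem IsSemigroupGeneratedBy.hasDerivWithinAt [NormedSpace ℝ H] [IsScalarTower ℝ 𝕜 H]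
    {T : ℝ≥0 → H →L[𝕜] H} {B : H →ₗ.[𝕜] H}
    (hT : IsSemigroupGeneratedBy T B) {f g : H} (h : (f, g) ∈ B.graph) {s : ℝ} (hs : 0 ≤ s) :
    HasDerivWithinAt (fun r : ℝ => T r.toNNReal f) (T s.toNNReal g) (Set.Ici s) s := by
  have h1 := (hT.2 _ _).1 (hT.mem_graph h s.toNNReal)
  rw [hasDerivWithinAt_iff_tendsto_slope, Set.Ici_sdiff_left]
  have h2 : Tendsto (fun r : ℝ => (r - s).toNNReal) (𝓝[>] s) (𝓝[>] 0) := by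
    refine tendsto_nhdsWithin_iff.2 ⟨?_, ?_⟩
    · have : Tendsto (fun r : ℝ => (r - s).toNNReal) (𝓝 s) (𝓝 ((s - s).toNNReal)) := by
        apply Continuous.tendsto; fun_prop
      simpa using this.mono_left nhdsWithin_le_nhds
    · filter_upwards [self_mem_nhdsWithin] with r hr
      simpa using hr
  refine (h1.comp h2).congr' ?_
  filter_upwards [self_mem_nhdsWithin] with r hr
  have hr' : s < r := hr
  have e : T r.toNNReal f = T (r - s).toNNReal (T s.toNNReal f) := by
    have := DFunLike.congr_fun (hT.1.map_add (r - s).toNNReal s.toNNReal) f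
    rw [← Real.toNNReal_add (by linarith) hs, sub_add_cancel] at this
    exact this
  simp only [Function.comp, slope, vsub_eq_sub]
  rw [e, Real.coe_toNNReal _ (by linarith)]
  rw [← smul_one_smul 𝕜 ((r - s)⁻¹ : ℝ)]
  congr 1
  rw [RCLike.real_smul_eq_coe_mul, mul_one]

/-- A semigroup is determined by its generator when the latter is dissipative and
densely defined. -/
theorem IsSemigroupGeneratedBy.unique {T S : ℝ≥0 → H →L[𝕜] H} {B : H →ₗ.[𝕜] H}
    (hdense : Dense (B.domain : Set H))
    (hdiss : ∀ f g, (f, g) ∈ B.graph → RCLike.re (inner 𝕜 f g) ≤ 0)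
    (hT : IsSemigroupGeneratedBy T B) (hS : IsSemigroupGeneratedBy S B) : T = S := by
  let _ : NormedSpace ℝ H := NormedSpace.restrictScalars ℝ 𝕜 H
  have _ : IsScalarTower ℝ 𝕜 H := RestrictScalars.isScalarTower ℝ 𝕜 H
  funext t
  refine ContinuousLinearMap.ext_on (s := (B.domain : Set H)) (hdense.mono Submodule.subset_span)
    fun f hf => ?_
  have hg := B.mem_graph ⟨f, hf⟩
  set g := B ⟨f, hf⟩
  -- The difference of the two orbits solves the same dissipative equation and starts at `0`.
  have := norm_le_of_dissipative 𝕜 (u := fun r : ℝ => T r.toNNReal f - S r.toNNReal f)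
    (u' := fun r => T r.toNNReal g - S r.toNNReal g) (a := 0)
    (Continuous.continuousOn (((hT.1.continuous f).comp continuous_real_toNNReal).sub
      ((hS.1.continuous f).comp continuous_real_toNNReal)))
    (fun r hr => (hT.hasDerivWithinAt hg hr).sub (hS.hasDerivWithinAt hg hr))
    (fun r _ => hdiss _ _ (B.graph.sub_mem (hT.mem_graph hg r.toNNReal)
      (hS.mem_graph hg r.toNNReal))) (t := t) t.2
  rw [Real.toNNReal_coe] at this
  have h0 : T 0 f - S 0 f = 0 := by rw [hT.1.map_zero, hS.1.map_zero]; simp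
  simp only [Real.toNNReal_zero, h0, norm_zero] at this
  exact sub_eq_zero.1 (norm_le_zero_iff.1 this)

end Semigroups

/-! ### Resolvents of a nonnegative symmetric operator and Yosida approximations. -/

section Resolvents

variable {𝕜 : Type*} [RCLike 𝕜] {H : Type*} [NormedAddCommGroup H] [InnerProductSpace 𝕜 H]

/-- `A` is symmetric and nonnegative, and `R l` is a right inverse of `l + A` for `l > 0`. -/
structure IsNonnegWithResolvent (A : H →ₗ.[𝕜] H) (R : ℝ → H →L[𝕜] H) : Prop where
  symm : ∀ {f g f' g'}, (f, g) ∈ A.graph → (f', g') ∈ A.graph → inner 𝕜 f g' = inner 𝕜 g f'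
  nonneg : ∀ {f g}, (f, g) ∈ A.graph → 0 ≤ RCLike.re (inner 𝕜 f g)
  resolvent : ∀ {l : ℝ}, 0 < l → ∀ f, (R l f, f - (l : 𝕜) • R l f) ∈ A.graph

/-- The Yosida approximations of the negative of an operator with resolvents `R`. -/
noncomputable def yosida (R : ℝ → H →L[𝕜] H) (k : ℕ) : H →L[𝕜] H :=
  ((k + 1 : ℝ) : 𝕜) • (((k + 1 : ℝ) : 𝕜) • R (k + 1) - 1)

namespace IsNonnegWithResolvent

variable {A : H →ₗ.[𝕜] H} {R : ℝ → H →L[𝕜] H} (h : IsNonnegWithResolvent A R)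
include h

/-- The right inverse is also a left inverse: the discrepancy `d` satisfies `Ad = -l d`, and
nonnegativity of `A` forces `d = 0`. -/
theorem resolvent_apply {u w : H} (hu : (u, w) ∈ A.graph) {l : ℝ} (hl : 0 < l) :
    R l ((l : 𝕜) • u + w) = u := by
  have h1 := A.graph.sub_mem (h.resolvent hl ((l : 𝕜) • u + w)) hu
  set d := R l ((l : 𝕜) • u + w) - u with hd
  have h2 : (d, -((l : 𝕜) • d)) ∈ A.graph := by
    convert h1 using 1
    refine Prod.ext rfl ?_
    simp only [hd, Prod.snd_sub]
    module
  have h3 := h.nonneg h2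
  rw [inner_neg_right, inner_smul_right, map_neg, RCLike.re_ofReal_mul,
    inner_self_eq_norm_sq] at h3
  have : ‖d‖ ^ 2 ≤ 0 := by
    by_contra hh
    push Not at hh
    have := mul_pos hl hh
    linarith
  have : d = 0 := by
    have := (sq_nonpos_iff _).1 this
    exact norm_eq_zero.1 this
  exact sub_eq_zero.1 this

/-- Nonnegativity of `A` at `R l f` reads `l ‖R l f‖² ≤ Re ⟪R l f, f⟫`; Cauchy–Schwarz finishes. -/
theorem norm_resolvent_le {l : ℝ} (hl : 0 < l) (f : H) : l * ‖R l f‖ ≤ ‖f‖ := by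
  have h1 := h.nonneg (h.resolvent hl f)
  rw [inner_sub_right, inner_smul_right, map_sub, RCLike.re_ofReal_mul,
    inner_self_eq_norm_sq] at h1
  have h2 := (RCLike.re_le_norm (inner 𝕜 (R l f) f)).trans (norm_inner_le_norm _ _)
  rcases (norm_nonneg (R l f)).eq_or_lt with h0 | h0
  · rw [← h0]; simp
  · have : ‖R l f‖ * (l * ‖R l f‖) ≤ ‖R l f‖ * ‖f‖ := by nlinarith
    exact le_of_mul_le_mul_left this h0

theorem inner_resolvent {l : ℝ} (hl : 0 < l) (f g : H) :
    inner 𝕜 (R l f) g = inner 𝕜 f (R l g) := by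
  have h1 := h.symm (h.resolvent hl f) (h.resolvent hl g)
  rw [inner_sub_right, inner_sub_left, inner_smul_right, inner_smul_left, RCLike.conj_ofReal] at h1
  exact sub_left_inj.1 h1

/-- The resolvent identity `R m f = R l f + (l - m) R m (R l f)` is read off from the graph;
applying `R l` to its right-hand side returns `R m (R l f)`. -/
theorem commute_resolvent {l m : ℝ} (hl : 0 < l) (hm : 0 < m) : Commute (R l) (R m) := by
  refine ContinuousLinearMap.ext fun f => ?_
  change R l (R m f) = R m (R l f)
  have hu := h.resolvent hl f
  have hw := h.resolvent hm (R l f)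
  set u := R l f
  set w := R m u
  have hv : (u + ((l : 𝕜) - m) • w, (f - (l : 𝕜) • u) + ((l : 𝕜) - m) • (u - (m : 𝕜) • w))
      ∈ A.graph := A.graph.add_mem hu (A.graph.smul_mem _ hw)
  have h1 := h.resolvent_apply hv hm
  have e1 : (m : 𝕜) • (u + ((l : 𝕜) - m) • w) +
      ((f - (l : 𝕜) • u) + ((l : 𝕜) - m) • (u - (m : 𝕜) • w)) = f := by module
  rw [e1] at h1
  rw [h1]
  have h2 := h.resolvent_apply hw hl
  rw [← h2]
  congr 1
  rw [h2]
  module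

/-- A vector `w` orthogonal to the domain is orthogonal to `R 1 w`, so nonnegativity at `R 1 w`
leaves `-‖R 1 w‖² ≥ 0`. Then `R 1 w = 0`, which is possible only for `w = 0`. -/
theorem dense_domain [CompleteSpace H] : Dense (A.domain : Set H) := by
  rw [Submodule.dense_iff_topologicalClosure_eq_top, Submodule.topologicalClosure_eq_top_iff,
    Submodule.eq_bot_iff]
  intro w hw
  have h1 := h.resolvent one_pos w
  have h2 : inner 𝕜 (R 1 w) w = 0 :=
    (Submodule.mem_orthogonal _ _).1 hw _ (LinearPMap.mem_domain_of_mem_graph h1)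
  have h3 := h.nonneg h1
  rw [inner_sub_right, h2, inner_smul_right, zero_sub, map_neg, RCLike.re_ofReal_mul,
    inner_self_eq_norm_sq] at h3
  have h4 : R 1 w = 0 := by
    have : ‖R 1 w‖ ^ 2 ≤ 0 := by linarith
    exact norm_eq_zero.1 ((sq_nonpos_iff _).1 this)
  rw [h4] at h1
  simpa using A.graph_fst_eq_zero_snd h1 rfl

/-- Approximation of the identity by resolvents. -/
theorem tendsto_smul_resolvent [CompleteSpace H] (f : H) :
    Tendsto (fun k : ℕ => (((k + 1 : ℝ) : 𝕜)) • R (k + 1) f) atTop (𝓝 f) := by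
  have hpos : ∀ k : ℕ, (0 : ℝ) < k + 1 := fun k => by positivity
  rw [Metric.tendsto_atTop]
  intro ε hε
  obtain ⟨u, hu, hfu⟩ := h.dense_domain.exists_dist_lt f (show 0 < ε / 3 by positivity)
  have hw := A.mem_graph ⟨u, hu⟩
  set w := A ⟨u, hu⟩
  obtain ⟨K, hK⟩ := exists_nat_gt (‖w‖ / (ε / 3))
  refine ⟨K, fun k hk => ?_⟩
  -- On the domain the error is `-R (k + 1) (Au)`, of size `‖Au‖ / (k + 1)`; contractivity extends
  -- the convergence to all of `H`.
  have e1 : (((k + 1 : ℝ) : 𝕜)) • R (k + 1) u - u = - R (k + 1) w := by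
    have := h.resolvent_apply hw (hpos k)
    rw [map_add, map_smul] at this
    rw [sub_eq_iff_eq_add]
    exact eq_neg_add_of_add_eq (by rw [add_comm]; exact this)
  have e2 : ‖R (k + 1) w‖ < ε / 3 := by
    have h1 := h.norm_resolvent_le (hpos k) w
    rw [div_lt_iff₀ (by positivity)] at hK
    have h2 : (K : ℝ) ≤ k := by exact_mod_cast hk
    by_contra hh
    push Not at hh
    nlinarith [hpos k, norm_nonneg w]
  have e3 : ‖(((k + 1 : ℝ) : 𝕜)) • R (k + 1) (f - u)‖ ≤ ‖f - u‖ := by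
    rw [norm_smul, RCLike.norm_ofReal, abs_of_pos (hpos k)]
    exact h.norm_resolvent_le (hpos k) _
  rw [dist_eq_norm] at hfu ⊢
  have e4 : (((k + 1 : ℝ) : 𝕜)) • R (k + 1) f - f =
      (((k + 1 : ℝ) : 𝕜)) • R (k + 1) (f - u) + ((((k + 1 : ℝ) : 𝕜)) • R (k + 1) u - u)
        - (f - u) := by
    rw [map_sub]; module
  rw [e4, e1]
  calc _ ≤ ‖(((k + 1 : ℝ) : 𝕜)) • R (k + 1) (f - u)‖ + ‖R (k + 1) w‖ + ‖f - u‖ := by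
        refine (norm_sub_le _ _).trans ?_
        gcongr
        refine (norm_add_le _ _).trans ?_
        rw [norm_neg]
    _ < ε := by linarith

theorem yosida_diss (k : ℕ) (f : H) : RCLike.re (inner 𝕜 f (yosida R k f)) ≤ 0 := by
  have hpos : (0 : ℝ) < k + 1 := by positivity
  have h1 := h.norm_resolvent_le hpos f
  have h2 := (RCLike.re_le_norm (inner 𝕜 f (R (k + 1) f))).trans (norm_inner_le_norm _ _)
  have e : yosida R k f = ((k + 1 : ℝ) : 𝕜) • (((k + 1 : ℝ) : 𝕜) • R (k + 1) f - f) := rfl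
  rw [e, inner_smul_right, inner_sub_right, inner_smul_right, RCLike.re_ofReal_mul,
    map_sub, RCLike.re_ofReal_mul, inner_self_eq_norm_sq]
  have h3 : (k + 1 : ℝ) * RCLike.re (inner 𝕜 f (R (k + 1) f)) ≤ ‖f‖ * ‖f‖ := by
    calc _ ≤ (k + 1 : ℝ) * (‖f‖ * ‖R (k + 1) f‖) := by gcongr
      _ = ‖f‖ * ((k + 1 : ℝ) * ‖R (k + 1) f‖) := by ring
      _ ≤ _ := by gcongr
  nlinarith

theorem yosida_commute (j k : ℕ) : Commute (yosida R j) (yosida R k) := by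
  have := h.commute_resolvent (l := j + 1) (m := k + 1) (by positivity) (by positivity)
  unfold yosida
  refine Commute.smul_left (Commute.smul_right ?_ _) _
  refine Commute.sub_left (Commute.sub_right ?_ (Commute.one_right _)) (Commute.one_left _)
  exact Commute.smul_left (Commute.smul_right this _) _

/-- On the domain the Yosida approximation is `-A` followed by the approximate identity, hence it
converges to `-A` and is bounded by `‖Au‖` uniformly in `k`. -/
theorem yosida_apply (k : ℕ) {u w : H} (hu : (u, w) ∈ A.graph) :
    yosida R k u = -(((k + 1 : ℝ) : 𝕜) • R (k + 1) w) := by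
  have h1 := h.resolvent_apply hu (l := k + 1) (by positivity)
  rw [map_add, map_smul] at h1
  have e : yosida R k u = ((k + 1 : ℝ) : 𝕜) • (((k + 1 : ℝ) : 𝕜) • R (k + 1) u - u) := rfl
  rw [e, ← smul_neg]
  congr 1
  rw [sub_eq_iff_eq_add]
  exact eq_neg_add_of_add_eq (by rw [add_comm]; exact h1)

theorem norm_yosida_le (k : ℕ) {u w : H} (hu : (u, w) ∈ A.graph) : ‖yosida R k u‖ ≤ ‖w‖ := by
  have hpos : (0 : ℝ) < k + 1 := by positivity
  rw [h.yosida_apply k hu, norm_neg, norm_smul, RCLike.norm_ofReal, abs_of_pos hpos]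
  exact h.norm_resolvent_le hpos _

theorem isSelfAdjoint_yosida [CompleteSpace H] (k : ℕ) : IsSelfAdjoint (yosida R k) := by
  have hR : IsSelfAdjoint (R (k + 1)) := by
    rw [ContinuousLinearMap.isSelfAdjoint_iff_isSymmetric]
    exact fun f g => h.inner_resolvent (by positivity) f g
  have hc : IsSelfAdjoint (((k + 1 : ℝ) : 𝕜)) := RCLike.conj_ofReal _
  exact IsSelfAdjoint.smul hc ((IsSelfAdjoint.smul hc hR).sub (IsSelfAdjoint.one _))

end IsNonnegWithResolvent

end Resolvents

/-! ### The contraction semigroup generated by `-A`. -/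

section Generation

variable {𝕜 : Type*} [RCLike 𝕜] {H : Type*} [NormedAddCommGroup H] [InnerProductSpace 𝕜 H]

theorem mem_neg_graph {A : H →ₗ.[𝕜] H} {f g : H} :
    (f, g) ∈ (-A).graph ↔ (f, -g) ∈ A.graph := by
  simp only [LinearPMap.mem_graph_iff, LinearPMap.neg_apply]
  constructor
  · rintro ⟨y, rfl, hy⟩
    exact ⟨y, rfl, by rw [← hy, neg_neg]⟩
  · rintro ⟨y, rfl, hy⟩
    exact ⟨y, rfl, by rw [hy, neg_neg]⟩

namespace IsNonnegWithResolvent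

variable [CompleteSpace H] [NormedSpace ℝ H] [IsScalarTower ℝ 𝕜 H]
  {A : H →ₗ.[𝕜] H} {R : ℝ → H →L[𝕜] H} (h : IsNonnegWithResolvent A R)
include h

theorem norm_exp_yosida_le (k : ℕ) {t : ℝ} (ht : 0 ≤ t) (f : H) :
    ‖NormedSpace.exp ((t : 𝕜) • yosida R k) f‖ ≤ ‖f‖ :=
  norm_exp_apply_le (h.yosida_diss k) f ht

theorem tendsto_yosida {u w : H} (hu : (u, w) ∈ A.graph) :
    Tendsto (fun k => yosida R k u) atTop (𝓝 (-w)) := by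
  simp_rw [h.yosida_apply _ hu]
  exact (h.tendsto_smul_resolvent w).neg

/-- For `u` in the domain, `norm_exp_sub_exp_le` bounds differences by `t` times those of `yosida R
k u`, which converges; uniform contractivity and density extend the Cauchy property to every `f`. -/
theorem exists_tendsto_exp_yosida {t : ℝ} (ht : 0 ≤ t) (f : H) :
    ∃ g, Tendsto (fun k => NormedSpace.exp ((t : 𝕜) • yosida R k) f) atTop (𝓝 g) := by
  apply cauchySeq_tendsto_of_complete
  rw [Metric.cauchySeq_iff]
  intro ε hε
  obtain ⟨u, hu, hfu⟩ := h.dense_domain.exists_dist_lt f (show 0 < ε / 3 by positivity)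
  have hc := (h.tendsto_yosida (A.mem_graph ⟨u, hu⟩)).cauchySeq
  rw [Metric.cauchySeq_iff] at hc
  obtain ⟨K, hK⟩ := hc (ε / 3 / (t + 1)) (by positivity)
  refine ⟨K, fun m hm n hn => ?_⟩
  have h1 := hK m hm n hn
  rw [dist_eq_norm] at h1 hfu ⊢
  have h2 := norm_exp_sub_exp_le (h.yosida_commute n m) (h.yosida_diss n) (h.yosida_diss m) u ht
  have h3 : t * ‖yosida R m u - yosida R n u‖ ≤ ε / 3 := by
    calc _ ≤ (t + 1) * (ε / 3 / (t + 1)) := by gcongr; linarith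
      _ = _ := by field_simp
  have h4 := h.norm_exp_yosida_le m ht (f - u)
  have h5 := h.norm_exp_yosida_le n ht (f - u)
  set a := NormedSpace.exp ((t : 𝕜) • yosida R m)
  set b := NormedSpace.exp ((t : 𝕜) • yosida R n)
  have e : a f - b f = a (f - u) + (a u - b u) - b (f - u) := by
    simp only [map_sub]; abel
  rw [e]
  calc _ ≤ ‖a (f - u)‖ + ‖a u - b u‖ + ‖b (f - u)‖ :=
        (norm_sub_le _ _).trans (by gcongr; exact norm_add_le _ _)
    _ < ε := by linarith

/-- `-A` generates a contraction semigroup of symmetric operators. -/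
theorem exists_semigroup : ∃ T : ℝ≥0 → H →L[𝕜] H, IsSemigroupGeneratedBy T (-A) ∧
    (∀ t f, ‖T t f‖ ≤ ‖f‖) ∧ (∀ t f g, inner 𝕜 (T t f) g = inner 𝕜 f (T t g)) ∧
    ∀ f g, (f, g) ∈ A.graph → ∀ t : ℝ≥0, ‖T t f - f‖ ≤ t * ‖g‖ := by
  choose T₀ hT₀ using fun (t : ℝ≥0) => h.exists_tendsto_exp_yosida t.2
  let T : ℝ≥0 → H →L[𝕜] H := fun t => LinearMap.mkContinuous
    (linearMapOfTendsto (T₀ t) (fun k => (NormedSpace.exp (((t : ℝ) : 𝕜) • yosida R k) : H →L[𝕜] H))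
      (tendsto_pi_nhds.2 (hT₀ t))) 1 fun f => by
        rw [one_mul]
        exact le_of_tendsto (hT₀ t f).norm
          (Eventually.of_forall fun k => h.norm_exp_yosida_le k t.2 f)
  have hT : ∀ (t : ℝ≥0) f, Tendsto (fun k => NormedSpace.exp (((t : ℝ) : 𝕜) • yosida R k) f) atTop
    (𝓝 (T t f)) := hT₀
  have hcontr : ∀ t f, ‖T t f‖ ≤ ‖f‖ := fun t f =>
    le_of_tendsto (hT t f).norm (Eventually.of_forall fun k => h.norm_exp_yosida_le k t.2 f)
  have hsymm : ∀ t f g, inner 𝕜 (T t f) g = inner 𝕜 f (T t g) := by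
    intro t f g
    refine tendsto_nhds_unique ((hT t f).inner tendsto_const_nhds)
      ((tendsto_const_nhds.inner (hT t g)).congr fun k => ?_)
    have h1 : IsSelfAdjoint (NormedSpace.exp (((t : ℝ) : 𝕜) • yosida R k)) := by
      apply IsSelfAdjoint.exp
      have hc : IsSelfAdjoint (((t : ℝ) : 𝕜)) := RCLike.conj_ofReal _
      exact IsSelfAdjoint.smul hc (h.isSelfAdjoint_yosida k)
    rw [ContinuousLinearMap.isSelfAdjoint_iff_isSymmetric] at h1
    exact (h1 f g).symm
  -- distance of the Yosida semigroups to the identity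
  have hk1 : ∀ k {f g}, (f, g) ∈ A.graph → ∀ t : ℝ, 0 ≤ t →
      ‖NormedSpace.exp ((t : 𝕜) • yosida R k) f - f‖ ≤ t * ‖g‖ := by
    intro k f g hfg t ht
    have := norm_exp_sub_exp_le (a := 0) (Commute.zero_left (yosida R k)) (by simp)
      (h.yosida_diss k) f ht
    simp only [smul_zero, NormedSpace.exp_zero, one_apply_eq_self,
      zero_apply, sub_zero] at this
    exact this.trans (by gcongr; exact h.norm_yosida_le k hfg)
  have h1 : ∀ f g, (f, g) ∈ A.graph → ∀ t : ℝ≥0, ‖T t f - f‖ ≤ t * ‖g‖ := fun f g hfg t =>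
    le_of_tendsto ((hT t f).sub_const f).norm (Eventually.of_forall fun k => hk1 k hfg t t.2)
  have hzero : T 0 = ContinuousLinearMap.id 𝕜 H := by
    ext f
    refine tendsto_nhds_unique (hT 0 f) (tendsto_const_nhds.congr fun k => ?_)
    simp
  have hadd : ∀ s t, T (s + t) = (T s).comp (T t) := by
    intro s t
    ext f
    refine tendsto_nhds_unique (hT (s + t) f) ?_
    have e : ∀ k, NormedSpace.exp ((((s + t : ℝ≥0) : ℝ) : 𝕜) • yosida R k) f =
        NormedSpace.exp (((s : ℝ) : 𝕜) • yosida R k)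
          (NormedSpace.exp (((t : ℝ) : 𝕜) • yosida R k) f) := by
      intro k
      have := exp_add_of_commute_smul (Commute.refl (yosida R k)) s t
      rw [← add_smul] at this
      push_cast
      rw [this]; rfl
    simp_rw [e]
    -- Inside the outer exponential, the inner one is replaced by its limit `T t f`; the error is
    -- harmless since the outer exponentials are contractions uniformly in `k`.
    have h2 := hT s (T t f)
    rw [ContinuousLinearMap.comp_apply]
    refine (h2.add (g := fun k => NormedSpace.exp (((s : ℝ) : 𝕜) • yosida R k)
      (NormedSpace.exp (((t : ℝ) : 𝕜) • yosida R k) f - T t f)) (b := 0) ?_).congr ?_ |>.trans ?_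
    · refine squeeze_zero_norm (fun k => h.norm_exp_yosida_le k s.2 _) ?_
      have := ((hT t f).sub_const (T t f)).norm
      simpa using this
    · intro k; rw [← map_add]; congr 1; abel
    · rw [add_zero]
  have hdiff : ∀ (s t : ℝ≥0) f, s ≤ t → ‖T t f - T s f‖ ≤ ‖T (t - s) f - f‖ := by
    intro s t f hst
    have : T t f = T s (T (t - s) f) := by
      rw [← ContinuousLinearMap.comp_apply, ← hadd, add_tsub_cancel_of_le hst]
    rw [this, ← map_sub]
    exact hcontr _ _
  have hcont0 : ∀ f, Continuous fun t => T t f := by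
    intro f
    have hu : ∀ u ∈ A.domain, Continuous fun t => T t u := by
      intro u hu
      have hg := A.mem_graph ⟨u, hu⟩
      refine (LipschitzWith.of_dist_le_mul (K := ⟨‖A ⟨u, hu⟩‖, norm_nonneg _⟩)
        fun t s => ?_).continuous
      wlog hst : s ≤ t generalizing s t
      · rw [dist_comm, dist_comm t]
        exact this s t (le_of_not_ge hst)
      rw [dist_eq_norm]
      refine (hdiff s t u hst).trans ((h1 _ _ hg _).trans ?_)
      rw [NNReal.dist_eq, NNReal.coe_sub hst, mul_comm]
      exact mul_le_mul_of_nonneg_left (le_abs_self _) (norm_nonneg _)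
    rw [continuous_iff_continuousAt]
    intro t
    rw [Metric.continuousAt_iff]
    intro ε hε
    obtain ⟨u, hud, hfu⟩ := h.dense_domain.exists_dist_lt f (show 0 < ε / 3 by positivity)
    obtain ⟨δ, hδ, hh⟩ := Metric.continuousAt_iff.1 (hu u hud).continuousAt (ε / 3)
      (by positivity)
    refine ⟨δ, hδ, fun {s} hs => ?_⟩
    have h2 := hh hs
    rw [dist_eq_norm] at h2 hfu ⊢
    have e : T s f - T t f = T s (f - u) + (T s u - T t u) - T t (f - u) := by
      simp only [map_sub]; abel
    rw [e]
    calc _ ≤ ‖T s (f - u)‖ + ‖T s u - T t u‖ + ‖T t (f - u)‖ :=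
          (norm_sub_le _ _).trans (by gcongr; exact norm_add_le _ _)
      _ < ε := by linarith [hcontr s (f - u), hcontr t (f - u)]
  -- second order estimate
  have h2 : ∀ u w w' z : H, (u, w) ∈ A.graph → (w', z) ∈ A.graph → ∀ t : ℝ≥0,
      ‖T t u - u + ((t : ℝ) : 𝕜) • w‖ ≤ t * (2 * ‖w - w'‖ + t * ‖z‖) := by
    intro u w w' z hu hw' t
    have hk : ∀ k, ‖NormedSpace.exp (((t : ℝ) : 𝕜) • yosida R k) u - u -
        ((t : ℝ) : 𝕜) • yosida R k u‖ ≤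
        t * (2 * ‖-(yosida R k u) - w'‖ + t * ‖z‖) := by
      intro k
      set a := yosida R k
      have := norm_image_sub_le_of_norm_deriv_le_segment'
        (f := fun s : ℝ => NormedSpace.exp ((s : 𝕜) • a) u - (s : 𝕜) • a u) (a := 0) (b := t)
        (C := 2 * ‖-(a u) - w'‖ + t * ‖z‖)
        (f' := fun s => NormedSpace.exp ((s : 𝕜) • a) (a u) - a u)
        (fun s _ => by
          refine ((hasDerivAt_exp_apply a u s).sub ?_).hasDerivWithinAt
          have h3 : HasDerivAt (fun t : ℝ => (t : 𝕜)) 1 s := by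
            simpa using (RCLike.ofRealCLM (K := 𝕜)).hasDerivAt (x := s)
          simpa using h3.smul_const (a u))
        (fun s hs => by
          -- The vector `w = Au` need not lie in the domain, so it is compared with `w'` that does:
          -- contractivity controls the difference (whence the factor `2`), and `hk1` the motion of
          -- `w'`.
          have e1 : NormedSpace.exp ((s : 𝕜) • a) (a u) - a u =
            (-(a u) - w') - NormedSpace.exp ((s : 𝕜) • a) (-(a u) - w') -
              (NormedSpace.exp ((s : 𝕜) • a) w' - w') := by
            simp only [map_sub, map_neg]; abel
          rw [e1]
          have h4 := h.norm_exp_yosida_le k hs.1 (-(a u) - w')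
          have h5 := hk1 k hw' s hs.1
          have h6 : s * ‖z‖ ≤ t * ‖z‖ := by gcongr; exact hs.2.le
          refine (norm_sub_le _ _).trans ?_
          have h7 := norm_sub_le (-(a u) - w') (NormedSpace.exp ((s : 𝕜) • a) (-(a u) - w'))
          linarith) t (Set.right_mem_Icc.2 t.2)
      simp only [RCLike.ofReal_zero, zero_smul, NormedSpace.exp_zero,
        one_apply_eq_self, sub_zero] at this
      calc _ = ‖NormedSpace.exp (((t : ℝ) : 𝕜) • a) u - ((t : ℝ) : 𝕜) • a u - u‖ := by
            congr 1; abel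
        _ ≤ _ := this
        _ = _ := by ring
    have hy := h.tendsto_yosida hu
    have l1 := (((hT t u).sub_const u).sub (hy.const_smul (((t : ℝ) : 𝕜)))).norm
    have l2 := (((((hy.neg).sub_const w').norm.const_mul 2).add_const ((t : ℝ) * ‖z‖)).const_mul
      (t : ℝ))
    have := le_of_tendsto_of_tendsto' l1 l2 hk
    simpa [smul_neg, sub_neg_eq_add] using this
  have hgen : ∀ u w, (u, w) ∈ A.graph →
      Tendsto (fun t : ℝ≥0 => (((t : ℝ)⁻¹ : ℝ) : 𝕜) • (T t u - u)) (𝓝[>] 0) (𝓝 (-w)) := by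
    intro u w hu
    rw [Metric.tendsto_nhds]
    intro ε hε
    obtain ⟨w', hw', hww⟩ := h.dense_domain.exists_dist_lt w (show 0 < ε / 4 by positivity)
    have hz := A.mem_graph ⟨w', hw'⟩
    set z := A ⟨w', hw'⟩
    have hδ : 0 < (ε / 2 / (‖z‖ + 1)).toNNReal := Real.toNNReal_pos.2 (by positivity)
    filter_upwards [Ioo_mem_nhdsGT hδ] with t ht
    have ht0 : (0 : ℝ) < t := ht.1
    have ht1 : (t : ℝ) < ε / 2 / (‖z‖ + 1) := Real.lt_toNNReal_iff_coe_lt.1 ht.2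
    rw [lt_div_iff₀ (by positivity)] at ht1
    have h3 := h2 u w w' z hu hz t
    rw [dist_eq_norm] at hww ⊢
    have e : (((t : ℝ)⁻¹ : ℝ) : 𝕜) • (T t u - u) - -w =
        (((t : ℝ)⁻¹ : ℝ) : 𝕜) • (T t u - u + ((t : ℝ) : 𝕜) • w) := by
      rw [smul_add, smul_smul, ← RCLike.ofReal_mul, inv_mul_cancel₀ ht0.ne',
        RCLike.ofReal_one, one_smul, sub_neg_eq_add]
    rw [e, norm_smul, RCLike.norm_ofReal, abs_of_pos (by positivity)]
    calc (t : ℝ)⁻¹ * ‖T t u - u + ((t : ℝ) : 𝕜) • w‖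
        ≤ (t : ℝ)⁻¹ * (t * (2 * ‖w - w'‖ + t * ‖z‖)) := by gcongr
      _ = 2 * ‖w - w'‖ + t * ‖z‖ := by field_simp
      _ < ε := by nlinarith [norm_nonneg z]
  refine ⟨T, ⟨⟨hzero, hadd, hcont0⟩, fun f g => ⟨fun hfg => ?_, fun hfg => ?_⟩⟩, hcontr, hsymm, h1⟩
  · simpa using hgen f (-g) (mem_neg_graph.1 hfg)
  -- The generator is no larger than `-A`. With `u = R 1 (f - g)`, the vector `d = f - u` has
  -- difference quotients tending to `d` itself, whereas contractivity gives them nonpositive real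
  -- inner product with `d`. Hence `f = u` lies in the domain.
  · have hu := h.resolvent one_pos (f - g)
    set u := R 1 (f - g) with hudef
    rw [RCLike.ofReal_one, one_smul] at hu
    have h3 := hfg.sub (hgen _ _ hu)
    have h4 : Tendsto (fun t : ℝ≥0 => (((t : ℝ)⁻¹ : ℝ) : 𝕜) • (T t (f - u) - (f - u))) (𝓝[>] 0)
        (𝓝 (f - u)) := by
      have e : g - -(f - g - u) = f - u := by abel
      rw [e] at h3
      refine h3.congr fun t => ?_
      rw [map_sub, ← smul_sub]
      congr 1; abel
    have h5 := (RCLike.continuous_re.tendsto _).comp (h4.inner (𝕜 := 𝕜)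
      (tendsto_const_nhds (x := f - u)))
    have h6 : RCLike.re (inner 𝕜 (f - u) (f - u)) ≤ 0 := by
      refine le_of_tendsto h5 (Eventually.of_forall fun t => ?_)
      generalize f - u = d
      rw [Function.comp, inner_smul_left, RCLike.conj_ofReal, RCLike.re_ofReal_mul,
        inner_sub_left, map_sub, inner_self_eq_norm_sq]
      refine mul_nonpos_of_nonneg_of_nonpos (inv_nonneg.2 t.2) ?_
      have h7 := (RCLike.re_le_norm (inner 𝕜 (T t d) d)).trans (norm_inner_le_norm _ _)
      nlinarith [hcontr t d, norm_nonneg d]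
    rw [inner_self_eq_norm_sq, sq_nonpos_iff, norm_eq_zero, sub_eq_zero] at h6
    rw [mem_neg_graph]
    rw [← h6] at hu
    simpa using hu

end IsNonnegWithResolvent

end Generation

/-! ### The operator associated with the form of a closed operator. -/

section FormOperator

variable {𝕜 : Type*} [RCLike 𝕜] {H : Type*} [NormedAddCommGroup H] [InnerProductSpace 𝕜 H]

/-- Density of the domain determines the second component of `formGraph`, so it is a genuine graph
and `toLinearPMap` loses nothing. -/
theorem formOperator_graph {B : H →ₗ.[𝕜] H} (hd : Dense (B.domain : Set H)) :
    (formOperator B).graph = formGraph B := by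
  refine Submodule.toLinearPMap_graph_eq _ ?_
  rintro ⟨a, w⟩ ⟨u, hu, hw⟩ ha
  simp only at hu hw ha ⊢
  have hu0 : u = 0 := Subtype.ext (by rw [hu, ha]; rfl)
  refine hd.eq_zero_of_mem_orthogonal (𝕜 := 𝕜) ?_
  rw [Submodule.mem_orthogonal]
  intro v hv
  rw [← hw ⟨v, hv⟩, hu0, LinearPMap.map_zero, inner_zero_right]

/-- The resolvents of the operator associated with the form of a closed operator. -/
theorem exists_formGraph_resolvent [CompleteSpace H] {B : H →ₗ.[𝕜] H} (hB : B.IsClosed)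
    {l : ℝ} (hl : 0 < l) :
    ∃ R : H →L[𝕜] H, ∀ f, (R f, f - (l : 𝕜) • R f) ∈ formGraph B := by
  set s : ℝ := Real.sqrt l with hs
  have hs0 : 0 < s := Real.sqrt_pos.2 hl
  have hss : s * s = l := Real.mul_self_sqrt hl.le
  have hsk : (s : 𝕜) ≠ 0 := by exact_mod_cast hs0.ne'
  -- The weak equation for `(l + B*B)u = f` says that `(√l u, Bu)` is the orthogonal projection of
  -- `(f/√l, 0)` onto `K = {(√l v, Bv)}` in the Hilbert product. `Φ` undoes the scaling by `√l`, so
  -- `K` is the preimage of the graph of `B` and is closed.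
  let Φ : WithLp 2 (H × H) →L[𝕜] H × H :=
    (((s : 𝕜)⁻¹) • WithLp.fstL 2 𝕜 H H).prod (WithLp.sndL 2 𝕜 H H)
  let K : Submodule 𝕜 (WithLp 2 (H × H)) := B.graph.comap Φ.toLinearMap
  have hK : IsClosed (K : Set (WithLp 2 (H × H))) := by
    have : (K : Set (WithLp 2 (H × H))) = Φ ⁻¹' B.graph := rfl
    rw [this]
    exact IsClosed.preimage Φ.continuous hB
  have : CompleteSpace K := hK.completeSpace_coe
  let ι : H →L[𝕜] WithLp 2 (H × H) :=
    ((WithLp.prodContinuousLinearEquiv 2 𝕜 H H).symm : H × H →L[𝕜] WithLp 2 (H × H)) ∘L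
      (ContinuousLinearMap.inl 𝕜 H H) ∘L ((s : 𝕜)⁻¹ • ContinuousLinearMap.id 𝕜 H)
  refine ⟨(s : 𝕜)⁻¹ • (WithLp.fstL 2 𝕜 H H ∘L K.starProjection ∘L ι), fun f => ?_⟩
  set p := K.starProjection (ι f) with hp
  have hpK : Φ p ∈ B.graph := K.starProjection_apply_mem (ι f)
  change ((s : 𝕜)⁻¹ • p.fst, f - (l : 𝕜) • (s : 𝕜)⁻¹ • p.fst) ∈ formGraph B
  have hΦ : Φ p = ((s : 𝕜)⁻¹ • p.fst, p.snd) := rfl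
  rw [hΦ] at hpK
  obtain ⟨u, hu, hBu⟩ := (LinearPMap.mem_graph_iff _).1 hpK
  refine ⟨u, hu, fun v => ?_⟩
  have hq : (WithLp.toLp 2 ((s : 𝕜) • (v : H), B v) : WithLp 2 (H × H)) ∈ K := by
    change ((s : 𝕜)⁻¹ • (s : 𝕜) • (v : H), B v) ∈ B.graph
    rw [smul_smul, inv_mul_cancel₀ hsk, one_smul]
    exact B.mem_graph v
  have h1 := K.starProjection_inner_eq_zero (ι f) _ hq
  rw [← inner_conj_symm, map_eq_zero, WithLp.prod_inner_apply] at h1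
  have e1 : (ι f - K.starProjection (ι f)).ofLp.1 = (s : 𝕜)⁻¹ • f - p.fst := rfl
  have e2 : (ι f - K.starProjection (ι f)).ofLp.2 = 0 - p.snd := rfl
  rw [e1, e2] at h1
  simp only at h1
  rw [zero_sub, inner_neg_right, ← sub_eq_add_neg, sub_eq_zero] at h1
  simp only at hBu
  rw [hBu, ← h1, inner_smul_left, RCLike.conj_ofReal, ← inner_smul_right]
  congr 1
  rw [smul_sub, smul_smul, mul_inv_cancel₀ hsk, one_smul, smul_smul, ← hss]
  push_cast
  rw [mul_assoc, mul_inv_cancel₀ hsk, mul_one]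

theorem exists_isNonnegWithResolvent_formOperator [CompleteSpace H] {B : H →ₗ.[𝕜] H}
    (hB : B.IsClosed) (hd : Dense (B.domain : Set H)) :
    ∃ R, IsNonnegWithResolvent (formOperator B) R := by
  have hR : ∀ l : ℝ, ∃ R : H →L[𝕜] H, 0 < l → ∀ f, (R f, f - (l : 𝕜) • R f) ∈ formGraph B := by
    intro l
    by_cases hl : 0 < l
    · obtain ⟨R, hR⟩ := exists_formGraph_resolvent hB hl
      exact ⟨R, fun _ => hR⟩
    · exact ⟨0, fun h => absurd h hl⟩
  choose R hR using hR
  refine ⟨R, ?_, ?_, ?_⟩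
  · intro f g f' g' h h'
    rw [formOperator_graph hd] at h h'
    obtain ⟨u, hu, h⟩ := h
    obtain ⟨u', hu', h'⟩ := h'
    simp only at hu hu' h h'
    rw [← hu, ← hu', ← h' u, ← inner_conj_symm, h u', inner_conj_symm]
  · intro f g h
    rw [formOperator_graph hd] at h
    obtain ⟨u, hu, h⟩ := h
    simp only at hu h
    rw [← hu, ← h u, inner_self_eq_norm_sq]
    positivity
  · intro l hl f
    rw [formOperator_graph hd]
    exact hR l hl f

/-- Testing `Au = 0` with `u` itself gives `‖Bu‖² = 0`; this and the next lemma identify the kernels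
of `A` and `B`. -/
theorem mem_graph_of_formOperator_zero {B : H →ₗ.[𝕜] H} (hd : Dense (B.domain : Set H)) {u : H}
    (h : (u, 0) ∈ (formOperator B).graph) : (u, 0) ∈ B.graph := by
  rw [formOperator_graph hd] at h
  obtain ⟨u', hu', h⟩ := h
  simp only at hu' h
  have h1 := h u'
  rw [inner_zero_right, inner_self_eq_zero] at h1
  rw [← hu', ← h1]
  exact B.mem_graph u'

theorem formOperator_zero_of_mem_graph {B : H →ₗ.[𝕜] H} (hd : Dense (B.domain : Set H)) {u : H}
    (h : (u, 0) ∈ B.graph) : (u, 0) ∈ (formOperator B).graph := by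
  rw [formOperator_graph hd]
  obtain ⟨u', hu', h⟩ := (LinearPMap.mem_graph_iff _).1 h
  refine ⟨u', hu', fun v => ?_⟩
  simp only at h ⊢
  rw [h, inner_zero_right, inner_zero_right]

end FormOperator

/-! ### Strong convergence to the projection onto the kernel. -/

section Asymptotics

variable {𝕜 : Type*} [RCLike 𝕜] {H : Type*} [NormedAddCommGroup H] [InnerProductSpace 𝕜 H]
  [CompleteSpace H] {A : H →ₗ.[𝕜] H} {R : ℝ → H →L[𝕜] H} {e : H}

namespace IsNonnegWithResolvent

/-- Strong convergence to the projection onto a one-dimensional kernel, for `t → ∞`. -/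
theorem tendsto_semigroup (he : ‖e‖ = 1)
    (hker : ∀ u, (u, 0) ∈ A.graph → ∃ c : 𝕜, u = c • e)
    {T : ℝ≥0 → H →L[𝕜] H} (hT : IsSemigroupGeneratedBy T (-A)) (hTe : ∀ t, T t e = e)
    (hcontr : ∀ t f, ‖T t f‖ ≤ ‖f‖) (hsymm : ∀ t f g, inner 𝕜 (T t f) g = inner 𝕜 f (T t g))
    (f : H) : Tendsto (fun t => T t f) atTop (𝓝 (inner 𝕜 e f • e)) := by
  have hadd : ∀ s t f, T (s + t) f = T s (T t f) := fun s t f =>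
    DFunLike.congr_fun (hT.1.map_add s t) f
  have hanti : Antitone fun t => ‖T t f‖ ^ 2 := by
    intro s t hst
    have : T t f = T (t - s) (T s f) := by rw [← hadd, tsub_add_cancel_of_le hst]
    simp only [this]
    gcongr
    exact hcontr _ _
  have hlim := tendsto_atTop_ciInf hanti ⟨0, by rintro _ ⟨t, rfl⟩; positivity⟩
  set c := ⨅ t, ‖T t f‖ ^ 2
  -- By symmetry and the semigroup law both sides are `⟪f, T (s + t) f⟫`. Thus `‖T s f - T t f‖²`
  -- involves only values of the nonincreasing function `‖T · f‖²`, and its convergence makes the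
  -- orbit Cauchy.
  have hinner : ∀ s t, RCLike.re (inner 𝕜 (T s f) (T t f)) = ‖T ((s + t) / 2) f‖ ^ 2 := by
    intro s t
    rw [hsymm, ← hadd, ← inner_self_eq_norm_sq (𝕜 := 𝕜), hsymm, ← hadd, add_halves]
  have hsq : ∀ s t, ‖T s f - T t f‖ ^ 2 =
      ‖T s f‖ ^ 2 - 2 * ‖T ((s + t) / 2) f‖ ^ 2 + ‖T t f‖ ^ 2 := by
    intro s t
    rw [norm_sub_sq (𝕜 := 𝕜), hinner]
  have hcauchy : Cauchy (Filter.map (fun t => T t f) atTop) := by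
    rw [Metric.cauchy_iff]
    refine ⟨inferInstance, fun ε hε => ?_⟩
    obtain ⟨t₀, ht₀⟩ := ((tendsto_order.1 hlim).2 (c + ε ^ 2 / 2)
      (by linarith [pow_pos hε 2])).exists
    refine ⟨(fun t => T t f) '' Set.Ici t₀, image_mem_map (Ici_mem_atTop t₀), ?_⟩
    rintro _ ⟨s, hs, rfl⟩ _ ⟨t, ht, rfl⟩
    have hs : t₀ ≤ s := hs
    have ht : t₀ ≤ t := ht
    rw [dist_eq_norm]
    have h1 := hsq s t
    have h2 : ‖T s f‖ ^ 2 ≤ ‖T t₀ f‖ ^ 2 := hanti hs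
    have h3 : ‖T t f‖ ^ 2 ≤ ‖T t₀ f‖ ^ 2 := hanti ht
    have h4 : c ≤ ‖T ((s + t) / 2) f‖ ^ 2 := hanti.le_of_tendsto hlim _
    have h5 : ‖T s f - T t f‖ ^ 2 < ε ^ 2 := by linarith
    exact lt_of_pow_lt_pow_left₀ 2 hε.le h5
  obtain ⟨g, hg⟩ := CompleteSpace.complete hcauchy
  have hg : Tendsto (fun t => T t f) atTop (𝓝 g) := hg
  have hTg : ∀ s, T s g = g := by
    intro s
    have h1 := ((T s).continuous.tendsto g).comp hg
    have h2 : Tendsto (fun t => T (s + t) f) atTop (𝓝 g) :=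
      hg.comp (tendsto_atTop_mono (fun _ => le_add_self) tendsto_id)
    exact tendsto_nhds_unique h1 (h2.congr fun t => hadd s t f)
  have hgA : (g, 0) ∈ (-A).graph := by
    rw [hT.2]
    simp [hTg]
  rw [mem_neg_graph, neg_zero] at hgA
  obtain ⟨d, hd⟩ := hker g hgA
  have h1 : inner 𝕜 e g = inner 𝕜 e f := by
    refine tendsto_nhds_unique (tendsto_const_nhds.inner hg) (tendsto_const_nhds.congr fun t => ?_)
    rw [← hsymm, hTe]
  rw [hd, inner_smul_right, inner_self_eq_norm_sq_to_K, he] at h1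
  have h2 : d = inner 𝕜 e f := by simpa using h1
  rwa [← h2, ← hd]

/-- Strong convergence to the projection onto a one-dimensional kernel, for `l → 0`. -/
theorem tendsto_resolvent (h : IsNonnegWithResolvent A R) (he : ‖e‖ = 1) (heA : (e, 0) ∈ A.graph)
    (hker : ∀ u, (u, 0) ∈ A.graph → ∃ c : 𝕜, u = c • e) (f : H) :
    Tendsto (fun l : ℝ => (l : 𝕜) • R l f) (𝓝[>] 0) (𝓝 (inner 𝕜 e f • e)) := by
  have hRe : ∀ l : ℝ, 0 < l → (l : 𝕜) • R l e = e := by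
    intro l hl
    have := h.resolvent_apply heA hl
    rwa [add_zero, map_smul] at this
  -- convergence on the range of `A`
  let S : Submodule 𝕜 H := A.graph.map (LinearMap.snd 𝕜 H H)
  -- If `w` is orthogonal to the range of `A`, it is orthogonal to `w - R 1 w = A (R 1 w)`;
  -- nonnegativity then gives `w = R 1 w`, that is `Aw = 0`. So the complement of `e` lies in the
  -- closure of the range.
  have hS : Sᗮ ≤ Submodule.span 𝕜 {e} := by
    intro w hw
    have h1 := h.resolvent one_pos w
    rw [RCLike.ofReal_one, one_smul] at h1
    have h2 : inner 𝕜 (w - R 1 w) w = 0 := (Submodule.mem_orthogonal _ _).1 hw _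
      ⟨_, h1, rfl⟩
    have h3 := h.norm_resolvent_le one_pos w
    rw [one_mul] at h3
    have h4 := h.nonneg h1
    have h5 : RCLike.re (inner 𝕜 (w - R 1 w) (w - R 1 w)) ≤ 0 := by
      rw [inner_sub_right, h2, zero_sub, map_neg, inner_re_symm]
      linarith
    rw [inner_self_eq_norm_sq, sq_nonpos_iff, norm_eq_zero] at h5
    rw [h5, ← sub_eq_zero.1 h5] at h1
    obtain ⟨c, hc⟩ := hker w h1
    exact Submodule.mem_span_singleton.2 ⟨c, hc.symm⟩
  have hzero : ∀ g, inner 𝕜 e g = 0 → Tendsto (fun l : ℝ => (l : 𝕜) • R l g) (𝓝[>] 0) (𝓝 0) := by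
    intro g hg
    have hgS : g ∈ S.topologicalClosure := by
      rw [← Submodule.orthogonal_orthogonal_eq_closure, Submodule.mem_orthogonal]
      intro w hw
      obtain ⟨c, rfl⟩ := Submodule.mem_span_singleton.1 (hS hw)
      rw [inner_smul_left, hg, mul_zero]
    rw [Metric.tendsto_nhds]
    intro ε hε
    obtain ⟨y, hy, hgy⟩ := Metric.mem_closure_iff.1
      (show g ∈ closure (S : Set H) from hgS) (ε / 2) (by positivity)
    obtain ⟨⟨u, y'⟩, hu, rfl⟩ := hy
    simp only [LinearMap.snd_apply] at hgy
    filter_upwards [Ioo_mem_nhdsGT (show (0 : ℝ) < ε / 2 / (2 * ‖u‖ + 1) by positivity)] with l hl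
    have hl0 := hl.1
    have hl1 := hl.2
    rw [lt_div_iff₀ (by positivity)] at hl1
    have h1 := h.resolvent_apply hu hl0
    rw [map_add, map_smul] at h1
    have hn : ∀ v, ‖(l : 𝕜) • R l v‖ ≤ ‖v‖ := fun v => by
      rw [norm_smul, RCLike.norm_ofReal, abs_of_pos hl0]
      exact h.norm_resolvent_le hl0 v
    -- For `y' = Au`, this makes `l R l y'` of norm at most `2 l ‖u‖`.
    have h2 : R l y' = u - (l : 𝕜) • R l u := eq_sub_of_add_eq' h1
    rw [dist_zero_right]
    rw [dist_eq_norm] at hgy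
    have e1 : (l : 𝕜) • R l g = (l : 𝕜) • R l (g - y') + (l : 𝕜) • (u - (l : 𝕜) • R l u) := by
      rw [← h2, map_sub]; module
    rw [e1]
    calc _ ≤ ‖(l : 𝕜) • R l (g - y')‖ + ‖(l : 𝕜) • (u - (l : 𝕜) • R l u)‖ := norm_add_le _ _
      _ ≤ ‖g - y'‖ + l * (‖u‖ + ‖u‖) := by
          gcongr
          · exact hn _
          · rw [norm_smul, RCLike.norm_ofReal, abs_of_pos hl0]
            gcongr
            exact (norm_sub_le _ _).trans (by gcongr; exact hn _)
      _ < ε := by linarith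
  have h1 : inner 𝕜 e (f - inner 𝕜 e f • e) = 0 := by
    rw [inner_sub_right, inner_smul_right, inner_self_eq_norm_sq_to_K, he]; simp
  have h2 := (hzero _ h1).add_const (inner 𝕜 e f • e)
  rw [zero_add] at h2
  refine h2.congr' ?_
  filter_upwards [self_mem_nhdsWithin] with l hl
  rw [map_sub, map_smul, smul_sub, smul_comm (l : 𝕜) (inner 𝕜 e f), hRe l hl, sub_add_cancel]

theorem isResolventOf (h : IsNonnegWithResolvent A R) {l : ℝ} (hl : 0 < l) :
    IsResolventOf (-A) (l : 𝕜) (R l) := by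
  constructor
  · intro f
    obtain ⟨u, hu, hAu⟩ := (LinearPMap.mem_graph_iff _).1 (h.resolvent hl f)
    simp only at hu hAu
    refine ⟨u, hu, ?_⟩
    rw [LinearPMap.neg_apply, hAu, hu]
    abel
  · intro u
    rw [LinearPMap.neg_apply, sub_neg_eq_add]
    exact h.resolvent_apply (A.mem_graph u) hl

end IsNonnegWithResolvent

/-- Generation and asymptotics for the form operator of a closed operator whose kernel is
spanned by a unit vector. -/
theorem formOperator_generation {B : H →ₗ.[𝕜] H} (hB : B.IsClosed)
    (hd : Dense (B.domain : Set H)) (he : ‖e‖ = 1) (heB : (e, 0) ∈ B.graph)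
    (hker : ∀ u, (u, 0) ∈ B.graph → ∃ c : 𝕜, u = c • e) :
    (∃! T : ℝ≥0 → H →L[𝕜] H, IsSemigroupGeneratedBy T (-formOperator B)) ∧
    (∀ T : ℝ≥0 → H →L[𝕜] H, IsSemigroupGeneratedBy T (-formOperator B) →
      ∀ f, Tendsto (fun t => T t f) atTop (𝓝 (inner 𝕜 e f • e))) ∧
    ∃ R : ℝ → H →L[𝕜] H, (∀ l : ℝ, 0 < l → IsResolventOf (-formOperator B) (l : 𝕜) (R l)) ∧
      ∀ f, Tendsto (fun l : ℝ => (l : 𝕜) • R l f) (𝓝[>] 0) (𝓝 (inner 𝕜 e f • e)) := by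
  let _ : NormedSpace ℝ H := NormedSpace.restrictScalars ℝ 𝕜 H
  have _ : IsScalarTower ℝ 𝕜 H := RestrictScalars.isScalarTower ℝ 𝕜 H
  obtain ⟨R, hR⟩ := exists_isNonnegWithResolvent_formOperator hB hd
  obtain ⟨T, hT, hcontr, hsymm, hT1⟩ := hR.exists_semigroup
  have heA := formOperator_zero_of_mem_graph hd heB
  have hkerA : ∀ u, (u, 0) ∈ (formOperator B).graph → ∃ c : 𝕜, u = c • e := fun u hu =>
    hker u (mem_graph_of_formOperator_zero hd hu)
  have huniq : ∀ S : ℝ≥0 → H →L[𝕜] H, IsSemigroupGeneratedBy S (-formOperator B) → S = T := by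
    intro S hS
    refine IsSemigroupGeneratedBy.unique (B := -formOperator B) hR.dense_domain (fun f g hfg => ?_) hS hT
    have := hR.nonneg (mem_neg_graph.1 hfg)
    rw [inner_neg_right, map_neg] at this
    linarith
  refine ⟨⟨T, hT, huniq⟩, ?_, R, fun l hl => hR.isResolventOf hl,
    hR.tendsto_resolvent he heA hkerA⟩
  intro S hS f
  rw [huniq S hS]
  refine IsNonnegWithResolvent.tendsto_semigroup he hkerA hT (fun t => ?_) hcontr hsymm f
  have := hT1 _ _ heA t
  rw [norm_zero, mul_zero] at this
  exact sub_eq_zero.1 (norm_le_zero_iff.1 this)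

end Asymptotics

/-! ### Integrals of products in `L²`. -/

section SquareIntegrable

variable {α : Type*} [MeasurableSpace α] {ν : Measure α}

theorem integral_mul_eq_inner {f g : α → ℝ} (hf : MemLp f 2 ν) (hg : MemLp g 2 ν) :
    ∫ x, f x * g x ∂ν = inner ℝ (hf.toLp f) (hg.toLp g) := by
  rw [L2.inner_def]
  refine integral_congr_ae ?_
  filter_upwards [hf.coeFn_toLp, hg.coeFn_toLp] with x h1 h2
  rw [h1, h2]
  simp [mul_comm]

theorem integrable_mul_of_memLp {f g : α → ℝ} (hf : MemLp f 2 ν) (hg : MemLp g 2 ν) :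
    Integrable (fun x => f x * g x) ν := hf.integrable_mul hg

theorem integrable_sq_of_memLp {f : α → ℝ} (hf : MemLp f 2 ν) :
    Integrable (fun x => f x ^ 2) ν := hf.integrable_sq

theorem integral_sq_nonneg (f : α → ℝ) : 0 ≤ ∫ x, f x ^ 2 ∂ν :=
  integral_nonneg fun _ => sq_nonneg _

theorem norm_toLp_eq_sqrt {f : α → ℝ} (hf : MemLp f 2 ν) :
    ‖hf.toLp f‖ = Real.sqrt (∫ x, f x ^ 2 ∂ν) := by
  have := integral_mul_eq_inner hf hf
  rw [real_inner_self_eq_norm_sq] at this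
  rw [← Real.sqrt_sq (norm_nonneg (hf.toLp f)), ← this]
  congr 2
  funext x
  ring

theorem abs_integral_mul_le {f g : α → ℝ} (hf : MemLp f 2 ν) (hg : MemLp g 2 ν) :
    |∫ x, f x * g x ∂ν| ≤ Real.sqrt (∫ x, f x ^ 2 ∂ν) * Real.sqrt (∫ x, g x ^ 2 ∂ν) := by
  rw [integral_mul_eq_inner hf hg, ← norm_toLp_eq_sqrt hf, ← norm_toLp_eq_sqrt hg]
  exact abs_real_inner_le_norm _ _

/-- Joint continuity of the inner product; with a fixed factor it is the standard passage to the
limit after mollifying. -/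
theorem tendsto_integral_mul {ι : Type*} {l : Filter ι} {f g : ι → α → ℝ} {f₀ g₀ : α → ℝ}
    (hf : ∀ n, MemLp (f n) 2 ν) (hg : ∀ n, MemLp (g n) 2 ν) (hf₀ : MemLp f₀ 2 ν)
    (hg₀ : MemLp g₀ 2 ν) (h1 : Tendsto (fun n => eLpNorm (f n - f₀) 2 ν) l (𝓝 0))
    (h2 : Tendsto (fun n => eLpNorm (g n - g₀) 2 ν) l (𝓝 0)) :
    Tendsto (fun n => ∫ x, f n x * g n x ∂ν) l (𝓝 (∫ x, f₀ x * g₀ x ∂ν)) := by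
  rw [integral_mul_eq_inner hf₀ hg₀]
  simp_rw [fun n => integral_mul_eq_inner (hf n) (hg n)]
  exact ((Lp.tendsto_Lp_iff_tendsto_eLpNorm'' f hf f₀ hf₀).2 h1).inner
    ((Lp.tendsto_Lp_iff_tendsto_eLpNorm'' g hg g₀ hg₀).2 h2)

theorem tendsto_integral_mul_const {ι : Type*} {l : Filter ι} {f : ι → α → ℝ} {f₀ g : α → ℝ}
    (hf : ∀ n, MemLp (f n) 2 ν) (hf₀ : MemLp f₀ 2 ν) (hg : MemLp g 2 ν)
    (h1 : Tendsto (fun n => eLpNorm (f n - f₀) 2 ν) l (𝓝 0)) :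
    Tendsto (fun n => ∫ x, f n x * g x ∂ν) l (𝓝 (∫ x, f₀ x * g x ∂ν)) :=
  tendsto_integral_mul hf (fun _ => hg) hf₀ hg h1 (by simp only [sub_self, eLpNorm_zero]; exact tendsto_const_nhds)

end SquareIntegrable

/-! ### Partial derivatives and test functions. -/

section Calculus

variable {N : ℕ}

/-- The `i`-th partial derivative. -/
noncomputable def pd (i : Fin N) (φ : Space N → ℝ) (x : Space N) : ℝ :=
  fderiv ℝ φ x (EuclideanSpace.single i 1)

/-- Real test functions. -/
structure IsTest (φ : Space N → ℝ) : Prop where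
  smooth : ContDiff ℝ ∞ φ
  compact : HasCompactSupport φ

theorem contDiff_pd {φ : Space N → ℝ} (h : ContDiff ℝ ∞ φ) (i : Fin N) :
    ContDiff ℝ ∞ (pd i φ) :=
  (h.fderiv_right (m := ∞) (by simp)).clm_apply contDiff_const

theorem pd_mul {φ ψ : Space N → ℝ} (i : Fin N) {x : Space N} (h1 : DifferentiableAt ℝ φ x)
    (h2 : DifferentiableAt ℝ ψ x) :
    pd i (fun y => φ y * ψ y) x = φ x * pd i ψ x + pd i φ x * ψ x := by
  unfold pd
  rw [fderiv_fun_mul h1 h2]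
  simp
  ring

theorem pd_add {φ ψ : Space N → ℝ} (i : Fin N) {x : Space N} (h1 : DifferentiableAt ℝ φ x)
    (h2 : DifferentiableAt ℝ ψ x) : pd i (fun y => φ y + ψ y) x = pd i φ x + pd i ψ x := by
  unfold pd
  rw [fderiv_fun_add h1 h2]
  simp

theorem fderiv_eq_sum_pd (φ : Space N → ℝ) (x v : Space N) :
    fderiv ℝ φ x v = ∑ i, v i * pd i φ x := by
  have : v = ∑ i, v i • (EuclideanSpace.single i (1 : ℝ)) := by
    have := (EuclideanSpace.basisFun (Fin N) ℝ).sum_repr v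
    simpa using this.symm
  conv_lhs => rw [this]
  simp [pd]

theorem laplacian_eq_sum_pd {φ : Space N → ℝ} (h : ContDiff ℝ ∞ φ) (x : Space N) :
    Laplacian.laplacian φ x = ∑ i, pd i (pd i φ) x := by
  rw [InnerProductSpace.laplacian_eq_iteratedFDeriv_orthonormalBasis φ
    (EuclideanSpace.basisFun (Fin N) ℝ)]
  refine Finset.sum_congr rfl fun i _ => ?_
  rw [iteratedFDeriv_two_apply]
  simp only [Matrix.cons_val_zero, Matrix.cons_val_one, EuclideanSpace.basisFun_apply]
  unfold pd
  have hd : DifferentiableAt ℝ (fderiv ℝ φ) x :=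
    ((h.fderiv_right (m := ∞) (by simp)).differentiable (by simp)) x
  rw [fderiv_clm_apply hd (differentiableAt_const _)]
  simp

theorem pd_comm {φ : Space N → ℝ} (h : ContDiff ℝ ∞ φ) (i j : Fin N) (x : Space N) :
    pd i (pd j φ) x = pd j (pd i φ) x := by
  have hd : DifferentiableAt ℝ (fderiv ℝ φ) x :=
    ((h.fderiv_right (m := ∞) (by simp)).differentiable (by simp)) x
  have key : ∀ i j, pd i (pd j φ) x =
      fderiv ℝ (fderiv ℝ φ) x (EuclideanSpace.single i 1) (EuclideanSpace.single j 1) := by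
    intro i j
    unfold pd
    rw [fderiv_clm_apply hd (differentiableAt_const _)]
    simp
  rw [key, key]
  exact (h.contDiffAt.isSymmSndFDerivAt (by simp; norm_cast)).eq _ _

namespace IsTest

variable {φ ψ : Space N → ℝ}

theorem differentiable (h : IsTest φ) : Differentiable ℝ φ := h.smooth.differentiable (by simp)

theorem continuous (h : IsTest φ) : Continuous φ := h.smooth.continuous

theorem mul_left (h : IsTest φ) (hψ : ContDiff ℝ ∞ ψ) : IsTest fun x => ψ x * φ x :=
  ⟨hψ.mul h.smooth, h.compact.mul_left⟩

theorem mul_right (h : IsTest φ) (hψ : ContDiff ℝ ∞ ψ) : IsTest fun x => φ x * ψ x :=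
  ⟨h.smooth.mul hψ, h.compact.mul_right⟩

theorem add (h : IsTest φ) (h' : IsTest ψ) : IsTest fun x => φ x + ψ x :=
  ⟨h.smooth.add h'.smooth, h.compact.add h'.compact⟩

theorem const_mul (h : IsTest φ) (c : ℝ) : IsTest fun x => c * φ x :=
  h.mul_left contDiff_const

theorem sub (h : IsTest φ) (h' : IsTest ψ) : IsTest fun x => φ x - ψ x := by
  simpa [sub_eq_add_neg] using h.add (h'.const_mul (-1))

theorem pd (h : IsTest φ) (i : Fin N) : IsTest (pd i φ) :=
  ⟨contDiff_pd h.smooth i, (h.compact.fderiv_apply (𝕜 := ℝ) (EuclideanSpace.single i 1))⟩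

theorem sum {ι : Type*} (s : Finset ι) {f : ι → Space N → ℝ} (h : ∀ i, IsTest (f i)) :
    IsTest fun x => ∑ i ∈ s, f i x := by
  classical
  induction s using Finset.induction_on with
  | empty => simpa using ⟨contDiff_const, HasCompactSupport.zero⟩
  | insert a s ha ih => simp only [Finset.sum_insert ha]; exact (h a).add ih

theorem memLp (h : IsTest φ) (p : ℝ≥0∞) (ν : Measure (Space N)) [IsFiniteMeasureOnCompacts ν] :
    MemLp φ p ν := h.continuous.memLp_of_hasCompactSupport h.compact

theorem integrable (h : IsTest φ) (ν : Measure (Space N)) [IsFiniteMeasureOnCompacts ν] :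
    Integrable φ ν := h.continuous.integrable_of_hasCompactSupport h.compact

theorem exists_bound (h : IsTest φ) : ∃ C, 0 ≤ C ∧ ∀ x, |φ x| ≤ C := by
  obtain ⟨C, hC⟩ := h.compact.exists_bound_of_continuous h.continuous
  exact ⟨C, (norm_nonneg _).trans (hC 0), hC⟩

/-- Integration by parts. -/
theorem integral_mul_pd (h : IsTest φ) (hψ : ContDiff ℝ ∞ ψ) (i : Fin N) :
    ∫ x, ψ x * BiKolmogorov.pd i φ x = -∫ x, BiKolmogorov.pd i ψ x * φ x :=
  integral_mul_fderiv_eq_neg_fderiv_mul_of_integrable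
    ((h.mul_left (contDiff_pd hψ i)).integrable volume)
    (((h.pd i).mul_left hψ).integrable volume) ((h.mul_left hψ).integrable volume)
    (fun x _ => hψ.differentiable (by simp) x) (fun x _ => h.differentiable x)

theorem integral_pd_mul_pd (h : IsTest φ) (h' : IsTest ψ) (i : Fin N) :
    ∫ x, BiKolmogorov.pd i φ x * BiKolmogorov.pd i ψ x =
      -∫ x, BiKolmogorov.pd i (BiKolmogorov.pd i φ) x * ψ x :=
  h'.integral_mul_pd (h.pd i).smooth i

end IsTest

end Calculus

/-! ### Cauchy–Schwarz for extended nonnegative functions. -/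

section CauchySchwarz

variable {α : Type*} [MeasurableSpace α] {ν : Measure α}

theorem sq_lintegral_mul_le {f g : α → ℝ≥0∞} (hf : AEMeasurable f ν) (hg : AEMeasurable g ν) :
    (∫⁻ x, f x * g x ∂ν) ^ 2 ≤ (∫⁻ x, f x ^ 2 ∂ν) * ∫⁻ x, g x ^ 2 ∂ν := by
  have h := ENNReal.lintegral_mul_le_Lp_mul_Lq ν Real.HolderConjugate.two_two hf hg
  simp only [Pi.mul_apply, ENNReal.rpow_two] at h
  calc _ ≤ ((∫⁻ x, f x ^ 2 ∂ν) ^ (1 / 2 : ℝ) * (∫⁻ x, g x ^ 2 ∂ν) ^ (1 / 2 : ℝ)) ^ 2 := by gcongr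
    _ = _ := by
      rw [mul_pow, ← ENNReal.rpow_two, ← ENNReal.rpow_two, ← ENNReal.rpow_mul, ← ENNReal.rpow_mul]
      norm_num

/-- Cauchy–Schwarz with a weight. -/
theorem sq_lintegral_weight_mul_le {k g : α → ℝ≥0∞} (hk : AEMeasurable k ν)
    (hg : AEMeasurable g ν) :
    (∫⁻ x, k x * g x ∂ν) ^ 2 ≤ (∫⁻ x, k x ∂ν) * ∫⁻ x, k x * g x ^ 2 ∂ν := by
  have h := sq_lintegral_mul_le (hk.pow_const (1 / 2 : ℝ)) ((hk.pow_const (1 / 2 : ℝ)).mul hg)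
  have e : ∀ x, (k x ^ (1 / 2 : ℝ)) ^ 2 = k x := fun x => by
    rw [← ENNReal.rpow_two, ← ENNReal.rpow_mul]; norm_num
  have e' : ∀ x, k x ^ (1 / 2 : ℝ) * (k x ^ (1 / 2 : ℝ) * g x) = k x * g x := fun x => by
    rw [← mul_assoc, ← sq, e]
  simpa only [Pi.mul_apply, mul_pow, e, e'] using h

end CauchySchwarz

/-! ### Mollification in `L²` and weak derivatives. -/

section Mollification

open ContinuousLinearMap

variable {N : ℕ}

/-- A bump function supported in the ball of radius `1 / (n + 1)`. -/
noncomputable def bump (N n : ℕ) : ContDiffBump (0 : Space N) where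
  rIn := 1 / (n + 2)
  rOut := 1 / (n + 1)
  rIn_pos := by positivity
  rIn_lt_rOut := by
    apply one_div_lt_one_div_of_lt <;> linarith [(n.cast_nonneg : (0 : ℝ) ≤ n)]

/-- The mollifying kernel. -/
noncomputable def molKer (N n : ℕ) : Space N → ℝ := (bump N n).normed volume

theorem isTest_molKer (n : ℕ) : IsTest (molKer N n) :=
  ⟨(bump N n).contDiff_normed, (bump N n).hasCompactSupport_normed⟩

theorem molKer_nonneg (n : ℕ) (x : Space N) : 0 ≤ molKer N n x := (bump N n).nonneg_normed x

theorem integral_molKer (n : ℕ) : ∫ x, molKer N n x = 1 := (bump N n).integral_normed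

theorem molKer_eq_zero (n : ℕ) {x : Space N} (hx : 1 / ((n : ℝ) + 1) ≤ ‖x‖) :
    molKer N n x = 0 := by
  have : x ∉ Function.support (molKer N n) := by
    rw [molKer, (bump N n).support_normed_eq]
    simpa [bump] using hx
  simpa using this

/-- Mollification of `u`. -/
noncomputable def mollify (n : ℕ) (u : Space N → ℝ) (x : Space N) : ℝ :=
  ∫ y, molKer N n y * u (x - y)

theorem mollify_eq_convolution (n : ℕ) (u : Space N → ℝ) :
    mollify n u = convolution (molKer N n) u (lsmul ℝ ℝ) volume := rfl

theorem mollify_swap (n : ℕ) (u : Space N → ℝ) (x : Space N) :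
    mollify n u x = ∫ y, molKer N n (x - y) * u y := by
  rw [mollify_eq_convolution, convolution_eq_swap]; rfl

theorem mollify_congr (n : ℕ) {u v : Space N → ℝ} (h : u =ᵐ[volume] v) :
    mollify n u = mollify n v := by
  funext x
  rw [mollify_swap, mollify_swap]
  exact integral_congr_ae (h.mono fun y hy => by simp only [hy])

theorem contDiff_mollify (n : ℕ) {u : Space N → ℝ} (hu : LocallyIntegrable u) :
    ContDiff ℝ ∞ (mollify n u) := by
  rw [mollify_eq_convolution]
  exact (isTest_molKer n).compact.contDiff_convolution_left _ (isTest_molKer n).smooth hu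

theorem isTest_mollify (n : ℕ) {u : Space N → ℝ} (hu : LocallyIntegrable u)
    (hc : HasCompactSupport u) : IsTest (mollify n u) :=
  ⟨contDiff_mollify n hu, by
    rw [mollify_eq_convolution]; exact (isTest_molKer n).compact.convolution _ hc⟩

theorem IsTest.pd_convolution {k u : Space N → ℝ} (hk : IsTest k) (hu : LocallyIntegrable u)
    (i : Fin N) (x : Space N) :
    BiKolmogorov.pd i (fun x => ∫ y, k (x - y) * u y) x =
      ∫ y, BiKolmogorov.pd i k (x - y) * u y := by
  let L : (Space N →L[ℝ] ℝ) →L[ℝ] ℝ →L[ℝ] (Space N →L[ℝ] ℝ) :=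
    precompL (Space N) (lsmul ℝ ℝ : ℝ →L[ℝ] ℝ →L[ℝ] ℝ)
  have hcs : HasCompactSupport (fderiv ℝ k) := hk.compact.fderiv ℝ
  have hcc : Continuous (fderiv ℝ k) := hk.smooth.continuous_fderiv (by simp)
  have hi : Integrable (fun t => L (fderiv ℝ k (x - t)) (u t)) :=
    (hcs.convolutionExists_left L hcc hu x).integrable_swap
  have e : (fun x => ∫ y, k (x - y) * u y) = convolution k u (lsmul ℝ ℝ) volume := by
    funext x
    rw [convolution_eq_swap]; rfl
  have h : HasFDerivAt (fun x => ∫ y, k (x - y) * u y)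
      (∫ t, L (fderiv ℝ k (x - t)) (u t)) x := by
    rw [e, ← convolution_eq_swap]
    exact hk.compact.hasFDerivAt_convolution_left _ (hk.smooth.of_le (by simp)) hu x
  unfold BiKolmogorov.pd
  rw [h.fderiv, integral_apply hi]
  rfl

theorem pd_mollify (n : ℕ) {u : Space N → ℝ} (hu : LocallyIntegrable u) (i : Fin N)
    (x : Space N) : pd i (mollify n u) x = ∫ y, pd i (molKer N n) (x - y) * u y := by
  have h1 : mollify n u = fun x => ∫ y, molKer N n (x - y) * u y := funext (mollify_swap n u)
  rw [h1, (isTest_molKer n).pd_convolution hu]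

theorem IsTest.pd_sub_left {k : Space N → ℝ} (hk : IsTest k) (i : Fin N) (x y : Space N) :
    BiKolmogorov.pd i (fun z => k (x - z)) y = - BiKolmogorov.pd i k (x - y) := by
  unfold BiKolmogorov.pd
  have h1 : HasFDerivAt (fun z : Space N => x - z) (-ContinuousLinearMap.id ℝ (Space N)) y := by
    simpa using (hasFDerivAt_id y).const_sub x
  have h2 := (hk.differentiable (x - y)).hasFDerivAt.comp y h1
  have h3 : HasFDerivAt (fun z => k (x - z)) _ y := h2
  rw [h3.fderiv]
  simp

theorem IsTest.comp_sub_left {k : Space N → ℝ} (hk : IsTest k) (x : Space N) :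
    IsTest (fun z => k (x - z)) :=
  ⟨hk.smooth.comp (contDiff_const.sub contDiff_id),
    hk.compact.comp_homeomorph (Homeomorph.subLeft x)⟩

/-- Mollification commutes with weak derivatives. -/
theorem pd_mollify_of_weak (n : ℕ) {u g : Space N → ℝ} (hu : LocallyIntegrable u) {i : Fin N}
    (h : ∀ ψ, IsTest ψ → ∫ x, u x * pd i ψ x = -∫ x, g x * ψ x) :
    pd i (mollify n u) = mollify n g := by
  funext x
  rw [pd_mollify n hu, mollify_swap]
  have := h _ ((isTest_molKer n).comp_sub_left x)
  simp only [(isTest_molKer n).pd_sub_left, mul_neg, integral_neg, neg_inj] at this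
  simp only [mul_comm _ (u _), mul_comm _ (g _)]
  exact this

theorem tendsto_eLpNorm_translate {u : Space N → ℝ} (hu : MemLp u 2 volume) :
    Tendsto (fun y => eLpNorm (fun x => u (x - y) - u x) 2 volume) (𝓝 (0 : Space N)) (𝓝 0) := by
  have hmp : ∀ y : Space N, MeasurePreserving (fun x : Space N => x - y) volume volume :=
    fun y => measurePreserving_sub_right volume y
  let F : C(Space N × Space N, Space N) := ⟨fun p => p.2 - p.1, by fun_prop⟩
  have h1 := Filter.Tendsto.compMeasurePreservingLp (μ := volume) (ν := volume) (p := 2)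
    (l := 𝓝 (0 : Space N)) (f := fun _ => hu.toLp u) (g := F.curry) (g₀ := F.curry 0)
    tendsto_const_nhds (F.curry.continuous.tendsto 0) hmp (hmp 0) (by simp)
  have h2 := (Lp.tendsto_Lp_iff_tendsto_eLpNorm'' (fun y x => u (x - y))
    (fun y => hu.comp_measurePreserving (hmp y)) (fun x => u (x - 0))
    (hu.comp_measurePreserving (hmp 0))).1 h1
  simp only [sub_zero] at h2
  exact h2

theorem eLpNorm_two_sq {α : Type*} [MeasurableSpace α] {ν : Measure α} (f : α → ℝ) :
    eLpNorm f 2 ν ^ 2 = ∫⁻ x, ‖f x‖ₑ ^ 2 ∂ν := by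
  rw [eLpNorm_eq_lintegral_rpow_enorm_toReal (by simp) (by simp), ← ENNReal.rpow_two,
    ← ENNReal.rpow_mul]
  simp

/-- The kernel is a probability density, so Cauchy–Schwarz bounds `|u_n - u|²` pointwise by the
kernel average of `|u(x - y) - u(x)|²`; Tonelli then leaves only translations within the support of
the kernel. -/
theorem eLpNorm_mollify_sub_le (n : ℕ) {u : Space N → ℝ} (hu : MemLp u 2 volume) {C : ℝ≥0∞}
    (hC : ∀ y : Space N, ‖y‖ < 1 / ((n : ℝ) + 1) →
      eLpNorm (fun x => u (x - y) - u x) 2 volume ≤ C) :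
    eLpNorm (mollify n u - u) 2 volume ≤ C := by
  -- Tonelli below needs joint measurability, so `u` is replaced by a measurable representative.
  wlog hm : Measurable u generalizing u
  · obtain ⟨v, hv, huv⟩ := hu.aestronglyMeasurable.aemeasurable
    have huv' : ∀ y : Space N, (fun x => u (x - y) - u x) =ᵐ[volume] fun x => v (x - y) - v x :=
      fun y => ((measurePreserving_sub_right volume y).quasiMeasurePreserving.ae_eq huv).sub huv
    have := this ((memLp_congr_ae huv).1 hu)
      (fun y hy => (eLpNorm_congr_ae (huv' y)).symm.le.trans (hC y hy)) hv
    rw [mollify_congr n huv]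
    refine (eLpNorm_congr_ae ?_).le.trans this
    exact (EventuallyEq.refl _ _).sub huv
  have hloc : LocallyIntegrable u := hu.locallyIntegrable (by norm_num)
  have hk : Measurable fun y : Space N => ‖molKer N n y‖ₑ :=
    (isTest_molKer n).continuous.measurable.enorm
  have hk1 : ∫⁻ y : Space N, ‖molKer N n y‖ₑ = 1 := by
    have h1 := ofReal_integral_norm_eq_lintegral_enorm ((isTest_molKer (N := N) n).integrable volume)
    rw [← h1]
    simp only [Real.norm_of_nonneg (molKer_nonneg n _), integral_molKer, ENNReal.ofReal_one]
  have hpt : ∀ x, ‖(mollify n u - u) x‖ₑ ^ 2 ≤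
      ∫⁻ y, ‖molKer N n y‖ₑ * ‖u (x - y) - u x‖ₑ ^ 2 := by
    intro x
    have hi : Integrable fun y => molKer N n y * u (x - y) :=
      (isTest_molKer n).compact.convolutionExists_left (lsmul ℝ ℝ) (isTest_molKer n).continuous
        hloc x
    have e : (mollify n u - u) x = ∫ y, molKer N n y * (u (x - y) - u x) := by
      simp only [mul_sub]
      rw [integral_sub hi (((isTest_molKer n).integrable volume).mul_const _),
        integral_mul_const, integral_molKer, one_mul]
      rfl
    rw [e]
    calc _ ≤ (∫⁻ y, ‖molKer N n y‖ₑ * ‖u (x - y) - u x‖ₑ) ^ 2 := by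
          gcongr
          refine (enorm_integral_le_lintegral_enorm _).trans_eq ?_
          simp only [enorm_mul]
      _ ≤ _ := sq_lintegral_weight_mul_le hk.aemeasurable (by fun_prop)
      _ = _ := by rw [hk1, one_mul]
  have h1 : eLpNorm (mollify n u - u) 2 volume ^ 2 ≤ C ^ 2 := by
    rw [eLpNorm_two_sq]
    calc _ ≤ ∫⁻ x, ∫⁻ y, ‖molKer N n y‖ₑ * ‖u (x - y) - u x‖ₑ ^ 2 := lintegral_mono hpt
      _ = ∫⁻ y, ∫⁻ x, ‖molKer N n y‖ₑ * ‖u (x - y) - u x‖ₑ ^ 2 := by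
          rw [lintegral_lintegral_swap]
          have : Measurable (fun p : Space N × Space N => ‖molKer N n p.2‖ₑ) :=
            hk.comp measurable_snd
          apply Measurable.aemeasurable
          simp only [Function.uncurry_def]
          fun_prop
      _ ≤ ∫⁻ y : Space N, ‖molKer N n y‖ₑ * C ^ 2 := by
          refine lintegral_mono fun y => ?_
          dsimp only
          rw [lintegral_const_mul _ (by fun_prop)]
          by_cases hy : ‖y‖ < 1 / ((n : ℝ) + 1)
          · gcongr
            have := hC y hy
            rw [← eLpNorm_two_sq]
            gcongr
          · rw [molKer_eq_zero n (not_lt.1 hy)]; simp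
      _ = C ^ 2 := by rw [lintegral_mul_const _ hk, hk1, one_mul]
  exact (ENNReal.pow_le_pow_left_iff two_ne_zero).1 h1

theorem tendsto_eLpNorm_mollify {u : Space N → ℝ} (hu : MemLp u 2 volume) :
    Tendsto (fun n => eLpNorm (mollify n u - u) 2 volume) atTop (𝓝 0) := by
  rw [ENNReal.tendsto_atTop_zero]
  intro ε hε
  obtain ⟨δ, hδ, hh⟩ := Metric.eventually_nhds_iff.1
    ((ENNReal.tendsto_nhds_zero.1 (tendsto_eLpNorm_translate hu)) ε hε)
  obtain ⟨n₀, hn₀⟩ := exists_nat_one_div_lt hδ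
  refine ⟨n₀, fun n hn => eLpNorm_mollify_sub_le n hu fun y hy => hh ?_⟩
  rw [dist_zero_right]
  refine hy.trans (lt_of_le_of_lt ?_ hn₀)
  gcongr

theorem memLp_mollify (n : ℕ) {u : Space N → ℝ} (hu : MemLp u 2 volume) :
    MemLp (mollify n u) 2 volume := by
  have hloc : LocallyIntegrable u := hu.locallyIntegrable (by norm_num)
  have h1 : MemLp (mollify n u - u) 2 volume := by
    refine ⟨((contDiff_mollify n hloc).continuous.aestronglyMeasurable).sub hu.1, ?_⟩
    -- For mere membership in `L²` the trivial bound `2‖u‖` on the translation differences suffices.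
    refine (eLpNorm_mollify_sub_le n hu (C := eLpNorm u 2 volume + eLpNorm u 2 volume)
      fun y _ => ?_).trans_lt (ENNReal.add_lt_top.2 ⟨hu.2, hu.2⟩)
    have hmp := measurePreserving_sub_right (volume : Measure (Space N)) y
    have h2 := hu.comp_measurePreserving hmp
    refine (eLpNorm_sub_le h2.1 hu.1 (by norm_num)).trans ?_
    gcongr
    exact (eLpNorm_comp_measurePreserving hu.1 hmp).le
  simpa using h1.add hu

end Mollification

/-! ### Averages over balls of dilated functions. -/

section BallAverages

variable {N : ℕ}

theorem lintegral_add_smul {f : Space N → ℝ≥0∞} (hf : Measurable f) (z : Space N) {t : ℝ}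
    (ht : t ≠ 0) :
    ∫⁻ y, f (z + t • y) = ENNReal.ofReal (|t| ^ (-(N : ℝ))) * ∫⁻ y, f y := by
  have h1 : Measurable fun y => f (z + y) := hf.comp (measurable_const_add z)
  have h2 := lintegral_map (μ := (volume : Measure (Space N))) h1 (measurable_const_smul t)
  rw [Measure.map_addHaar_smul _ ht, lintegral_smul_measure, lintegral_add_left_eq_self] at h2
  rw [← h2, smul_eq_mul]
  congr 2
  simp [abs_inv, Real.rpow_neg]

/-- Hölder's inequality for averages over small balls. -/
theorem lintegral_ball_add_smul_le {f : Space N → ℝ≥0∞} (hf : Measurable f) (z : Space N) {t : ℝ}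
    (ht : t ≠ 0) (R : ℝ) {p : ℝ} (hp : 1 ≤ p) :
    ∫⁻ y in Metric.ball 0 R, f (z + t • y) ≤
      ENNReal.ofReal (|t| ^ (-(N / p : ℝ))) * ((∫⁻ y, f y ^ p) ^ (1 / p) *
        volume (Metric.ball (0 : Space N) R) ^ (1 - 1 / p)) := by
  have hp0 : 0 < p := by linarith
  have hm : Measurable fun y : Space N => f (z + t • y) := by fun_prop
  have h1 := eLpNorm'_le_eLpNorm'_mul_rpow_measure_univ (μ := volume.restrict
    (Metric.ball (0 : Space N) R)) (f := fun y => f (z + t • y)) one_pos hp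
    hm.aestronglyMeasurable
  simp only [eLpNorm', enorm_eq_self, ENNReal.rpow_one, div_one, Measure.restrict_apply_univ] at h1
  refine h1.trans ?_
  rw [← mul_assoc]
  gcongr
  have h2 := lintegral_add_smul (hf.pow_const p) z ht
  have h3 : (∫⁻ y in Metric.ball 0 R, f (z + t • y) ^ p) ≤
      ENNReal.ofReal (|t| ^ (-(N : ℝ))) * ∫⁻ y, f y ^ p :=
    (setLIntegral_le_lintegral _ _).trans h2.le
  refine (ENNReal.rpow_le_rpow h3 (by positivity)).trans_eq ?_
  rw [ENNReal.mul_rpow_of_nonneg _ _ (by positivity),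
    ENNReal.ofReal_rpow_of_nonneg (by positivity) (by positivity), ← Real.rpow_mul (abs_nonneg t)]
  congr 3
  ring

theorem lintegral_Ioc_rpow_lt_top {a : ℝ} (ha : -1 < a) :
    ∫⁻ t in Set.Ioc (0 : ℝ) 1, ENNReal.ofReal (t ^ a) < ⊤ := by
  have h := (intervalIntegral.intervalIntegrable_rpow' (a := 0) (b := 1) ha).1
  refine lt_of_le_of_lt (lintegral_mono_ae ?_) h.2
  refine (ae_restrict_iff' measurableSet_Ioc).2 (Eventually.of_forall fun t ht => ?_)
  exact Real.ofReal_le_enorm _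

/-- The fundamental theorem of calculus as an inequality between extended norms. -/
theorem enorm_le_of_hasDerivAt {f f' : ℝ → ℝ}
    (hd : ∀ t ∈ Set.Icc (0 : ℝ) 1, HasDerivAt f (f' t) t) (hc : ContinuousOn f' (Set.Icc 0 1)) :
    ‖f 0‖ₑ ≤ ‖f 1‖ₑ + ∫⁻ t in Set.Ioc (0 : ℝ) 1, ‖f' t‖ₑ := by
  have h := intervalIntegral.integral_eq_sub_of_hasDerivAt (a := 0) (b := 1) (f := f) (f' := f')
    (by rwa [Set.uIcc_of_le zero_le_one])
    (ContinuousOn.intervalIntegrable (by rwa [Set.uIcc_of_le zero_le_one]))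
  rw [intervalIntegral.integral_of_le zero_le_one] at h
  have e : f 0 = f 1 - ∫ t in Set.Ioc (0 : ℝ) 1, f' t := by rw [h]; ring
  rw [e]
  refine (enorm_sub_le).trans ?_
  gcongr
  exact enorm_integral_le_lintegral_enorm _

theorem ennreal_add_sq_le (a b : ℝ≥0∞) : (a + b) ^ 2 ≤ 2 * a ^ 2 + 2 * b ^ 2 := by
  have := ENNReal.rpow_add_le_mul_rpow_add_rpow a b (p := 2) (by norm_num)
  norm_num at this
  rw [← mul_add]
  exact this

/-- A smooth function at a point in terms of its values and gradients near the point. -/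
theorem enorm_sq_le_of_contDiff {φ : Space N → ℝ} (hφ : ContDiff ℝ 1 φ) {α : ℝ} (x y : Space N)
    {R : ℝ} (hy : ‖y‖ ≤ R) :
    ‖φ x‖ₑ ^ 2 ≤ 2 * ‖φ (x + y)‖ₑ ^ 2 + 2 * (ENNReal.ofReal R ^ 2 *
      ((∫⁻ t in Set.Ioc (0 : ℝ) 1, ENNReal.ofReal (t ^ (-α))) *
        ∫⁻ t in Set.Ioc (0 : ℝ) 1, ENNReal.ofReal (t ^ α) * ‖fderiv ℝ φ (x + t • y)‖ₑ ^ 2)) := by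
  have hcont : Continuous (fderiv ℝ φ) := hφ.continuous_fderiv (by simp)
  have h1 := enorm_le_of_hasDerivAt (f := fun t => φ (x + t • y))
    (f' := fun t => fderiv ℝ φ (x + t • y) y)
    (fun t _ => by
      have h1 := (hφ.differentiable (by simp) (x + t • y)).hasFDerivAt
      have h2 : HasDerivAt (fun t : ℝ => x + t • y) y t := by
        simpa using ((hasDerivAt_id t).smul_const y).const_add x
      exact h1.comp_hasDerivAt t h2)
    (by fun_prop)
  simp only [zero_smul, add_zero, one_smul] at h1
  have h2 : ∫⁻ t in Set.Ioc (0 : ℝ) 1, ‖fderiv ℝ φ (x + t • y) y‖ₑ ≤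
      ENNReal.ofReal R * ∫⁻ t in Set.Ioc (0 : ℝ) 1, ‖fderiv ℝ φ (x + t • y)‖ₑ := by
    rw [← lintegral_const_mul _ (by fun_prop)]
    refine lintegral_mono fun t => ?_
    refine (ContinuousLinearMap.le_opENorm _ _).trans ?_
    rw [mul_comm]
    gcongr
    rw [← ofReal_norm]
    exact ENNReal.ofReal_le_ofReal hy
  have hm : Measurable fun t : ℝ => ‖fderiv ℝ φ (x + t • y)‖ₑ := by fun_prop
  have h3 : (∫⁻ t in Set.Ioc (0 : ℝ) 1, ‖fderiv ℝ φ (x + t • y)‖ₑ) ^ 2 ≤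
      (∫⁻ t in Set.Ioc (0 : ℝ) 1, ENNReal.ofReal (t ^ (-α))) *
        ∫⁻ t in Set.Ioc (0 : ℝ) 1, ENNReal.ofReal (t ^ α) * ‖fderiv ℝ φ (x + t • y)‖ₑ ^ 2 := by
    -- The weights `t^(∓α/2)` are split off before Cauchy–Schwarz: `α` will be `N/r`, chosen so that
    -- both the free factor and the remaining `t`-integral stay finite.
    have h4 := sq_lintegral_mul_le (ν := volume.restrict (Set.Ioc (0 : ℝ) 1))
      (f := fun t => ENNReal.ofReal (t ^ (-α / 2)))
      (g := fun t => ENNReal.ofReal (t ^ (α / 2)) * ‖fderiv ℝ φ (x + t • y)‖ₑ)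
      (by fun_prop) (by fun_prop)
    have e : ∀ a : ℝ, ∀ t ∈ Set.Ioc (0 : ℝ) 1,
        ENNReal.ofReal (t ^ (a / 2)) ^ 2 = ENNReal.ofReal (t ^ a) := by
      intro a t ht
      rw [← ENNReal.ofReal_pow (Real.rpow_nonneg ht.1.le _), ← Real.rpow_mul_natCast ht.1.le]
      congr 2
      push_cast; ring
    have e1 : ∫⁻ t in Set.Ioc (0 : ℝ) 1, ‖fderiv ℝ φ (x + t • y)‖ₑ =
        ∫⁻ t in Set.Ioc (0 : ℝ) 1, ENNReal.ofReal (t ^ (-α / 2)) *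
          (ENNReal.ofReal (t ^ (α / 2)) * ‖fderiv ℝ φ (x + t • y)‖ₑ) := by
      refine setLIntegral_congr_fun measurableSet_Ioc fun t ht => ?_
      rw [← mul_assoc, ← ENNReal.ofReal_mul (Real.rpow_nonneg ht.1.le _), ← Real.rpow_add ht.1,
        neg_div, neg_add_cancel, Real.rpow_zero, ENNReal.ofReal_one, one_mul]
    rw [e1]
    refine h4.trans_eq ?_
    congr 1
    · exact setLIntegral_congr_fun measurableSet_Ioc fun t ht => e _ t ht
    · refine setLIntegral_congr_fun measurableSet_Ioc fun t ht => ?_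
      rw [mul_pow, e _ t ht]
  calc ‖φ x‖ₑ ^ 2 ≤ (‖φ (x + y)‖ₑ + ENNReal.ofReal R *
        ∫⁻ t in Set.Ioc (0 : ℝ) 1, ‖fderiv ℝ φ (x + t • y)‖ₑ) ^ 2 := by
        gcongr
        exact h1.trans (by gcongr)
    _ ≤ _ := (ennreal_add_sq_le _ _).trans (by rw [mul_pow]; gcongr)

/-- The weighted `L²` norm of a translate, averaged over translations. -/
theorem lintegral_ball_weight_le {b q : Space N → ℝ≥0∞} (hb : Measurable b) (hq : Measurable q)
    {r : ℝ} (hr : 2 ≤ r) {t : ℝ} (ht : t ≠ 0) (R : ℝ) :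
    ∫⁻ y in Metric.ball 0 R, ∫⁻ x, b x ^ 2 * q (x + t • y) ≤
      ENNReal.ofReal (|t| ^ (-(2 * (N / r) : ℝ))) * ((∫⁻ y, b y ^ r) ^ (2 / r) *
        volume (Metric.ball (0 : Space N) R) ^ (1 - 2 / r)) * ∫⁻ x, q x := by
  have hr0 : 0 < r := by linarith
  -- Translation moves the dilation from `q` onto `b`; the `y`-average of `b²` is then bounded by
  -- Hölder uniformly in `x`. The exponent `r/2 ≥ 1` is why `2 ≤ r` is needed.
  have h1 : ∀ y : Space N, ∫⁻ x, b x ^ 2 * q (x + t • y) = ∫⁻ x, b (x + (-t) • y) ^ 2 * q x := by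
    intro y
    rw [← lintegral_add_right_eq_self (fun x => b (x + (-t) • y) ^ 2 * q x) (t • y)]
    simp only [neg_smul, add_neg_cancel_right]
  simp only [h1]
  rw [lintegral_lintegral_swap (by
    apply Measurable.aemeasurable
    simp only [Function.uncurry_def]
    fun_prop)]
  have h2 : ∀ x : Space N, ∫⁻ y in Metric.ball 0 R, b (x + (-t) • y) ^ 2 * q x ≤
      ENNReal.ofReal (|t| ^ (-(2 * (N / r) : ℝ))) * ((∫⁻ y, b y ^ r) ^ (2 / r) *
        volume (Metric.ball (0 : Space N) R) ^ (1 - 2 / r)) * q x := by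
    intro x
    rw [lintegral_mul_const _ (by fun_prop)]
    gcongr
    have := lintegral_ball_add_smul_le (hb.pow_const 2) x (neg_ne_zero.2 ht) R (p := r / 2)
      (by linarith)
    have e1 : ∀ y, (b y ^ 2) ^ (r / 2) = b y ^ r := fun y => by
      rw [← ENNReal.rpow_two, ← ENNReal.rpow_mul]; congr 1; ring
    have e2 : (N / (r / 2) : ℝ) = 2 * (N / r) := by field_simp
    have e3 : 1 / (r / 2) = 2 / r := by field_simp
    simp only [e1, abs_neg] at this
    rw [e2, e3] at this
    exact this
  refine (lintegral_mono h2).trans_eq ?_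
  rw [lintegral_const_mul _ hq]

end BallAverages

/-! ### Form boundedness of weights in `L^r`, `r > N`. -/

section WeightBound

variable {N : ℕ}

theorem volume_ball_pos {R : ℝ} (hR : 0 < R) : volume (Metric.ball (0 : Space N) R) ≠ 0 :=
  (Metric.measure_ball_pos volume _ hR).ne'

theorem volume_ball_ne_top (R : ℝ) : volume (Metric.ball (0 : Space N) R) ≠ ⊤ :=
  measure_ball_lt_top.ne

/-- Write `φ(x)` as `φ(x + y)` minus an integral of the gradient along the segment, and average over
`y` in a ball of radius `R`. At position `t` the average of `b²` costs `t^(-2N/r)`; the weight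
`t^(N/r)` leaves `t^(-N/r)`, integrable exactly when `r > N`. -/
theorem lintegral_weight_le {b : Space N → ℝ≥0∞} (hb : Measurable b) {r : ℝ} (hr2 : 2 ≤ r)
    {φ : Space N → ℝ} (hφ : ContDiff ℝ 1 φ) {R : ℝ} (hR : 0 < R) :
    ∫⁻ x, b x ^ 2 * ‖φ x‖ₑ ^ 2 ≤
      2 * ((∫⁻ y, b y ^ r) ^ (2 / r) * volume (Metric.ball (0 : Space N) R) ^ (- (2 / r))) *
        (ENNReal.ofReal R ^ 2 *
          (∫⁻ t in Set.Ioc (0 : ℝ) 1, ENNReal.ofReal (t ^ (-(N / r : ℝ)))) ^ 2) *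
        (∫⁻ x, ‖fderiv ℝ φ x‖ₑ ^ 2) +
      2 * ((∫⁻ y, b y ^ r) ^ (2 / r) * volume (Metric.ball (0 : Space N) R) ^ (- (2 / r))) *
        ∫⁻ x, ‖φ x‖ₑ ^ 2 := by
  set B := Metric.ball (0 : Space N) R with hB
  set V := volume B with hV
  set J := (∫⁻ y, b y ^ r) ^ (2 / r)
  set α : ℝ := N / r
  set κ := ∫⁻ t in Set.Ioc (0 : ℝ) 1, ENNReal.ofReal (t ^ (-α))
  have hcont : Continuous (fderiv ℝ φ) := hφ.continuous_fderiv (by simp)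
  have hφm : Measurable φ := hφ.continuous.measurable
  have hD : Measurable fun x => ‖fderiv ℝ φ x‖ₑ ^ 2 := by fun_prop
  have hP : Measurable fun x => ‖φ x‖ₑ ^ 2 := by fun_prop
  have hV0 : V ≠ 0 := volume_ball_pos hR
  have hVt : V ≠ ⊤ := volume_ball_ne_top R
  have hjoint : Measurable fun p : (Space N × Space N) × ℝ =>
      ‖fderiv ℝ φ (p.1.1 + p.2 • p.1.2)‖ₑ ^ 2 := by
    apply Measurable.pow_const
    apply Measurable.enorm
    apply Continuous.measurable
    fun_prop
  have hbase : V * ∫⁻ x, b x ^ 2 * ‖φ x‖ₑ ^ 2 ≤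
      2 * (J * V ^ (1 - 2 / r)) * (ENNReal.ofReal R ^ 2 * κ ^ 2) * (∫⁻ x, ‖fderiv ℝ φ x‖ₑ ^ 2) +
      2 * (J * V ^ (1 - 2 / r)) * ∫⁻ x, ‖φ x‖ₑ ^ 2 := by
    calc V * ∫⁻ x, b x ^ 2 * ‖φ x‖ₑ ^ 2
        = ∫⁻ y in B, ∫⁻ x, b x ^ 2 * ‖φ x‖ₑ ^ 2 := by rw [setLIntegral_const, mul_comm]
      _ ≤ ∫⁻ y in B, (2 * (∫⁻ x, b x ^ 2 * ‖φ (x + (1 : ℝ) • y)‖ₑ ^ 2) +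
            2 * (ENNReal.ofReal R ^ 2 * (κ * ∫⁻ t in Set.Ioc (0 : ℝ) 1, ENNReal.ofReal (t ^ α) *
              ∫⁻ x, b x ^ 2 * ‖fderiv ℝ φ (x + t • y)‖ₑ ^ 2))) := by
          refine setLIntegral_mono' measurableSet_ball fun y hy => ?_
          have hy' : ‖y‖ ≤ R := (mem_ball_zero_iff.1 hy).le
          have e1 : ∫⁻ t in Set.Ioc (0 : ℝ) 1, ENNReal.ofReal (t ^ α) *
              ∫⁻ x, b x ^ 2 * ‖fderiv ℝ φ (x + t • y)‖ₑ ^ 2 =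
              ∫⁻ x, b x ^ 2 * ∫⁻ t in Set.Ioc (0 : ℝ) 1, ENNReal.ofReal (t ^ α) *
                ‖fderiv ℝ φ (x + t • y)‖ₑ ^ 2 := by
            have hm : Measurable fun p : ℝ × Space N => b p.2 ^ 2 *
                (ENNReal.ofReal (p.1 ^ α) * ‖fderiv ℝ φ (p.2 + p.1 • y)‖ₑ ^ 2) := by
              have := hjoint.comp (f := fun p : ℝ × Space N => ((p.2, y), p.1)) (by fun_prop)
              simp only [Function.comp_def] at this
              fun_prop
            calc _ = ∫⁻ t in Set.Ioc (0 : ℝ) 1, ∫⁻ x, b x ^ 2 * (ENNReal.ofReal (t ^ α) *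
                ‖fderiv ℝ φ (x + t • y)‖ₑ ^ 2) := by
                  refine lintegral_congr fun t => ?_
                  rw [← lintegral_const_mul _ (by fun_prop)]
                  refine lintegral_congr fun x => ?_
                  ring
              _ = _ := by
                  rw [lintegral_lintegral_swap hm.aemeasurable]
                  refine lintegral_congr fun x => ?_
                  rw [lintegral_const_mul _ (by fun_prop)]
          rw [e1, ← lintegral_const_mul _ (by fun_prop)]
          have hm2 : Measurable fun x => b x ^ 2 * ∫⁻ t in Set.Ioc (0 : ℝ) 1,
              ENNReal.ofReal (t ^ α) * ‖fderiv ℝ φ (x + t • y)‖ₑ ^ 2 := by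
            refine (hb.pow_const 2).mul (Measurable.lintegral_prod_right' (f := fun p : Space N × ℝ =>
              ENNReal.ofReal (p.2 ^ α) * ‖fderiv ℝ φ (p.1 + p.2 • y)‖ₑ ^ 2) ?_)
            have := hjoint.comp (f := fun p : Space N × ℝ => ((p.1, y), p.2)) (by fun_prop)
            simp only [Function.comp_def] at this
            fun_prop
          rw [← lintegral_const_mul _ hm2, ← lintegral_const_mul _ (by fun_prop),
            ← lintegral_const_mul _ (by fun_prop), ← lintegral_add_left (by fun_prop)]
          refine lintegral_mono fun x => ?_
          refine (mul_le_mul_right (enorm_sq_le_of_contDiff hφ (α := α) x y hy') (b x ^ 2)).trans_eq ?_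
          rw [one_smul]
          ring
      _ = 2 * (∫⁻ y in B, ∫⁻ x, b x ^ 2 * ‖φ (x + (1 : ℝ) • y)‖ₑ ^ 2) +
            2 * (ENNReal.ofReal R ^ 2 * (κ * ∫⁻ t in Set.Ioc (0 : ℝ) 1, ENNReal.ofReal (t ^ α) *
              ∫⁻ y in B, ∫⁻ x, b x ^ 2 * ‖fderiv ℝ φ (x + t • y)‖ₑ ^ 2)) := by
          have hm1 : Measurable fun y => ∫⁻ x, b x ^ 2 * ‖φ (x + (1 : ℝ) • y)‖ₑ ^ 2 := by
            refine Measurable.lintegral_prod_right' (f := fun p : Space N × Space N =>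
              b p.2 ^ 2 * ‖φ (p.2 + (1 : ℝ) • p.1)‖ₑ ^ 2) ?_
            fun_prop
          have hm3 : Measurable fun p : Space N × ℝ =>
              ENNReal.ofReal (p.2 ^ α) * ∫⁻ x, b x ^ 2 * ‖fderiv ℝ φ (x + p.2 • p.1)‖ₑ ^ 2 := by
            have : Measurable fun p : Space N × ℝ =>
                ∫⁻ x, b x ^ 2 * ‖fderiv ℝ φ (x + p.2 • p.1)‖ₑ ^ 2 := by
              refine Measurable.lintegral_prod_right' (f := fun p : (Space N × ℝ) × Space N =>
                b p.2 ^ 2 * ‖fderiv ℝ φ (p.2 + p.1.2 • p.1.1)‖ₑ ^ 2) ?_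
              have := hjoint.comp (f := fun p : (Space N × ℝ) × Space N => ((p.2, p.1.1), p.1.2))
                (by fun_prop)
              simp only [Function.comp_def] at this
              fun_prop
            fun_prop
          have hm4 : Measurable fun y : Space N => ∫⁻ t in Set.Ioc (0 : ℝ) 1,
              ENNReal.ofReal (t ^ α) * ∫⁻ x, b x ^ 2 * ‖fderiv ℝ φ (x + t • y)‖ₑ ^ 2 :=
            hm3.lintegral_prod_right'
          have hswap : ∫⁻ y in B, ∫⁻ t in Set.Ioc (0 : ℝ) 1, ENNReal.ofReal (t ^ α) *
              ∫⁻ x, b x ^ 2 * ‖fderiv ℝ φ (x + t • y)‖ₑ ^ 2 =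
              ∫⁻ t in Set.Ioc (0 : ℝ) 1, ∫⁻ y in B, ENNReal.ofReal (t ^ α) *
                ∫⁻ x, b x ^ 2 * ‖fderiv ℝ φ (x + t • y)‖ₑ ^ 2 :=
            lintegral_lintegral_swap hm3.aemeasurable
          rw [lintegral_add_left (hm1.const_mul _), lintegral_const_mul _ hm1,
            lintegral_const_mul _ (by fun_prop), lintegral_const_mul _ (by fun_prop),
            lintegral_const_mul _ hm4, hswap]
          congr 5
          funext t
          rw [lintegral_const_mul]
          refine Measurable.lintegral_prod_right' (f := fun p : Space N × Space N =>
            b p.2 ^ 2 * ‖fderiv ℝ φ (p.2 + t • p.1)‖ₑ ^ 2) ?_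
          have := hjoint.comp (f := fun p : Space N × Space N => ((p.2, p.1), t)) (by fun_prop)
          simp only [Function.comp_def] at this
          fun_prop
      _ ≤ 2 * (J * V ^ (1 - 2 / r) * ∫⁻ x, ‖φ x‖ₑ ^ 2) + 2 * (ENNReal.ofReal R ^ 2 *
            (κ * (κ * (J * V ^ (1 - 2 / r)) * ∫⁻ x, ‖fderiv ℝ φ x‖ₑ ^ 2))) := by
          gcongr
          · refine (lintegral_ball_weight_le hb hP hr2 one_ne_zero R).trans_eq ?_
            simp [J, V, B]
          · calc _ ≤ ∫⁻ t in Set.Ioc (0 : ℝ) 1, ENNReal.ofReal (t ^ (-α)) *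
                (J * V ^ (1 - 2 / r) * ∫⁻ x, ‖fderiv ℝ φ x‖ₑ ^ 2) := by
                  refine setLIntegral_mono' measurableSet_Ioc fun t ht => ?_
                  refine (mul_le_mul_right (lintegral_ball_weight_le hb hD hr2 ht.1.ne' R)
                    (ENNReal.ofReal (t ^ α))).trans_eq ?_
                  rw [abs_of_pos ht.1, ← mul_assoc, ← mul_assoc,
                    ← ENNReal.ofReal_mul (Real.rpow_nonneg ht.1.le _), ← Real.rpow_add ht.1,
                    mul_assoc]
                  congr 3
                  simp only [α]; ring
              _ = _ := by
                  rw [lintegral_mul_const _ (by fun_prop)]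
                  ring
      _ = _ := by ring
  have e : V ^ (1 - 2 / r) = V * V ^ (- (2 / r)) := by
    rw [sub_eq_add_neg, ENNReal.rpow_add _ _ hV0 hVt, ENNReal.rpow_one]
  rw [e] at hbase
  rw [← ENNReal.mul_le_mul_iff_right hV0 hVt]
  refine hbase.trans_eq ?_
  ring

/-- Multiplication by a weight in `L^r`, `r > N`, is form bounded with bound zero with respect to
the gradient. -/
theorem exists_weight_bound {b : Space N → ℝ≥0∞} (hb : Measurable b) {r : ℝ} (hr : N < r)
    (hr2 : 2 ≤ r) (hI : ∫⁻ y, b y ^ r < ⊤) {ε : ℝ} (hε : 0 < ε) :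
    ∃ C : ℝ≥0, ∀ φ : Space N → ℝ, ContDiff ℝ 1 φ →
      ∫⁻ x, b x ^ 2 * ‖φ x‖ₑ ^ 2 ≤
        ENNReal.ofReal ε * (∫⁻ x, ‖fderiv ℝ φ x‖ₑ ^ 2) + C * ∫⁻ x, ‖φ x‖ₑ ^ 2 := by
  have hr0 : 0 < r := by linarith
  have hα : (N : ℝ) / r < 1 := (div_lt_one hr0).2 hr
  set J := (∫⁻ y, b y ^ r) ^ (2 / r)
  set κ := ∫⁻ t in Set.Ioc (0 : ℝ) 1, ENNReal.ofReal (t ^ (-(N / r : ℝ))) with hκ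
  have hJ : J ≠ ⊤ := ENNReal.rpow_ne_top_of_nonneg (by positivity) hI.ne
  have hκt : κ ≠ ⊤ := (lintegral_Ioc_rpow_lt_top (by linarith)).ne
  set V₁ := volume (Metric.ball (0 : Space N) 1) with hV₁
  have hV₁0 : V₁ ≠ 0 := volume_ball_pos one_pos
  have hV₁t : V₁ ≠ ⊤ := volume_ball_ne_top 1
  set K := 2 * (J * V₁ ^ (-(2 / r))) * κ ^ 2 with hK
  have hVr : V₁ ^ (-(2 / r)) ≠ ⊤ := ENNReal.rpow_ne_top_of_ne_zero hV₁0 hV₁t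
  have hKt : K ≠ ⊤ := by
    apply ENNReal.mul_ne_top (ENNReal.mul_ne_top (by simp) (ENNReal.mul_ne_top hJ hVr))
    exact ENNReal.pow_ne_top hκt
  -- The gradient coefficient scales like `R² |B_R|^(-2/r) ~ R^s`, and `s > 0` because `r > N`; a
  -- small radius therefore makes it at most `ε`. The `+ 1` in the choice of `R` covers `K = 0`.
  set s : ℝ := 2 - 2 * (N / r) with hs
  have hs0 : 0 < s := by linarith
  set R : ℝ := (ε / (K.toReal + 1)) ^ (1 / s) with hRdef
  have hq : 0 < ε / (K.toReal + 1) := by positivity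
  have hR : 0 < R := Real.rpow_pos_of_pos hq _
  have hRs : R ^ s = ε / (K.toReal + 1) := by
    rw [hRdef, ← Real.rpow_mul hq.le, one_div, inv_mul_cancel₀ hs0.ne', Real.rpow_one]
  have hVR : volume (Metric.ball (0 : Space N) R) = ENNReal.ofReal (R ^ N) * V₁ := by
    have := Measure.addHaar_ball_mul_of_pos (volume : Measure (Space N)) 0 hR 1
    simpa using this
  have hVR0 : volume (Metric.ball (0 : Space N) R) ≠ 0 := volume_ball_pos hR
  have hVRt : volume (Metric.ball (0 : Space N) R) ≠ ⊤ := volume_ball_ne_top R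
  have hC : 2 * (J * volume (Metric.ball (0 : Space N) R) ^ (-(2 / r))) ≠ ⊤ :=
    ENNReal.mul_ne_top (by simp) (ENNReal.mul_ne_top hJ (ENNReal.rpow_ne_top_of_ne_zero hVR0 hVRt))
  refine ⟨(2 * (J * volume (Metric.ball (0 : Space N) R) ^ (-(2 / r)))).toNNReal, fun φ hφ => ?_⟩
  rw [ENNReal.coe_toNNReal hC]
  refine (lintegral_weight_le hb hr2 hφ hR).trans ?_
  gcongr
  have e1 : volume (Metric.ball (0 : Space N) R) ^ (-(2 / r)) * ENNReal.ofReal R ^ 2 =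
      ENNReal.ofReal (R ^ s) * V₁ ^ (-(2 / r)) := by
    rw [hVR, ENNReal.mul_rpow_of_ne_top ENNReal.ofReal_ne_top hV₁t,
      ENNReal.ofReal_rpow_of_pos (by positivity), ← ENNReal.ofReal_pow hR.le, mul_right_comm,
      ← ENNReal.ofReal_mul (by positivity)]
    congr 2
    rw [← Real.rpow_natCast R N, ← Real.rpow_mul hR.le, ← Real.rpow_natCast R 2,
      ← Real.rpow_add hR]
    congr 1
    rw [hs]; push_cast; ring
  calc _ = (volume (Metric.ball (0 : Space N) R) ^ (-(2 / r)) * ENNReal.ofReal R ^ 2) *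
        (2 * J * κ ^ 2) := by ring
    _ = ENNReal.ofReal (R ^ s) * K := by rw [e1, hK]; ring
    _ ≤ ENNReal.ofReal ε := by
      have e2 : ENNReal.ofReal K.toReal = K := ENNReal.ofReal_toReal hKt
      rw [hRs]
      nth_rw 2 [← e2]
      rw [← ENNReal.ofReal_mul hq.le]
      refine ENNReal.ofReal_le_ofReal ?_
      rw [div_mul_eq_mul_div, div_le_iff₀ (by positivity)]
      linarith

end WeightBound

/-! ### A Morrey-type bound for limits of smooth functions. -/

section LocalBoundedness

variable {N : ℕ}

/-- Local boundedness of limits of smooth functions whose gradients are asymptotically controlled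
by a function in `L^r`, `r > N`. -/
theorem ae_bounded_of_gradient {ϱ r : ℝ} (hr : N < r) (hr1 : 1 ≤ r) {w : Space N → ℝ}
    (hwm : AEMeasurable w) {W : ℕ → Space N → ℝ} {W' : ℕ → Space N → Space N →L[ℝ] ℝ}
    {q : Space N → ℝ≥0∞} (hWm : ∀ j, Measurable (W j)) (hW'm : ∀ j, Measurable (W' j))
    (hd : ∀ j, ∀ x ∈ Metric.ball 0 (ϱ + 1), HasFDerivAt (W j) (W' j x) x)
    (hc : ∀ j, ContinuousOn (W' j) (Metric.ball 0 (ϱ + 1)))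
    (hq : Measurable q) (hqr : ∫⁻ x, q x ^ r < ⊤)
    (hw : ∫⁻ x in Metric.ball 0 (ϱ + 1), ‖w x‖ₑ ≠ ⊤)
    (hWw : Tendsto (fun j => ∫⁻ x in Metric.ball 0 (ϱ + 1), ‖W j x - w x‖ₑ) atTop (𝓝 0))
    (hW'q : Tendsto (fun j => ∫⁻ x in Metric.ball 0 (ϱ + 1), (‖W' j x‖ₑ - q x)) atTop (𝓝 0)) :
    ∃ C : ℝ≥0, ∀ᵐ x, x ∈ Metric.ball (0 : Space N) ϱ → ‖w x‖ₑ ≤ C := by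
  set s := Metric.ball (0 : Space N) (ϱ + 1) with hs
  set B := Metric.ball (0 : Space N) 1 with hB
  have hsm : MeasurableSet s := measurableSet_ball
  have hr0 : 0 < r := by linarith
  have hα : (N : ℝ) / r < 1 := (div_lt_one hr0).2 hr
  set κ := ∫⁻ t in Set.Ioc (0 : ℝ) 1, ENNReal.ofReal (t ^ (-(N / r : ℝ)))
  have hκt : κ ≠ ⊤ := (lintegral_Ioc_rpow_lt_top (by linarith)).ne
  set V := volume B
  have hV0 : V ≠ 0 := volume_ball_pos one_pos
  have hVt : V ≠ ⊤ := volume_ball_ne_top 1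
  set M := κ * ((∫⁻ x, q x ^ r) ^ (1 / r) * V ^ (1 - 1 / r)) with hM
  have hMt : M ≠ ⊤ := ENNReal.mul_ne_top hκt (ENNReal.mul_ne_top
    (ENNReal.rpow_ne_top_of_nonneg (by positivity) hqr.ne)
    (ENNReal.rpow_ne_top_of_ne_zero hV0 hVt))
  -- The subtraction is truncated, so on `s` one has `‖W' j‖ ≤ q + d j`: the part `q` in `L^r` is
  -- bounded pointwise by Hölder on dilated balls, while the excess `d j` only tends to `0` in `L¹`.
  set d : ℕ → Space N → ℝ≥0∞ := fun j => s.indicator fun x => ‖W' j x‖ₑ - q x with hd'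
  have hdm : ∀ j, Measurable (d j) := fun j => ((hW'm j).enorm.sub hq).indicator hsm
  have hdj : ∀ j, ∫⁻ x, d j x = ∫⁻ x in s, (‖W' j x‖ₑ - q x) := fun j => lintegral_indicator hsm _
  set D : ℕ → Space N → ℝ≥0∞ := fun j x =>
    ∫⁻ t in Set.Ioc (0 : ℝ) 1, ∫⁻ y in B, d j (x + t • y) with hD
  have hmem : ∀ x ∈ Metric.ball (0 : Space N) ϱ, ∀ y ∈ B, ∀ t ∈ Set.Icc (0 : ℝ) 1,
      x + t • y ∈ s := by
    intro x hx y hy t ht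
    rw [hs, mem_ball_zero_iff]
    have hx := mem_ball_zero_iff.1 hx
    have hy := mem_ball_zero_iff.1 hy
    calc _ ≤ ‖x‖ + t * ‖y‖ := (norm_add_le _ _).trans (by
          rw [norm_smul, Real.norm_of_nonneg ht.1])
      _ < ϱ + 1 := by nlinarith [ht.1, ht.2, norm_nonneg y]
  have hdjoint : ∀ j, Measurable fun p : (Space N × Space N) × ℝ => d j (p.1.1 + p.2 • p.1.2) :=
    fun j => (hdm j).comp (by fun_prop)
  have hqjoint : Measurable fun p : (Space N × Space N) × ℝ => q (p.1.1 + p.2 • p.1.2) :=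
    hq.comp (by fun_prop)
  -- pointwise bound
  have hpt : ∀ j, ∀ x ∈ Metric.ball (0 : Space N) ϱ,
      V * ‖W j x‖ₑ ≤ (∫⁻ x in s, ‖W j x‖ₑ) + M + D j x := by
    intro j x hx
    have h1 : ∀ y ∈ B, ‖W j x‖ₑ ≤ s.indicator (fun z => ‖W j z‖ₑ) (x + y) +
        ∫⁻ t in Set.Ioc (0 : ℝ) 1, (q (x + t • y) + d j (x + t • y)) := by
      intro y hy
      have h2 := enorm_le_of_hasDerivAt (f := fun t => W j (x + t • y))
        (f' := fun t => W' j (x + t • y) y)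
        (fun t ht => by
          have h2 : HasDerivAt (fun t : ℝ => x + t • y) y t := by
            simpa using ((hasDerivAt_id t).smul_const y).const_add x
          exact (hd j _ (hmem x hx y hy t ht)).comp_hasDerivAt t h2)
        (by
          have h3 : ContinuousOn (fun t : ℝ => W' j (x + t • y)) (Set.Icc 0 1) :=
            (hc j).comp (by fun_prop) fun t ht => hmem x hx y hy t ht
          exact h3.clm_apply continuousOn_const)
      simp only [zero_smul, add_zero, one_smul] at h2
      refine h2.trans (add_le_add ?_ (setLIntegral_mono' measurableSet_Ioc fun t ht => ?_))
      · rw [Set.indicator_of_mem]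
        have := hmem x hx y hy 1 (by simp)
        rwa [one_smul] at this
      · have hmt := hmem x hx y hy t (Set.Ioc_subset_Icc_self ht)
        refine (ContinuousLinearMap.le_opENorm _ _).trans ?_
        have hy1 : ‖y‖ₑ ≤ 1 := by
          rw [← ofReal_norm, ← ENNReal.ofReal_one]
          exact ENNReal.ofReal_le_ofReal (mem_ball_zero_iff.1 hy).le
        calc ‖W' j (x + t • y)‖ₑ * ‖y‖ₑ ≤ ‖W' j (x + t • y)‖ₑ * 1 := by gcongr
          _ ≤ _ := by
            rw [mul_one, hd']
            simp only [Set.indicator_of_mem hmt]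
            exact le_add_tsub
    have hmW : Measurable fun y => s.indicator (fun z => ‖W j z‖ₑ) (x + y) :=
      ((hWm j).enorm.indicator hsm).comp (measurable_const_add x)
    have hqx : Measurable fun p : Space N × ℝ => q (x + p.2 • p.1) :=
      hqjoint.comp (f := fun p : Space N × ℝ => ((x, p.1), p.2)) (by fun_prop)
    have hdx : Measurable fun p : Space N × ℝ => d j (x + p.2 • p.1) :=
      (hdjoint j).comp (f := fun p : Space N × ℝ => ((x, p.1), p.2)) (by fun_prop)
    calc V * ‖W j x‖ₑ = ∫⁻ y in B, ‖W j x‖ₑ := by rw [setLIntegral_const, mul_comm]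
      _ ≤ ∫⁻ y in B, (s.indicator (fun z => ‖W j z‖ₑ) (x + y) +
          ((∫⁻ t in Set.Ioc (0 : ℝ) 1, q (x + t • y)) +
            ∫⁻ t in Set.Ioc (0 : ℝ) 1, d j (x + t • y))) := by
          refine setLIntegral_mono' measurableSet_ball fun y hy => (h1 y hy).trans_eq ?_
          rw [lintegral_add_left]
          exact hq.comp (by fun_prop)
      _ = (∫⁻ y in B, s.indicator (fun z => ‖W j z‖ₑ) (x + y)) +
          ((∫⁻ y in B, ∫⁻ t in Set.Ioc (0 : ℝ) 1, q (x + t • y)) +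
            ∫⁻ y in B, ∫⁻ t in Set.Ioc (0 : ℝ) 1, d j (x + t • y)) := by
          rw [lintegral_add_left hmW, lintegral_add_left hqx.lintegral_prod_right']
      _ ≤ (∫⁻ x in s, ‖W j x‖ₑ) + (M + D j x) := by
          refine add_le_add ?_ (add_le_add ?_ (le_of_eq ?_))
          · refine (setLIntegral_le_lintegral _ _).trans_eq ?_
            rw [lintegral_add_left_eq_self (fun y => s.indicator (fun z => ‖W j z‖ₑ) y),
              lintegral_indicator hsm]
          · rw [lintegral_lintegral_swap hqx.aemeasurable, hM, ← lintegral_mul_const _ (by fun_prop)]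
            refine setLIntegral_mono' measurableSet_Ioc fun t ht => ?_
            refine (lintegral_ball_add_smul_le hq x ht.1.ne' 1 hr1).trans_eq ?_
            rw [abs_of_pos ht.1]
          · exact lintegral_lintegral_swap hdx.aemeasurable
      _ = _ := by rw [add_assoc]
  have hDint : ∀ j, ∫⁻ x, D j x ≤ V * ∫⁻ x, d j x := by
    intro j
    have hm1 : Measurable fun p : (Space N × ℝ) × Space N => d j (p.1.1 + p.1.2 • p.2) :=
      (hdjoint j).comp (f := fun p : (Space N × ℝ) × Space N => ((p.1.1, p.2), p.1.2))
        (by fun_prop)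
    have hm2 : Measurable fun p : Space N × ℝ => ∫⁻ y in B, d j (p.1 + p.2 • y) :=
      hm1.lintegral_prod_right'
    have e1 : ∫⁻ x, D j x = ∫⁻ t in Set.Ioc (0 : ℝ) 1, ∫⁻ x, ∫⁻ y in B, d j (x + t • y) :=
      lintegral_lintegral_swap hm2.aemeasurable
    rw [e1]
    have e2 : ∀ t : ℝ, ∫⁻ x, ∫⁻ y in B, d j (x + t • y) = V * ∫⁻ x, d j x := by
      intro t
      have hm3 : Measurable fun p : Space N × Space N => d j (p.1 + t • p.2) :=
        (hdm j).comp (by fun_prop)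
      rw [lintegral_lintegral_swap hm3.aemeasurable]
      simp only [lintegral_add_right_eq_self (d j)]
      rw [setLIntegral_const, mul_comm]
    simp only [e2]
    rw [setLIntegral_const]
    simp
  set A := ∫⁻ x in s, ‖w x‖ₑ
  have hAj : ∀ j, ∫⁻ x in s, ‖W j x‖ₑ ≤ (∫⁻ x in s, ‖W j x - w x‖ₑ) + A := by
    intro j
    rw [← lintegral_add_right' _ hwm.enorm.restrict]
    refine lintegral_mono fun x => ?_
    have := enorm_add_le (W j x - w x) (w x)
    simpa using this
  have hbs : Metric.ball (0 : Space N) ϱ ⊆ s := Metric.ball_subset_ball (by linarith)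
  -- The excess vanishes only in `L¹`, so the pointwise bound is integrated over an arbitrary set
  -- before `j → ∞`; comparing integrals over all such sets recovers the almost everywhere bound.
  have key : ∀ E, MeasurableSet E → E ⊆ Metric.ball (0 : Space N) ϱ → volume E < ⊤ →
      V * ∫⁻ x in E, ‖w x‖ₑ ≤ (A + M) * volume E := by
    intro E hE hEs hEt
    have hj : ∀ j, V * ∫⁻ x in E, ‖w x‖ₑ ≤ V * (∫⁻ x in s, ‖W j x - w x‖ₑ) +
        (((∫⁻ x in s, ‖W j x - w x‖ₑ) + (A + M)) * volume E +
          V * ∫⁻ x in s, (‖W' j x‖ₑ - q x)) := by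
      intro j
      calc V * ∫⁻ x in E, ‖w x‖ₑ = ∫⁻ x in E, V * ‖w x‖ₑ :=
            (lintegral_const_mul'' _ hwm.enorm.restrict).symm
        _ ≤ ∫⁻ x in E, (V * ‖W j x - w x‖ₑ +
            (((∫⁻ x in s, ‖W j x - w x‖ₑ) + (A + M)) + D j x)) := by
          refine setLIntegral_mono_ae' hE (Eventually.of_forall fun x hx => ?_)
          have h1 : ‖w x‖ₑ ≤ ‖W j x - w x‖ₑ + ‖W j x‖ₑ := by
            have := enorm_sub_le (a := W j x) (b := W j x - w x)
            rw [add_comm]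
            simpa using this
          calc V * ‖w x‖ₑ ≤ V * (‖W j x - w x‖ₑ + ‖W j x‖ₑ) := by gcongr
            _ = V * ‖W j x - w x‖ₑ + V * ‖W j x‖ₑ := mul_add _ _ _
            _ ≤ V * ‖W j x - w x‖ₑ + ((∫⁻ x in s, ‖W j x‖ₑ) + M + D j x) := by
                gcongr; exact hpt j x (hEs hx)
            _ ≤ V * ‖W j x - w x‖ₑ + (((∫⁻ x in s, ‖W j x - w x‖ₑ) + A) + M + D j x) := by
                gcongr; exact hAj j
            _ = _ := by rw [add_assoc (∫⁻ x in s, ‖W j x - w x‖ₑ)]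
        _ = V * (∫⁻ x in E, ‖W j x - w x‖ₑ) + (((∫⁻ x in s, ‖W j x - w x‖ₑ) + (A + M)) * volume E +
            ∫⁻ x in E, D j x) := by
          have hm : AEMeasurable (fun x => ‖W j x - w x‖ₑ) (volume.restrict E) :=
            ((hWm j).aemeasurable.sub hwm).enorm.restrict
          rw [lintegral_add_left' (hm.const_mul _), lintegral_const_mul'' _ hm,
            lintegral_add_left measurable_const, setLIntegral_const]
        _ ≤ _ := by
          refine add_le_add (mul_le_mul_right (lintegral_mono_set (hEs.trans hbs)) V)
            (add_le_add le_rfl ?_)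
          · rw [← hdj]
            exact (setLIntegral_le_lintegral _ _).trans (hDint j)
    have hlim : Tendsto (fun j => V * (∫⁻ x in s, ‖W j x - w x‖ₑ) +
        (((∫⁻ x in s, ‖W j x - w x‖ₑ) + (A + M)) * volume E +
          V * ∫⁻ x in s, (‖W' j x‖ₑ - q x))) atTop
        (𝓝 (V * 0 + ((0 + (A + M)) * volume E + V * 0))) :=
      (ENNReal.Tendsto.const_mul hWw (Or.inr hVt)).add
        ((ENNReal.Tendsto.mul_const (hWw.add_const _) (Or.inr hEt.ne)).add
          (ENNReal.Tendsto.const_mul hW'q (Or.inr hVt)))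
    have := ge_of_tendsto' hlim hj
    simpa using this
  have hCt : (A + M) / V ≠ ⊤ := ENNReal.div_ne_top (ENNReal.add_ne_top.2 ⟨hw, hMt⟩) hV0
  refine ⟨((A + M) / V).toNNReal, ?_⟩
  rw [ENNReal.coe_toNNReal hCt]
  rw [← ae_restrict_iff' measurableSet_ball]
  refine ae_le_of_forall_setLIntegral_le_of_sigmaFinite₀ hwm.enorm.restrict fun E hE hEt => ?_
  rw [Measure.restrict_restrict hE]
  have h1 := key (E ∩ Metric.ball (0 : Space N) ϱ) (hE.inter measurableSet_ball)
    Set.inter_subset_right ((measure_mono Set.inter_subset_right).trans_lt measure_ball_lt_top)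
  rw [setLIntegral_const, ← ENNReal.mul_le_mul_iff_right hV0 hVt]
  refine h1.trans_eq ?_
  rw [← mul_assoc, ENNReal.mul_div_cancel hV0 hVt]

end LocalBoundedness

/-! ### Local approximation and local boundedness of the density. -/

section Density

variable {N : ℕ}

/-- A smooth cutoff function equal to one on a ball of radius `a > 0`. -/
theorem exists_cutoff {a : ℝ} (ha : 0 < a) : ∃ ζ : Space N → ℝ, IsTest ζ ∧
    (∀ x, ‖x‖ ≤ a → ζ x = 1) ∧ (∀ x, a + 1 ≤ ‖x‖ → ζ x = 0) := by
  let f : ContDiffBump (0 : Space N) := ⟨a, a + 1, ha, by linarith⟩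
  refine ⟨f, ⟨f.contDiff, f.hasCompactSupport⟩, fun x hx => ?_, fun x hx => ?_⟩
  · exact f.one_of_mem_closedBall (by simpa using hx)
  · exact f.zero_of_le_dist (by simpa using hx)

theorem le_mollify (n : ℕ) {u : Space N → ℝ} (hu : LocallyIntegrable u) {c : ℝ} {x : Space N}
    (h : ∀ᵐ y, ‖x - y‖ < 1 / ((n : ℝ) + 1) → c ≤ u y) : c ≤ mollify n u x := by
  have hi : Integrable fun y => molKer N n (x - y) * u y :=
    ((isTest_molKer n).compact.convolutionExists_left (ContinuousLinearMap.lsmul ℝ ℝ)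
      (isTest_molKer n).continuous hu x).integrable_swap
  have h2 : Integrable fun y => molKer N n (x - y) * c :=
    (((isTest_molKer n).comp_sub_left x).integrable volume).mul_const c
  have e : ∫ y, molKer N n (x - y) * c = c := by
    rw [integral_mul_const, integral_sub_left_eq_self (molKer N n), integral_molKer, one_mul]
  rw [mollify_swap, ← e]
  refine integral_mono_ae h2 hi (h.mono fun y hy => ?_)
  by_cases hxy : ‖x - y‖ < 1 / ((n : ℝ) + 1)
  · exact mul_le_mul_of_nonneg_left (hy hxy) (molKer_nonneg _ _)
  · simp [molKer_eq_zero n (not_lt.1 hxy)]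

theorem MemLpLoc.mul_isTest {u ζ : Space N → ℝ} (hu : MemLpLoc u 2) (hζ : IsTest ζ) :
    MemLp (fun x => ζ x * u x) 2 volume := by
  obtain ⟨C, hC0, hC⟩ := hζ.exists_bound
  have hK : IsCompact (tsupport ζ) := hζ.compact
  have h1 : MemLp (fun x => ζ x * u x) 2 (volume.restrict (tsupport ζ)) :=
    MemLp.of_le_mul (c := C) (hu _ hK)
      (hζ.continuous.aestronglyMeasurable.mul (hu _ hK).1)
      (Eventually.of_forall fun x => by
        rw [norm_mul]; exact mul_le_mul_of_nonneg_right (hC x) (norm_nonneg _))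
  have e : (tsupport ζ).indicator (fun x => ζ x * u x) = fun x => ζ x * u x := by
    rw [Set.indicator_eq_self]
    intro x hx
    exact subset_tsupport ζ (left_ne_zero_of_mul hx)
  rw [← e, memLp_indicator_iff_restrict (isClosed_tsupport ζ).measurableSet]
  exact h1

theorem MemLpLoc.comp_apply {G : Space N → Space N} (h : MemLpLoc G 2) (i : Fin N) :
    MemLpLoc (fun x => G x i) 2 := fun K hK => by
  refine MemLp.of_le (h K hK) ?_ (Eventually.of_forall fun x => PiLp.norm_apply_le _ i)
  exact (PiLp.continuous_apply 2 _ i).comp_aestronglyMeasurable (h K hK).1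

theorem MemLpLoc.locallyIntegrable {F : Type*} [NormedAddCommGroup F] {u : Space N → F}
    (h : MemLpLoc u 2) : LocallyIntegrable u := by
  rw [locallyIntegrable_iff]
  intro K hK
  have : IsFiniteMeasure (volume.restrict K) := ⟨by simpa using hK.measure_lt_top⟩
  exact (h K hK).integrable (by norm_num)

theorem IsTest.integrable_mul {φ u : Space N → ℝ} (hφ : IsTest φ) (hu : LocallyIntegrable u) :
    Integrable fun x => φ x * u x := by
  have := hu.integrable_smul_left_of_hasCompactSupport hφ.continuous hφ.compact
  simpa using this

variable {ρ : Space N → ℝ} {G : Space N → Space N} {μ : Measure (Space N)}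

theorem IsAdmissible.weak (h : IsAdmissible ρ G μ) {φ : Space N → ℝ} (hφ : IsTest φ) (i : Fin N) :
    ∫ x, ρ x * pd i φ x = - ∫ x, G x i * φ x := h.isWeakGradient φ hφ.smooth hφ.compact i

theorem IsAdmissible.exists_lower_bound (h : IsAdmissible ρ G μ) (a : ℝ) :
    ∃ c, 0 < c ∧ ∀ᵐ x, ‖x‖ ≤ a → c ≤ ρ x := by
  obtain ⟨c, hc, hh⟩ := h.locally_bounded_below _ (isCompact_closedBall (0 : Space N) a)
  refine ⟨c, hc, ?_⟩
  rw [ae_restrict_iff' measurableSet_closedBall] at hh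
  simpa using hh

/-- Smooth positive approximation of the density on a ball. -/
theorem IsAdmissible.exists_approx (h : IsAdmissible ρ G μ) {a : ℝ} (ha : 0 < a) :
    ∃ (c : ℝ) (u : Space N → ℝ) (g : Fin N → Space N → ℝ) (P : ℕ → Space N → ℝ), 0 < c ∧
      (∀ᵐ x, ‖x‖ ≤ a → c ≤ ρ x) ∧ MemLp u 2 volume ∧ (∀ i, MemLp (g i) 2 volume) ∧
      (∀ x, ‖x‖ ≤ a → u x = ρ x) ∧ (∀ i x, ‖x‖ < a → g i x = G x i) ∧ (∀ j, IsTest (P j)) ∧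
      (∀ j x, ‖x‖ < a → c ≤ P j x) ∧
      Tendsto (fun j => eLpNorm (P j - u) 2 volume) atTop (𝓝 0) ∧
      ∀ i, Tendsto (fun j => eLpNorm (pd i (P j) - g i) 2 volume) atTop (𝓝 0) := by
  -- The cutoff is `1` out to radius `a + 1`, and the mollification radius `1/(j + 1)` is at most
  -- `1`. Mollifications therefore see only `ρ` itself inside radius `a`, and keep its lower bound
  -- `c`.
  obtain ⟨ζ, hζ, hζ1, -⟩ := exists_cutoff (N := N) (a := a + 1) (by linarith)
  obtain ⟨c, hc, hcρ⟩ := h.exists_lower_bound (a + 1)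
  set u : Space N → ℝ := fun x => ζ x * ρ x
  set g : Fin N → Space N → ℝ := fun i x => ζ x * G x i + pd i ζ x * ρ x
  have hu : MemLp u 2 volume := h.memLpLoc.mul_isTest hζ
  have hg : ∀ i, MemLp (g i) 2 volume := fun i =>
    ((h.gradient_memLpLoc.comp_apply i).mul_isTest hζ).add (h.memLpLoc.mul_isTest (hζ.pd i))
  have hul : LocallyIntegrable u := hu.locallyIntegrable (by norm_num)
  have hρl := h.memLpLoc.locallyIntegrable
  have hGl := fun i => (h.gradient_memLpLoc.comp_apply i).locallyIntegrable
  have hweak : ∀ i ψ, IsTest ψ → ∫ x, u x * pd i ψ x = -∫ x, g i x * ψ x := by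
    intro i ψ hψ
    have h1 := h.weak (hζ.mul_right hψ.smooth) i
    have e1 : ∀ x, ρ x * pd i (fun y => ζ y * ψ y) x = u x * pd i ψ x + ρ x * (pd i ζ x * ψ x) := by
      intro x
      rw [pd_mul i (hζ.differentiable x) (hψ.differentiable x)]
      simp only [u]; ring
    have i1 : Integrable fun x => u x * pd i ψ x := by
      have := (hψ.pd i).integrable_mul hul
      simpa only [mul_comm] using this
    have i2 : Integrable fun x => ρ x * (pd i ζ x * ψ x) := by
      have := ((hζ.pd i).mul_right hψ.smooth).integrable_mul hρl
      simpa only [mul_comm] using this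
    have i3 : Integrable fun x => G x i * (ζ x * ψ x) := by
      have := (hζ.mul_right hψ.smooth).integrable_mul (hGl i)
      simpa only [mul_comm] using this
    simp only [e1] at h1
    rw [integral_add i1 i2] at h1
    have e2 : ∀ x, g i x * ψ x = G x i * (ζ x * ψ x) + ρ x * (pd i ζ x * ψ x) := by
      intro x; simp only [g]; ring
    simp only [e2]
    rw [integral_add i3 i2]
    linarith
  have hpd : ∀ i j, pd i (mollify j u) = mollify j (g i) := fun i j =>
    pd_mollify_of_weak j hul (hweak i)
  refine ⟨c, u, g, fun j => mollify j u, hc, hcρ.mono fun x hx hxa => hx (by linarith), hu, hg,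
    fun x hx => ?_, fun i x hx => ?_, fun j => isTest_mollify j hul ?_, fun j x hx => ?_,
    tendsto_eLpNorm_mollify hu, fun i => ?_⟩
  · simp only [u, hζ1 x (by linarith), one_mul]
  · have hev : ζ =ᶠ[𝓝 x] fun _ => 1 := by
      have : ∀ᶠ y in 𝓝 x, ‖y‖ < a := (continuous_norm.tendsto x).eventually_lt_const hx
      exact this.mono fun y hy => hζ1 y (by linarith)
    have h0 : pd i ζ x = 0 := by
      unfold pd; rw [hev.fderiv_eq]; simp
    simp only [g, h0, hζ1 x (by linarith)]; ring
  · exact hζ.compact.mul_right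
  · refine le_mollify j hul (hcρ.mono fun y hy hxy => ?_)
    have h1 : 1 / ((j : ℝ) + 1) ≤ 1 := by
      rw [div_le_one (by positivity)]; linarith [(j.cast_nonneg : (0 : ℝ) ≤ j)]
    have h2 : ‖y‖ ≤ a + 1 := by
      have : ‖y‖ ≤ ‖x‖ + ‖x - y‖ := by
        have := norm_sub_le x (x - y); simpa using this
      linarith
    simp only [u, hζ1 y h2, one_mul]
    exact hy h2
  · simp only [hpd]
    exact tendsto_eLpNorm_mollify (hg i)

theorem lintegral_mul_le_eLpNorm {f g : Space N → ℝ} {ν : Measure (Space N)}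
    (hf : AEStronglyMeasurable f ν) (hg : AEStronglyMeasurable g ν) :
    ∫⁻ x, ‖f x‖ₑ * ‖g x‖ₑ ∂ν ≤ eLpNorm f 2 ν * eLpNorm g 2 ν := by
  have h := sq_lintegral_mul_le hf.enorm hg.enorm
  rw [← eLpNorm_two_sq, ← eLpNorm_two_sq, ← mul_pow] at h
  exact (ENNReal.pow_le_pow_left_iff two_ne_zero).1 h

/-- If the given exponent is below `2` then `N < 2`, and the exponent `2` serves instead, since `G`
is locally in `L²` and `ρ` is locally bounded below. -/
theorem IsAdmissible.exists_exponent (h : IsAdmissible ρ G μ) :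
    ∃ r : ℝ, (N : ℝ) < r ∧ 2 ≤ r ∧ MemLpLoc (fun x => (ρ x)⁻¹ • G x) (ENNReal.ofReal r) := by
  obtain ⟨r, hr, hG⟩ := h.logGradient_memLpLoc
  rcases le_or_gt 2 r with h2 | h2
  · exact ⟨r, hr, h2, hG⟩
  refine ⟨2, hr.trans h2, le_rfl, fun K hK => ?_⟩
  obtain ⟨c, hc, hcρ⟩ := h.locally_bounded_below K hK
  have hGK := h.gradient_memLpLoc K hK
  have e : ENNReal.ofReal 2 = 2 := by simp
  rw [e]
  refine MemLp.of_le_mul (c := c⁻¹) hGK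
    (h.integrable.aestronglyMeasurable.restrict.aemeasurable.inv.aestronglyMeasurable.smul hGK.1) ?_
  filter_upwards [hcρ] with x hx
  rw [norm_smul, norm_inv, Real.norm_of_nonneg (hc.le.trans hx)]
  gcongr

/-- A globally integrable measurable weight dominating `‖∇ρ / ρ‖` on a ball. -/
theorem IsAdmissible.exists_weight (h : IsAdmissible ρ G μ) (a : ℝ) :
    ∃ (r : ℝ) (b : Space N → ℝ≥0∞), (N : ℝ) < r ∧ 2 ≤ r ∧ Measurable b ∧ ∫⁻ x, b x ^ r < ⊤ ∧
      ∀ᵐ x, ‖x‖ ≤ a → b x = ‖(ρ x)⁻¹ • G x‖ₑ := by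
  obtain ⟨r, hr, h2, hG⟩ := h.exists_exponent
  have hm := hG _ (isCompact_closedBall (0 : Space N) a)
  have hr0 : 0 < r := by linarith
  have hlt := lintegral_rpow_enorm_lt_top_of_eLpNorm_lt_top (by simpa using hr0) (by simp) hm.2
  rw [ENNReal.toReal_ofReal hr0.le] at hlt
  have hae := (hm.1.enorm)
  obtain ⟨b₀, hb₀, hbe⟩ := hae
  refine ⟨r, (Metric.closedBall 0 a).indicator b₀, hr, h2, hb₀.indicator measurableSet_closedBall,
    ?_, ?_⟩
  · have e : (fun x => (Metric.closedBall (0 : Space N) a).indicator b₀ x ^ r) =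
        (Metric.closedBall (0 : Space N) a).indicator fun x => b₀ x ^ r := by
      funext x
      by_cases hx : x ∈ Metric.closedBall (0 : Space N) a <;> simp [hx, hr0]
    rw [e, lintegral_indicator measurableSet_closedBall]
    refine lt_of_eq_of_lt (lintegral_congr_ae ?_) hlt
    filter_upwards [hbe] with x hx
    rw [hx]
  · rw [EventuallyEq, ae_restrict_iff' measurableSet_closedBall] at hbe
    filter_upwards [hbe] with x hx hxa
    have hx' : x ∈ Metric.closedBall (0 : Space N) a := by simpa using hxa
    rw [Set.indicator_of_mem hx', hx hx']

theorem norm_le_sum_of_apply_eq {Λ : Space N →L[ℝ] ℝ} {t : Fin N → ℝ}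
    (h : ∀ v : Space N, Λ v = ∑ i, v i * t i) : ‖Λ‖ ≤ ∑ i, |t i| := by
  refine Λ.opNorm_le_bound (Finset.sum_nonneg fun _ _ => abs_nonneg _) fun v => ?_
  rw [h, Finset.sum_mul]
  refine (Finset.abs_sum_le_sum_abs _ _).trans (Finset.sum_le_sum fun i _ => ?_)
  rw [abs_mul, mul_comm]
  exact mul_le_mul_of_nonneg_left (PiLp.norm_apply_le v i) (abs_nonneg _)

/-- Used with `p` and `φ` the smooth approximation and `w = ρ`, `V = G`: the excess of the
approximate logarithmic gradient is linear in differences that tend to `0` in `L²`, with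
coefficients fixed by the common lower bound. -/
theorem norm_log_gradient_le {c p w : ℝ} (hc : 0 < c) (hp : c ≤ p) (hw : c ≤ w)
    (φ : Space N → ℝ) (x V : Space N) :
    ‖p⁻¹ • fderiv ℝ φ x‖ ≤ ‖w⁻¹ • V‖ +
      ∑ i, (c⁻¹ * |pd i φ x - V i| + (c ^ 2)⁻¹ * (|V i| * |p - w|)) := by
  have hp0 : 0 < p := hc.trans_le hp
  have hw0 : 0 < w := hc.trans_le hw
  set Λ : Space N →L[ℝ] ℝ := innerSL ℝ (w⁻¹ • V)
  have h1 : ‖p⁻¹ • fderiv ℝ φ x‖ ≤ ‖Λ‖ + ‖p⁻¹ • fderiv ℝ φ x - Λ‖ := by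
    have := norm_add_le Λ (p⁻¹ • fderiv ℝ φ x - Λ)
    simpa using this
  have h2 : ‖Λ‖ = ‖w⁻¹ • V‖ := innerSL_apply_norm _ _
  have h3 : ‖p⁻¹ • fderiv ℝ φ x - Λ‖ ≤ ∑ i, |p⁻¹ * pd i φ x - w⁻¹ * V i| := by
    refine norm_le_sum_of_apply_eq fun v => ?_
    simp only [sub_apply, smul_apply, Λ, innerSL_apply_apply,
      fderiv_eq_sum_pd φ x v, PiLp.inner_apply, smul_eq_mul, Finset.mul_sum]
    rw [← Finset.sum_sub_distrib]
    refine Finset.sum_congr rfl fun i _ => ?_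
    simp
    ring
  rw [h2] at h1
  refine h1.trans (add_le_add_right (h3.trans (Finset.sum_le_sum fun i _ => ?_)) _)
  have e : p⁻¹ * pd i φ x - w⁻¹ * V i =
      p⁻¹ * (pd i φ x - V i) - (p⁻¹ * w⁻¹) * (V i * (p - w)) := by
    field_simp; ring
  rw [e]
  refine (abs_sub _ _).trans ?_
  rw [abs_mul, abs_mul, abs_of_pos (inv_pos.2 hp0),
    abs_of_pos (mul_pos (inv_pos.2 hp0) (inv_pos.2 hw0)), abs_mul]
  have e2 : (c ^ 2)⁻¹ = c⁻¹ * c⁻¹ := by rw [sq, mul_inv]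
  rw [e2]
  gcongr

theorem abs_log_sub_log_le {c p w : ℝ} (hc : 0 < c) (hp : c ≤ p) (hw : c ≤ w) :
    |Real.log p - Real.log w| ≤ c⁻¹ * |p - w| := by
  have key : ∀ p w : ℝ, c ≤ p → c ≤ w → Real.log p - Real.log w ≤ c⁻¹ * |p - w| := by
    intro p w hp hw
    have hp0 : 0 < p := hc.trans_le hp
    have hw0 : 0 < w := hc.trans_le hw
    rw [← Real.log_div hp0.ne' hw0.ne']
    refine (Real.log_le_sub_one_of_pos (by positivity)).trans ?_
    have : p / w - 1 = w⁻¹ * (p - w) := by field_simp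
    rw [this]
    calc w⁻¹ * (p - w) ≤ w⁻¹ * |p - w| := by gcongr; exact le_abs_self _
      _ ≤ _ := by gcongr
  rw [abs_le]
  constructor
  · have := key w p hw hp
    rw [abs_sub_comm] at this
    linarith
  · exact key p w hp hw

theorem setLIntegral_enorm_le_eLpNorm {f : Space N → ℝ} (hf : AEStronglyMeasurable f volume)
    (s : Set (Space N)) : ∫⁻ x in s, ‖f x‖ₑ ≤
      eLpNorm f 2 volume * eLpNorm (fun _ => (1 : ℝ)) 2 (volume.restrict s) := by
  have h := lintegral_mul_le_eLpNorm (ν := volume.restrict s) hf.restrict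
    (aestronglyMeasurable_const (b := (1 : ℝ)))
  simp only [enorm_one, mul_one] at h
  exact h.trans (mul_le_mul_left (eLpNorm_mono_measure f Measure.restrict_le_self) _)

/-- The density is locally bounded. -/
theorem IsAdmissible.exists_upper_bound (h : IsAdmissible ρ G μ) (a : ℝ) :
    ∃ M, 0 < M ∧ ∀ᵐ x, ‖x‖ < a → ρ x ≤ M := by
  wlog ha : 0 < a generalizing a
  · obtain ⟨M, hM, hh⟩ := this (|a| + 1) (by positivity)
    exact ⟨M, hM, hh.mono fun x hx hxa => hx (by linarith [le_abs_self a])⟩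
  obtain ⟨c, u, g, P, hc, hcρ, hu, hg, huρ, hgG, hP, hcP, hPu, hPg⟩ :=
    h.exists_approx (a := a + 1) (by linarith)
  obtain ⟨r, q, hr, hr2, hq, hqr, hqe⟩ := h.exists_weight (a + 1)
  set s : Set (Space N) := Metric.ball 0 (a + 1)
  have hs : MeasurableSet s := Metric.isOpen_ball.measurableSet
  have hmem : ∀ x, x ∈ s ↔ ‖x‖ < a + 1 := fun x => by simp [s]
  have hone : eLpNorm (fun _ => (1 : ℝ)) 2 (volume.restrict s) ≠ ⊤ := by
    have : IsFiniteMeasure (volume.restrict s) := ⟨by simpa using measure_ball_lt_top⟩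
    exact (memLp_const (1 : ℝ)).2.ne
  have hlog : ∀ j, ∀ᵐ x ∂(volume.restrict s), ‖Real.log (P j x) - Real.log (u x)‖ₑ ≤
      ENNReal.ofReal c⁻¹ * ‖(P j - u) x‖ₑ := by
    intro j
    rw [ae_restrict_iff' hs]
    filter_upwards [hcρ] with x hx hxs
    have hxs' := (hmem x).1 hxs
    have hcu : c ≤ u x := by rw [huρ x hxs'.le]; exact hx hxs'.le
    rw [← ofReal_norm, ← ofReal_norm, ← ENNReal.ofReal_mul (by positivity)]
    exact ENNReal.ofReal_le_ofReal (abs_log_sub_log_le hc (hcP j x hxs') hcu)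
  have hdiff : ∀ j, ∫⁻ x in s, ‖Real.log (P j x) - Real.log (u x)‖ₑ ≤ ENNReal.ofReal c⁻¹ *
      (eLpNorm (P j - u) 2 volume * eLpNorm (fun _ => (1 : ℝ)) 2 (volume.restrict s)) := by
    intro j
    refine (lintegral_mono_ae (hlog j)).trans ?_
    rw [lintegral_const_mul' _ _ ENNReal.ofReal_ne_top]
    gcongr
    exact setLIntegral_enorm_le_eLpNorm ((hP j).continuous.aestronglyMeasurable.sub hu.1) s
  have hlog0 : ∫⁻ x in s, ‖Real.log (P 0 x)‖ₑ ≠ ⊤ := by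
    obtain ⟨C, hC0, hC⟩ := (hP 0).exists_bound
    refine ne_top_of_le_ne_top (b := ∫⁻ x in s, ENNReal.ofReal (|Real.log c| + |Real.log C|)) ?_ ?_
    · rw [setLIntegral_const]
      exact ENNReal.mul_ne_top ENNReal.ofReal_ne_top (volume_ball_ne_top _)
    · refine setLIntegral_mono' hs fun x hx => ?_
      have h1 := hcP 0 x ((hmem x).1 hx)
      have h2 := (le_abs_self _).trans (hC x)
      have h3 := Real.log_le_log hc h1
      have h4 := Real.log_le_log (hc.trans_le h1) h2
      rw [← ofReal_norm]
      refine ENNReal.ofReal_le_ofReal ?_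
      rw [Real.norm_eq_abs, abs_le]
      constructor <;> linarith [neg_abs_le (Real.log c), le_abs_self (Real.log C),
        abs_nonneg (Real.log c), abs_nonneg (Real.log C)]
  suffices hmain : ∃ C : ℝ≥0, ∀ᵐ x, x ∈ Metric.ball (0 : Space N) a → ‖Real.log (u x)‖ₑ ≤ C by
    obtain ⟨C, hC⟩ := hmain
    refine ⟨Real.exp C, Real.exp_pos _, ?_⟩
    filter_upwards [hC, hcρ] with x hx hcx hxa
    have h1 := hx (by simpa using hxa)
    rw [huρ x (by linarith), ← ofReal_norm, ENNReal.ofReal_le_coe] at h1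
    have h2 : 0 < ρ x := hc.trans_le (hcx (by linarith))
    calc ρ x = Real.exp (Real.log (ρ x)) := (Real.exp_log h2).symm
      _ ≤ _ := Real.exp_le_exp.2 ((le_abs_self _).trans h1)
  -- The Morrey bound is applied to `log ρ` rather than `ρ`: its gradient is `∇ρ/ρ`, for which local
  -- `L^r` integrability with `r > N` is available.
  refine ae_bounded_of_gradient (ϱ := a) hr (by linarith) (w := fun x => Real.log (u x))
    (W := fun j x => Real.log (P j x)) (W' := fun j x => (P j x)⁻¹ • fderiv ℝ (P j) x) (q := q)
    (Real.measurable_log.comp_aemeasurable hu.1.aemeasurable)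
    (fun j => Real.measurable_log.comp (hP j).continuous.measurable)
    (fun j => (hP j).continuous.measurable.inv.smul (measurable_fderiv ℝ (P j)))
    (fun j x hx => ((hP j).differentiable x).hasFDerivAt.log
      (hc.trans_le (hcP j x ((hmem x).1 hx))).ne')
    (fun j => ((hP j).continuous.continuousOn.inv₀ fun x hx =>
      (hc.trans_le (hcP j x ((hmem x).1 hx))).ne').smul
      ((hP j).smooth.continuous_fderiv (by simp)).continuousOn)
    hq hqr ?_ ?_ ?_
  · have hfin : ENNReal.ofReal c⁻¹ * (eLpNorm (P 0 - u) 2 volume *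
        eLpNorm (fun _ => (1 : ℝ)) 2 (volume.restrict s)) ≠ ⊤ :=
      ENNReal.mul_ne_top ENNReal.ofReal_ne_top
        (ENNReal.mul_ne_top (((hP 0).memLp 2 volume).sub hu).2.ne hone)
    refine ne_top_of_le_ne_top
      (ENNReal.add_ne_top.2 ⟨hlog0, ne_top_of_le_ne_top hfin (hdiff 0)⟩) ?_
    have hm0 : Measurable fun x => ‖Real.log (P 0 x)‖ₑ :=
      (Real.measurable_log.comp (hP 0).continuous.measurable).enorm
    rw [← lintegral_add_left hm0]
    refine lintegral_mono fun x => ?_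
    have := enorm_sub_le (a := Real.log (P 0 x)) (b := Real.log (P 0 x) - Real.log (u x))
    simpa using this
  · refine tendsto_of_tendsto_of_tendsto_of_le_of_le tendsto_const_nhds ?_ (fun _ => zero_le) hdiff
    have h1 := ENNReal.Tendsto.const_mul (ENNReal.Tendsto.mul_const hPu (Or.inr hone))
      (Or.inr (ENNReal.ofReal_ne_top (r := c⁻¹)))
    simpa using h1
  · have hb : ∀ j, ∫⁻ x in s, (‖(P j x)⁻¹ • fderiv ℝ (P j) x‖ₑ - q x) ≤
        ∑ i, (ENNReal.ofReal c⁻¹ * (eLpNorm (pd i (P j) - g i) 2 volume *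
            eLpNorm (fun _ => (1 : ℝ)) 2 (volume.restrict s)) +
          ENNReal.ofReal (c ^ 2)⁻¹ * (eLpNorm (g i) 2 volume * eLpNorm (P j - u) 2 volume)) := by
      intro j
      have h1 : ∀ᵐ x ∂(volume.restrict s), ‖(P j x)⁻¹ • fderiv ℝ (P j) x‖ₑ - q x ≤
          ∑ i, (ENNReal.ofReal c⁻¹ * ‖(pd i (P j) - g i) x‖ₑ +
            ENNReal.ofReal (c ^ 2)⁻¹ * (‖g i x‖ₑ * ‖(P j - u) x‖ₑ)) := by
        rw [ae_restrict_iff' hs]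
        filter_upwards [hcρ, hqe] with x hx hqx hxs
        have hxs' := (hmem x).1 hxs
        rw [hqx hxs'.le, tsub_le_iff_left]
        have h2 := norm_log_gradient_le hc (hcP j x hxs') (hx hxs'.le) (P j) x (G x)
        rw [← ofReal_norm (_ • fderiv ℝ (P j) x)]
        refine (ENNReal.ofReal_le_ofReal h2).trans ?_
        rw [ENNReal.ofReal_add (norm_nonneg _)
          (Finset.sum_nonneg fun i _ => by positivity), ofReal_norm,
          ENNReal.ofReal_sum_of_nonneg fun i _ => by positivity]
        gcongr with i
        rw [ENNReal.ofReal_add (by positivity) (by positivity), ENNReal.ofReal_mul (by positivity),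
          ENNReal.ofReal_mul (by positivity), ENNReal.ofReal_mul (by positivity)]
        simp only [← Real.norm_eq_abs, ofReal_norm, Pi.sub_apply, hgG i x hxs', huρ x hxs'.le,
          le_refl]
      have m1 : ∀ i, AEStronglyMeasurable (pd i (P j) - g i) volume := fun i =>
        ((hP j).pd i).continuous.aestronglyMeasurable.sub (hg i).1
      have m2 : AEStronglyMeasurable (P j - u) volume :=
        (hP j).continuous.aestronglyMeasurable.sub hu.1
      refine (lintegral_mono_ae h1).trans ?_
      have m3 : ∀ i, AEMeasurable (fun x => ENNReal.ofReal c⁻¹ * ‖(pd i (P j) - g i) x‖ₑ)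
          (volume.restrict s) := fun i => ((m1 i).enorm.const_mul _).restrict
      have m4 : ∀ i, AEMeasurable (fun x => ENNReal.ofReal (c ^ 2)⁻¹ *
          (‖g i x‖ₑ * ‖(P j - u) x‖ₑ)) (volume.restrict s) := fun i =>
        (((hg i).1.enorm.mul m2.enorm).const_mul _).restrict
      refine (lintegral_finsetSum' _ fun i _ => (m3 i).add (m4 i)).trans_le ?_
      gcongr with i
      refine (lintegral_add_left' (m3 i) _).trans_le ?_
      rw [lintegral_const_mul' _ _ ENNReal.ofReal_ne_top,
        lintegral_const_mul' _ _ ENNReal.ofReal_ne_top]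
      gcongr
      · exact setLIntegral_enorm_le_eLpNorm (m1 i) s
      · exact (setLIntegral_le_lintegral _ _).trans (lintegral_mul_le_eLpNorm (hg i).1 m2)
    refine tendsto_of_tendsto_of_tendsto_of_le_of_le tendsto_const_nhds ?_ (fun _ => zero_le) hb
    have h0 : (0 : ℝ≥0∞) = ∑ i : Fin N, (ENNReal.ofReal c⁻¹ * (0 *
        eLpNorm (fun _ => (1 : ℝ)) 2 (volume.restrict s)) +
          ENNReal.ofReal (c ^ 2)⁻¹ * (eLpNorm (g i) 2 volume * 0)) := by simp
    rw [h0]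
    refine tendsto_finsetSum _ fun i _ => Tendsto.add ?_ ?_
    · exact ENNReal.Tendsto.const_mul (ENNReal.Tendsto.mul_const (hPg i) (Or.inr hone))
        (Or.inr ENNReal.ofReal_ne_top)
    · exact ENNReal.Tendsto.const_mul (ENNReal.Tendsto.const_mul hPu (Or.inr (hg i).2.ne))
        (Or.inr ENNReal.ofReal_ne_top)

end Density

/-! ### Cutoffs exhausting the space. -/

section Cutoffs

variable {N : ℕ}

/-- Smooth cutoff functions exhausting the space with gradients of size `O(1 / n)`. -/
theorem exists_cutoff_seq (N : ℕ) : ∃ (χ : ℕ → Space N → ℝ) (C : ℝ), 0 ≤ C ∧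
    (∀ n, IsTest (χ n)) ∧ (∀ n x, |χ n x| ≤ 1) ∧ (∀ n i x, |pd i (χ n) x| ≤ C / (n + 1)) ∧
    ∀ x, Tendsto (fun n => χ n x) atTop (𝓝 1) := by
  let ζ : ContDiffBump (0 : Space N) := ⟨1, 2, one_pos, one_lt_two⟩
  have hζ : IsTest (ζ : Space N → ℝ) := ⟨ζ.contDiff, ζ.hasCompactSupport⟩
  have hb : ∀ i : Fin N, ∃ C, 0 ≤ C ∧ ∀ x, |pd i ζ x| ≤ C := fun i => (hζ.pd i).exists_bound
  choose C hC0 hC using hb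
  have hpos : ∀ n : ℕ, (0 : ℝ) < ((n : ℝ) + 1)⁻¹ := fun n => by positivity
  -- One fixed bump is dilated by `n + 1`. The sum of the bounds for the partial derivatives serves
  -- all directions at once.
  refine ⟨fun n x => ζ (((n : ℝ) + 1)⁻¹ • x), ∑ i, C i, Finset.sum_nonneg fun i _ => hC0 i,
    fun n => ⟨hζ.smooth.comp (contDiff_const_smul _), hζ.compact.comp_smul (hpos n).ne'⟩,
    fun n x => ?_, fun n i x => ?_, fun x => ?_⟩
  · rw [abs_of_nonneg ζ.nonneg]
    exact ζ.le_one
  · have h1 := (hζ.differentiable (((n : ℝ) + 1)⁻¹ • x)).hasFDerivAt.comp x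
      ((hasFDerivAt_id x).const_smul (((n : ℝ) + 1)⁻¹))
    have h2 : pd i (fun x => ζ (((n : ℝ) + 1)⁻¹ • x)) x =
        ((n : ℝ) + 1)⁻¹ * pd i ζ (((n : ℝ) + 1)⁻¹ • x) := by
      unfold pd
      have h3 := h1.fderiv
      simp only [Function.comp_def] at h3
      have h4 := congrArg (fun L => L (EuclideanSpace.single i 1)) h3
      simpa using h4
    rw [h2, abs_mul, abs_of_pos (hpos n), div_eq_inv_mul]
    gcongr
    exact (hC i _).trans (Finset.single_le_sum (f := C) (fun i _ => hC0 i) (Finset.mem_univ i))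
  · refine tendsto_const_nhds.congr' ?_
    filter_upwards [eventually_ge_atTop ⌈‖x‖⌉₊] with n hn
    have hn' : ‖x‖ ≤ (n : ℝ) + 1 := (Nat.ceil_le.1 hn).trans (by linarith)
    refine (ζ.one_of_mem_closedBall ?_).symm
    rw [mem_closedBall_zero_iff, norm_smul, Real.norm_of_nonneg (hpos n).le]
    exact (inv_mul_le_one₀ (by positivity)).2 hn'

theorem tendsto_integral_cutoff {χ : ℕ → Space N → ℝ} (hχ : ∀ n, IsTest (χ n))
    (h1 : ∀ n x, |χ n x| ≤ 1) (hl : ∀ x, Tendsto (fun n => χ n x) atTop (𝓝 1))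
    {ν : Measure (Space N)} {F : Space N → ℝ} (hF : Integrable F ν) :
    Tendsto (fun n => ∫ x, χ n x ^ 2 * F x ∂ν) atTop (𝓝 (∫ x, F x ∂ν)) := by
  refine tendsto_integral_of_dominated_convergence (fun x => |F x|)
    (fun n => (((hχ n).continuous.pow 2).aestronglyMeasurable).mul hF.1) hF.abs
    (fun n => Eventually.of_forall fun x => ?_) (Eventually.of_forall fun x => ?_)
  · rw [norm_mul, norm_pow]
    exact mul_le_of_le_one_left (abs_nonneg _) (pow_le_one₀ (abs_nonneg _) (h1 n x))
  · simpa using ((hl x).pow 2).mul_const (F x)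

end Cutoffs

/-! ### Integration by parts identities for the Laplacian. -/

section Energy

variable {N : ℕ} {φ : Space N → ℝ}

theorem IsTest.laplacian (h : IsTest φ) : IsTest (Laplacian.laplacian φ) := by
  have : Laplacian.laplacian φ = fun x => ∑ i, BiKolmogorov.pd i (BiKolmogorov.pd i φ) x :=
    funext (laplacian_eq_sum_pd h.smooth)
  rw [this]
  exact IsTest.sum _ fun i => (h.pd i).pd i

theorem IsTest.integral_mul_laplacian (h : IsTest φ) {ψ : Space N → ℝ} (hψ : ContDiff ℝ ∞ ψ) :
    ∫ x, φ x * Laplacian.laplacian ψ x =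
      -∑ i, ∫ x, BiKolmogorov.pd i φ x * BiKolmogorov.pd i ψ x := by
  have e : ∀ x, φ x * Laplacian.laplacian ψ x =
      ∑ i, BiKolmogorov.pd i (BiKolmogorov.pd i ψ) x * φ x := fun x => by
    rw [laplacian_eq_sum_pd hψ, Finset.mul_sum]
    exact Finset.sum_congr rfl fun i _ => mul_comm _ _
  simp only [e]
  rw [integral_finsetSum _ fun i _ =>
    (h.mul_left (contDiff_pd (contDiff_pd hψ i) i)).integrable volume, ← Finset.sum_neg_distrib]
  refine Finset.sum_congr rfl fun i _ => ?_
  have := h.integral_mul_pd (contDiff_pd hψ i) i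
  rw [eq_neg_iff_add_eq_zero] at this ⊢
  rw [← this, add_comm]
  congr 2
  funext x
  ring

/-- Two integrations by parts and equality of mixed derivatives; summed over `i` and `j` this is
`‖Δφ‖ = ‖D²φ‖` in `L²`. -/
theorem IsTest.integral_pd_pd_mul (h : IsTest φ) (i j : Fin N) :
    ∫ x, BiKolmogorov.pd i (BiKolmogorov.pd i φ) x * BiKolmogorov.pd j (BiKolmogorov.pd j φ) x =
      ∫ x, BiKolmogorov.pd j (BiKolmogorov.pd i φ) x ^ 2 := by
  have h2 := (h.pd i).integral_pd_mul_pd (h.pd i) j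
  have e1 : ∀ x, BiKolmogorov.pd i (BiKolmogorov.pd j (BiKolmogorov.pd j φ)) x =
      BiKolmogorov.pd j (BiKolmogorov.pd j (BiKolmogorov.pd i φ)) x := fun x => by
    rw [pd_comm (contDiff_pd h.smooth j)]
    congr 1
    funext y
    exact pd_comm h.smooth i j y
  have h3 := (h.pd i).integral_mul_pd ((h.pd j).pd j).smooth i
  simp only [e1] at h3
  calc _ = ∫ x, BiKolmogorov.pd j (BiKolmogorov.pd j φ) x *
        BiKolmogorov.pd i (BiKolmogorov.pd i φ) x := by simp only [mul_comm]
    _ = _ := by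
      rw [h3, ← h2]
      simp only [sq]

/-- `‖lφ - Δφ‖² = l²‖φ‖² + 2l‖∇φ‖² + ‖D²φ‖²` in `L²`. -/
theorem IsTest.integral_sq_sub_laplacian (h : IsTest φ) (l : ℝ) :
    ∫ x, (l * φ x - Laplacian.laplacian φ x) ^ 2 = l ^ 2 * (∫ x, φ x ^ 2) +
      2 * l * (∑ i, ∫ x, BiKolmogorov.pd i φ x ^ 2) +
        ∑ i, ∑ j, ∫ x, BiKolmogorov.pd j (BiKolmogorov.pd i φ) x ^ 2 := by
  have h1 := h.integral_mul_laplacian h.smooth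
  have h2 : ∫ x, Laplacian.laplacian φ x ^ 2 =
      ∑ i, ∑ j, ∫ x, BiKolmogorov.pd j (BiKolmogorov.pd i φ) x ^ 2 := by
    simp only [laplacian_eq_sum_pd h.smooth, sq (∑ _, _), Finset.sum_mul_sum]
    rw [integral_finsetSum _ fun i _ => integrable_finsetSum _ fun j _ =>
      (((h.pd i).pd i).mul_right ((h.pd j).pd j).smooth).integrable volume]
    refine Finset.sum_congr rfl fun i _ => ?_
    rw [integral_finsetSum _ fun j _ =>
      (((h.pd i).pd i).mul_right ((h.pd j).pd j).smooth).integrable volume]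
    exact Finset.sum_congr rfl fun j _ => h.integral_pd_pd_mul i j
  have i1 : Integrable fun x => l ^ 2 * φ x ^ 2 := by
    simpa only [sq] using ((h.mul_left h.smooth).const_mul (l * l)).integrable volume
  have i2 : Integrable fun x => 2 * l * (φ x * Laplacian.laplacian φ x) :=
    ((h.mul_right h.laplacian.smooth).const_mul (2 * l)).integrable volume
  have i3 : Integrable fun x => Laplacian.laplacian φ x ^ 2 := by
    simpa only [sq] using (h.laplacian.mul_left h.laplacian.smooth).integrable volume
  have e : ∀ x, (l * φ x - Laplacian.laplacian φ x) ^ 2 = l ^ 2 * φ x ^ 2 -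
      2 * l * (φ x * Laplacian.laplacian φ x) + Laplacian.laplacian φ x ^ 2 := fun x => by ring
  simp only [e]
  have i12 : Integrable fun x => l ^ 2 * φ x ^ 2 - 2 * l * (φ x * Laplacian.laplacian φ x) :=
    i1.sub i2
  rw [integral_add i12 i3, integral_sub i1 i2, integral_const_mul, integral_const_mul, h1,
    h2]
  simp only [sq]
  ring

end Energy

/-! ### Density of the range of `l - Δ` on test functions. -/

section ResolventRange

variable {N : ℕ}

/-- An `L²` solution of `l w = Δ w`, `l > 0`, vanishes. -/
theorem integral_sq_eq_zero_of_laplacian {w : Space N → ℝ} (hw : ContDiff ℝ ∞ w)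
    (hw2 : MemLp w 2 volume) {l : ℝ} (hl : 0 < l) (h : ∀ x, l * w x = Laplacian.laplacian w x) :
    ∫ x, w x ^ 2 = 0 := by
  obtain ⟨χ, C, hC, hχ, hχ1, hχd, hχl⟩ := exists_cutoff_seq N
  have hwi := integrable_sq_of_memLp hw2
  have hb : ∀ n : ℕ, l * ∫ x, χ n x ^ 2 * w x ^ 2 ≤
      N * ((C / (n + 1)) ^ 2 * ∫ x, w x ^ 2) := by
    intro n
    have ht : IsTest fun x => χ n x ^ 2 * w x := by
      have := ((hχ n).mul_left (hχ n).smooth).mul_right hw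
      simpa only [sq] using this
    have h1 := ht.integral_mul_laplacian hw
    have e1 : l * ∫ x, χ n x ^ 2 * w x ^ 2 = ∫ x, (χ n x ^ 2 * w x) * Laplacian.laplacian w x := by
      rw [← integral_const_mul]
      congr 1
      funext x
      rw [← h x]; ring
    rw [e1, h1, ← Finset.sum_neg_distrib]
    have hN : (N : ℝ) * ((C / (n + 1)) ^ 2 * ∫ x, w x ^ 2) =
        ∑ _i : Fin N, ((C / (n + 1)) ^ 2 * ∫ x, w x ^ 2) := by simp
    rw [hN]
    refine Finset.sum_le_sum fun i _ => ?_
    rw [← integral_neg, ← integral_const_mul]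
    refine integral_mono (((ht.pd i).mul_right (contDiff_pd hw i)).integrable volume).neg
      (hwi.const_mul _) fun x => ?_
    have e2 : pd i (fun x => χ n x ^ 2 * w x) x =
        χ n x ^ 2 * pd i w x + 2 * χ n x * pd i (χ n) x * w x := by
      simp only [sq]
      rw [pd_mul i ((((hχ n).mul_left (hχ n).smooth)).differentiable x)
        (hw.differentiable (by simp) x),
        pd_mul i ((hχ n).differentiable x) ((hχ n).differentiable x)]
      ring
    simp only [e2]
    have h3 : pd i (χ n) x ^ 2 ≤ (C / (n + 1)) ^ 2 := sq_le_sq' (abs_le.1 (hχd n i x)).1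
      (abs_le.1 (hχd n i x)).2
    -- Completing the square: `-(χ² |∂w|² + 2χ ∂χ w ∂w) = -(χ ∂w + w ∂χ)² + w² (∂χ)²`.
    nlinarith [sq_nonneg (χ n x * pd i w x + pd i (χ n) x * w x),
      mul_le_mul_of_nonneg_right h3 (sq_nonneg (w x))]
  have hl1 := (tendsto_integral_cutoff hχ hχ1 hχl hwi).const_mul l
  have hl2 : Tendsto (fun n : ℕ => N * ((C / (n + 1)) ^ 2 * ∫ x, w x ^ 2)) atTop (𝓝 0) := by
    have h0 : Tendsto (fun n : ℕ => C / ((n : ℝ) + 1)) atTop (𝓝 0) := by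
      have := (tendsto_one_div_add_atTop_nhds_zero_nat (𝕜 := ℝ)).const_mul C
      simpa [div_eq_mul_inv] using this
    have := ((h0.pow 2).mul_const (∫ x, w x ^ 2)).const_mul (N : ℝ)
    simpa using this
  have h0 := le_of_tendsto_of_tendsto' hl1 hl2 hb
  have := integral_sq_nonneg (ν := volume) w
  nlinarith

theorem laplacian_sub_left {k : Space N → ℝ} (hk : IsTest k) (x y : Space N) :
    Laplacian.laplacian (fun z => k (x - z)) y = Laplacian.laplacian k (x - y) := by
  have hs : ContDiff ℝ ∞ fun z => k (x - z) := hk.smooth.comp (contDiff_const.sub contDiff_id)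
  rw [laplacian_eq_sum_pd hs, laplacian_eq_sum_pd hk.smooth]
  refine Finset.sum_congr rfl fun i _ => ?_
  have e : pd i (fun z => k (x - z)) = fun y => (-1 : ℝ) * pd i k (x - y) := by
    funext y; rw [hk.pd_sub_left]; ring
  rw [e]
  have hd : DifferentiableAt ℝ (fun y => pd i k (x - y)) y :=
    ((hk.pd i).smooth.comp (contDiff_const.sub contDiff_id)).differentiable (by simp) y
  rw [pd_mul i (differentiableAt_const _) hd, (hk.pd i).pd_sub_left]
  have : pd i (fun _ : Space N => (-1 : ℝ)) y = 0 := by simp [pd]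
  rw [this]; ring

theorem laplacian_mollify (n : ℕ) {u : Space N → ℝ} (hu : LocallyIntegrable u) (x : Space N) :
    Laplacian.laplacian (mollify n u) x =
      ∫ y, Laplacian.laplacian (molKer N n) (x - y) * u y := by
  rw [laplacian_eq_sum_pd (contDiff_mollify n hu)]
  have e : ∀ i, pd i (pd i (mollify n u)) x =
      ∫ y, pd i (pd i (molKer N n)) (x - y) * u y := fun i => by
    have : pd i (mollify n u) = fun x => ∫ y, pd i (molKer N n) (x - y) * u y :=
      funext fun x => pd_mollify n hu i x
    rw [this, ((isTest_molKer n).pd i).pd_convolution hu]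
  simp only [e]
  rw [← integral_finsetSum]
  · congr 1
    funext y
    rw [laplacian_eq_sum_pd (isTest_molKer n).smooth, Finset.sum_mul]
  · intro i _
    exact ((((isTest_molKer n).pd i).pd i).comp_sub_left x).integrable_mul hu

/-- Testing with translates of the reflected kernel shows that each mollification of `z` is a smooth
`L²` solution of `l w = Δw`, hence zero; the mollifications converge to `z`. -/
theorem eLpNorm_eq_zero_of_orthogonal {z : Space N → ℝ} (hz : MemLp z 2 volume) {l : ℝ}
    (hl : 0 < l)
    (h : ∀ φ, IsTest φ → ∫ x, (l * φ x - Laplacian.laplacian φ x) * z x = 0) :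
    eLpNorm z 2 volume = 0 := by
  have hzl : LocallyIntegrable z := hz.locallyIntegrable (by norm_num)
  have h0 : ∀ n, eLpNorm (mollify n z) 2 volume = 0 := by
    intro n
    have hm := memLp_mollify n hz
    have h1 : ∫ x, mollify n z x ^ 2 = 0 := by
      refine integral_sq_eq_zero_of_laplacian (contDiff_mollify n hzl) hm hl fun x => ?_
      have h2 := h _ ((isTest_molKer n).comp_sub_left x)
      simp only [laplacian_sub_left (isTest_molKer n), sub_mul, mul_assoc] at h2
      rw [integral_sub ((((isTest_molKer n).comp_sub_left x).integrable_mul hzl).const_mul l)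
        (((isTest_molKer n).laplacian.comp_sub_left x).integrable_mul hzl), integral_const_mul, sub_eq_zero] at h2
      rw [laplacian_mollify n hzl, mollify_swap, h2]
    have h3 := norm_toLp_eq_sqrt hm
    rw [h1, Real.sqrt_zero, Lp.norm_toLp, ENNReal.toReal_eq_zero_iff] at h3
    exact h3.resolve_right hm.2.ne
  have h1 := tendsto_eLpNorm_mollify hz
  have h2 : ∀ n, eLpNorm (mollify n z - z) 2 volume = eLpNorm z 2 volume := by
    intro n
    have h3 := (eLpNorm_eq_zero_iff (memLp_mollify n hz).1 (by simp)).1 (h0 n)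
    rw [← eLpNorm_neg]
    refine eLpNorm_congr_ae (h3.mono fun x hx => ?_)
    simp [hx]
  simp only [h2] at h1
  exact tendsto_nhds_unique tendsto_const_nhds h1

end ResolventRange

/-! ### Stability of dense range under small perturbations. -/

section DensePerturbation

/-- A relatively small perturbation of a linear map with dense range has dense range. -/
theorem dense_range_sub {V H : Type*} [AddCommGroup V] [Module ℝ V] [NormedAddCommGroup H]
    [InnerProductSpace ℝ H] [CompleteSpace H] {S D : V →ₗ[ℝ] H}
    (hS : ∀ z : H, (∀ v, inner ℝ (S v) z = 0) → z = 0) (hD : ∀ v, ‖D v‖ ≤ 1 / 2 * ‖S v‖) :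
    Dense (Set.range (S - D)) := by
  have key : ∀ {T : V →ₗ[ℝ] H}, (∀ z : H, (∀ v, inner ℝ (T v) z = 0) → z = 0) →
      Dense (Set.range T) := by
    intro T hT
    rw [← LinearMap.coe_range, Submodule.dense_iff_topologicalClosure_eq_top,
      Submodule.topologicalClosure_eq_top_iff, Submodule.eq_bot_iff]
    intro z hz
    refine hT z fun v => ?_
    exact (Submodule.mem_orthogonal _ _).1 hz _ ⟨v, rfl⟩
  refine key fun z hz => ?_
  have hd := key hS
  have hc : IsClosed {y : H | inner ℝ y z ≤ 1 / 2 * ‖y‖ * ‖z‖} :=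
    isClosed_le (by fun_prop) (by fun_prop)
  -- For `z` orthogonal to the range of `S - D` this holds at `y = S v`, where `⟪S v, z⟫ = ⟪D v,
  -- z⟫`, and extends by density of the range of `S`. Taking `y = z` gives `‖z‖² ≤ ‖z‖² / 2`.
  have hall : ∀ y : H, inner ℝ y z ≤ 1 / 2 * ‖y‖ * ‖z‖ := by
    intro y
    refine hc.closure_subset_iff.2 ?_ (hd y)
    rintro _ ⟨v, rfl⟩
    have h1 := hz v
    rw [LinearMap.sub_apply, inner_sub_left, sub_eq_zero] at h1
    show inner ℝ (S v) z ≤ _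
    rw [h1]
    exact (real_inner_le_norm _ _).trans (mul_le_mul_of_nonneg_right (hD v) (norm_nonneg _))
  have h2 := hall z
  rw [real_inner_self_eq_norm_sq] at h2
  have : ‖z‖ = 0 := by nlinarith [norm_nonneg z]
  exact norm_eq_zero.1 this

end DensePerturbation

/-! ### The drift localized to a ball. -/

section LocalDrift

variable {N : ℕ}

theorem ofReal_integral_sq {α : Type*} [MeasurableSpace α] {ν : Measure α} {f : α → ℝ}
    (hf : MemLp f 2 ν) : ENNReal.ofReal (∫ x, f x ^ 2 ∂ν) = ∫⁻ x, ‖f x‖ₑ ^ 2 ∂ν := by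
  rw [ofReal_integral_eq_lintegral_ofReal (integrable_sq_of_memLp hf)
    (Eventually.of_forall fun x => sq_nonneg _)]
  refine lintegral_congr fun x => ?_
  rw [← ofReal_norm, ← ENNReal.ofReal_pow (norm_nonneg _), Real.norm_eq_abs, sq_abs]

/-- The Dirichlet integral of a test function. -/
noncomputable def gradSq (φ : Space N → ℝ) : ℝ := ∑ i, ∫ x, pd i φ x ^ 2

theorem gradSq_nonneg (φ : Space N → ℝ) : 0 ≤ gradSq φ :=
  Finset.sum_nonneg fun _ _ => integral_sq_nonneg _

theorem norm_fderiv_sq_le (φ : Space N → ℝ) (x : Space N) :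
    ‖fderiv ℝ φ x‖ ^ 2 ≤ ∑ i, pd i φ x ^ 2 := by
  have h0 : 0 ≤ ∑ i, pd i φ x ^ 2 := Finset.sum_nonneg fun _ _ => sq_nonneg _
  rw [← Real.sq_sqrt h0]
  refine pow_le_pow_left₀ (norm_nonneg _) ?_ 2
  refine ContinuousLinearMap.opNorm_le_bound _ (Real.sqrt_nonneg _) fun v => ?_
  rw [fderiv_eq_sum_pd, Real.norm_eq_abs, ← Real.sqrt_sq (norm_nonneg v), ← Real.sqrt_mul h0,
    EuclideanSpace.real_norm_sq_eq]
  refine Real.abs_le_sqrt ?_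
  rw [mul_comm]
  exact Finset.sum_mul_sq_le_sq_mul_sq _ _ _

variable (ρ : Space N → ℝ) (G : Space N → Space N)

/-- The size of the logarithmic gradient, localized to a ball. -/
noncomputable def locWeight (a : ℝ) : Space N → ℝ :=
  (Metric.ball 0 a).indicator fun x => ‖(ρ x)⁻¹ • G x‖

/-- The drift term, localized to a ball. -/
noncomputable def locDrift (a : ℝ) (φ : Space N → ℝ) : Space N → ℝ :=
  (Metric.ball 0 a).indicator fun x => fderiv ℝ φ x ((ρ x)⁻¹ • G x)

variable {ρ G} {μ : Measure (Space N)}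

theorem IsAdmissible.aestronglyMeasurable_logGradient (h : IsAdmissible ρ G μ) :
    AEStronglyMeasurable (fun x => (ρ x)⁻¹ • G x) volume :=
  h.integrable.aestronglyMeasurable.aemeasurable.inv.aestronglyMeasurable.smul
    h.gradient_memLpLoc.locallyIntegrable.aestronglyMeasurable

theorem IsAdmissible.aestronglyMeasurable_locWeight (h : IsAdmissible ρ G μ) (a : ℝ) :
    AEStronglyMeasurable (locWeight ρ G a) volume :=
  h.aestronglyMeasurable_logGradient.norm.indicator measurableSet_ball

/-- This is `exists_weight_bound` for an `L^r` majorant of the localized logarithmic gradient,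
converted to real integrals. -/
theorem IsAdmissible.locWeight_bound (h : IsAdmissible ρ G μ) (a : ℝ) {ε : ℝ} (hε : 0 < ε) :
    ∃ C, 0 ≤ C ∧ ∀ φ, IsTest φ → MemLp (fun x => locWeight ρ G a x * φ x) 2 volume ∧
      ∫ x, (locWeight ρ G a x * φ x) ^ 2 ≤ ε * gradSq φ + C * ∫ x, φ x ^ 2 := by
  obtain ⟨r, b, hr, hr2, hb, hbr, hbe⟩ := h.exists_weight a
  obtain ⟨C, hC⟩ := exists_weight_bound hb hr hr2 hbr hε
  refine ⟨C, C.coe_nonneg, fun φ hφ => ?_⟩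
  have hm : AEStronglyMeasurable (fun x => locWeight ρ G a x * φ x) volume :=
    (h.aestronglyMeasurable_locWeight a).mul hφ.continuous.aestronglyMeasurable
  have hg : ∀ i, Integrable fun x => BiKolmogorov.pd i φ x ^ 2 := fun i =>
    integrable_sq_of_memLp ((hφ.pd i).memLp 2 volume)
  have hgs : ∫ x, (∑ i, BiKolmogorov.pd i φ x ^ 2) = gradSq φ :=
    integral_finsetSum _ fun i _ => hg i
  have h1 : ∫⁻ x, ‖locWeight ρ G a x * φ x‖ₑ ^ 2 ≤
      ENNReal.ofReal (ε * gradSq φ + C * ∫ x, φ x ^ 2) := by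
    calc ∫⁻ x, ‖locWeight ρ G a x * φ x‖ₑ ^ 2 ≤ ∫⁻ x, b x ^ 2 * ‖φ x‖ₑ ^ 2 := by
          refine lintegral_mono_ae (hbe.mono fun x hx => ?_)
          rw [enorm_mul, mul_pow]
          gcongr
          by_cases hxa : x ∈ Metric.ball (0 : Space N) a
          · rw [locWeight, Set.indicator_of_mem hxa, enorm_norm,
              hx (mem_ball_zero_iff.1 hxa).le]
          · simp [locWeight, Set.indicator_of_notMem hxa]
      _ ≤ _ := hC φ (hφ.smooth.of_le (by simp))
      _ ≤ _ := by
        rw [ENNReal.ofReal_add (mul_nonneg hε.le (gradSq_nonneg φ))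
          (mul_nonneg C.coe_nonneg (integral_sq_nonneg φ)), ENNReal.ofReal_mul hε.le,
          ENNReal.ofReal_mul C.coe_nonneg, ofReal_integral_sq (hφ.memLp 2 volume), ← hgs,
          ofReal_integral_eq_lintegral_ofReal (integrable_finsetSum _ fun i _ => hg i)
            (Eventually.of_forall fun x => Finset.sum_nonneg fun _ _ => sq_nonneg _)]
        gcongr with x
        · rw [← ofReal_norm, ← ENNReal.ofReal_pow (norm_nonneg _)]
          exact ENNReal.ofReal_le_ofReal (norm_fderiv_sq_le φ x)
        · simp
  have hL : MemLp (fun x => locWeight ρ G a x * φ x) 2 volume := by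
    refine ⟨hm, ?_⟩
    have h2 : eLpNorm (fun x => locWeight ρ G a x * φ x) 2 volume ^ 2 < ⊤ := by
      rw [eLpNorm_two_sq]
      exact h1.trans_lt ENNReal.ofReal_lt_top
    exact (ENNReal.pow_lt_top_iff.1 h2).resolve_right two_ne_zero
  refine ⟨hL, ?_⟩
  rw [← ofReal_integral_sq hL] at h1
  exact (ENNReal.ofReal_le_ofReal_iff (add_nonneg (mul_nonneg hε.le (gradSq_nonneg φ))
    (mul_nonneg C.coe_nonneg (integral_sq_nonneg _)))).1 h1

theorem locDrift_sq_le (a : ℝ) (φ : Space N → ℝ) (x : Space N) :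
    locDrift ρ G a φ x ^ 2 ≤ ∑ i, (locWeight ρ G a x * pd i φ x) ^ 2 := by
  by_cases hx : x ∈ Metric.ball (0 : Space N) a
  · rw [locDrift, locWeight, Set.indicator_of_mem hx, Set.indicator_of_mem hx, fderiv_eq_sum_pd]
    simp only [mul_pow]
    rw [← Finset.mul_sum, EuclideanSpace.real_norm_sq_eq]
    exact Finset.sum_mul_sq_le_sq_mul_sq _ _ _
  · simp [locDrift, locWeight, Set.indicator_of_notMem hx]

theorem IsAdmissible.aestronglyMeasurable_locDrift (h : IsAdmissible ρ G μ) (a : ℝ)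
    {φ : Space N → ℝ} (hφ : ContDiff ℝ ∞ φ) : AEStronglyMeasurable (locDrift ρ G a φ) volume := by
  refine AEStronglyMeasurable.indicator ?_ measurableSet_ball
  have hc := (hφ.continuous_fderiv (by simp)).aestronglyMeasurable (μ := volume)
  exact (isBoundedBilinearMap_apply (𝕜 := ℝ) (E := Space N) (F := ℝ)).continuous
    |>.comp_aestronglyMeasurable (hc.prodMk h.aestronglyMeasurable_logGradient)

/-- For large `l` the localized drift is a small perturbation of `l - Δ`. -/
theorem IsAdmissible.exists_large (h : IsAdmissible ρ G μ) (a : ℝ) :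
    ∃ l : ℝ, 1 ≤ l ∧ ∀ φ, IsTest φ → MemLp (locDrift ρ G a φ) 2 volume ∧
      ∫ x, locDrift ρ G a φ x ^ 2 ≤ 1 / 4 * ∫ x, (l * φ x - Laplacian.laplacian φ x) ^ 2 ∧
      MemLp (fun x => locWeight ρ G a x * φ x) 2 volume ∧
      ∫ x, (locWeight ρ G a x * φ x) ^ 2 ≤ 1 / 4 * (gradSq φ + l * ∫ x, φ x ^ 2) := by
  obtain ⟨C, hC0, hC⟩ := h.locWeight_bound a (ε := 1 / 4) (by norm_num)
  -- The weight bound with `ε = 1/4` is used twice. For `∂ᵢφ` it gives `‖D²φ‖²/4 + C ‖∇φ‖²`,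
  -- absorbed in `‖lφ - Δφ‖²/4` once `l ≥ 2C`; for `φ` it gives a zero-order term `C ‖φ‖² ≤ l
  -- ‖φ‖²/4`, which needs `l ≥ 4C`. The `+ 1` ensures `l ≥ 1`.
  refine ⟨4 * C + 1, by linarith, fun φ hφ => ?_⟩
  have hi : ∀ i, Integrable fun x => (locWeight ρ G a x * pd i φ x) ^ 2 := fun i =>
    integrable_sq_of_memLp (hC _ (hφ.pd i)).1
  have his : Integrable fun x => ∑ i, (locWeight ρ G a x * pd i φ x) ^ 2 :=
    integrable_finsetSum _ fun i _ => hi i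
  have hm := h.aestronglyMeasurable_locDrift a hφ.smooth
  have hL : MemLp (locDrift ρ G a φ) 2 volume := by
    rw [memLp_two_iff_integrable_sq hm]
    refine his.mono' (hm.pow 2) (Eventually.of_forall fun x => ?_)
    rw [Real.norm_of_nonneg (sq_nonneg _)]
    exact locDrift_sq_le a φ x
  have hφ0 := integral_sq_nonneg (ν := volume) φ
  refine ⟨hL, ?_, (hC φ hφ).1, (hC φ hφ).2.trans (by nlinarith [gradSq_nonneg φ])⟩
  calc ∫ x, locDrift ρ G a φ x ^ 2 ≤ ∫ x, ∑ i, (locWeight ρ G a x * pd i φ x) ^ 2 :=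
        integral_mono (integrable_sq_of_memLp hL) his fun x => locDrift_sq_le a φ x
    _ = ∑ i, ∫ x, (locWeight ρ G a x * pd i φ x) ^ 2 := integral_finsetSum _ fun i _ => hi i
    _ ≤ ∑ i, (1 / 4 * gradSq (pd i φ) + C * ∫ x, pd i φ x ^ 2) :=
        Finset.sum_le_sum fun i _ => (hC _ (hφ.pd i)).2
    _ = 1 / 4 * (∑ i, gradSq (pd i φ)) + C * gradSq φ := by
        rw [Finset.sum_add_distrib, ← Finset.mul_sum, ← Finset.mul_sum, gradSq]
    _ ≤ _ := by
        rw [hφ.integral_sq_sub_laplacian]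
        change _ ≤ 1 / 4 * (_ + 2 * (4 * C + 1) * gradSq φ + ∑ i, gradSq (pd i φ))
        have h1 := gradSq_nonneg φ
        have h2 : 0 ≤ C * gradSq φ := mul_nonneg hC0 h1
        have h3 : 0 ≤ (4 * C + 1) ^ 2 * ∫ x, φ x ^ 2 := by positivity
        linarith

end LocalDrift

/-! ### Approximate solvability of the localized resolvent equation. -/

section DenseRange

variable {N : ℕ}

/-- The space of real test functions. -/
def testSpace (N : ℕ) : Submodule ℝ (Space N → ℝ) where
  carrier := {φ | IsTest φ}
  add_mem' := fun h h' => h.add h'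
  zero_mem' := ⟨contDiff_const, HasCompactSupport.zero⟩
  smul_mem' := fun c _ h => h.const_mul c

/-- The map into `L²` induced by a linear operator on test functions. -/
noncomputable def testToLp (D : testSpace N →ₗ[ℝ] (Space N → ℝ))
    (h : ∀ φ, MemLp (D φ) 2 volume) : testSpace N →ₗ[ℝ] Lp ℝ 2 (volume : Measure (Space N)) where
  toFun φ := (h φ).toLp (D φ)
  map_add' φ ψ := by
    rw [← MemLp.toLp_add (h φ) (h ψ)]
    exact MemLp.toLp_congr _ _ (by rw [map_add])
  map_smul' c φ := by
    rw [RingHom.id_apply, ← MemLp.toLp_const_smul c (h φ)]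
    exact MemLp.toLp_congr _ _ (by rw [map_smul])

/-- With `driftMap`, it supplies the linear maps `S` and `D` of `dense_range_sub`. -/
noncomputable def resolventMap (N : ℕ) (l : ℝ) : testSpace N →ₗ[ℝ] (Space N → ℝ) where
  toFun φ x := l * (φ : Space N → ℝ) x - Laplacian.laplacian (φ : Space N → ℝ) x
  map_add' := by
    rintro ⟨φ, hφ⟩ ⟨ψ, hψ⟩
    funext x
    have a := (hφ.smooth.of_le (m := 2) (by norm_cast)).contDiffAt (x := x)
    have a' := (hψ.smooth.of_le (m := 2) (by norm_cast)).contDiffAt (x := x)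
    simp only [Submodule.coe_add, Pi.add_apply, a.laplacian_add a']
    ring
  map_smul' := by
    rintro c ⟨φ, hφ⟩
    funext x
    have a := (hφ.smooth.of_le (m := 2) (by norm_cast)).contDiffAt (x := x)
    simp only [Submodule.coe_smul, Pi.smul_apply, smul_eq_mul, RingHom.id_apply,
      InnerProductSpace.laplacian_smul c a]
    ring

noncomputable def driftMap (ρ : Space N → ℝ) (G : Space N → Space N) (a : ℝ) :
    testSpace N →ₗ[ℝ] (Space N → ℝ) where
  toFun φ := locDrift ρ G a φ
  map_add' := by
    rintro ⟨φ, hφ⟩ ⟨ψ, hψ⟩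
    funext x
    by_cases hx : x ∈ Metric.ball (0 : Space N) a
    · simp [locDrift, hx, fderiv_add (hφ.differentiable x) (hψ.differentiable x), mul_add]
    · simp [locDrift, hx]
  map_smul' := by
    rintro c ⟨φ, hφ⟩
    funext x
    by_cases hx : x ∈ Metric.ball (0 : Space N) a
    · simp [locDrift, hx, fderiv_const_smul (hφ.differentiable x) c, mul_left_comm]
    · simp [locDrift, hx]

variable {ρ : Space N → ℝ} {G : Space N → Space N}

/-- Approximate solvability of `lφ - Δφ - β·∇φ = g` by test functions. -/
theorem exists_approx_solution {a l : ℝ} (hl : 0 < l)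
    (hD : ∀ φ, IsTest φ → MemLp (locDrift ρ G a φ) 2 volume ∧
      ∫ x, locDrift ρ G a φ x ^ 2 ≤ 1 / 4 * ∫ x, (l * φ x - Laplacian.laplacian φ x) ^ 2)
    {g : Space N → ℝ} (hg : MemLp g 2 volume) {δ : ℝ} (hδ : 0 < δ) :
    ∃ φ, IsTest φ ∧ MemLp (fun x => l * φ x - Laplacian.laplacian φ x - locDrift ρ G a φ x - g x)
        2 volume ∧ Real.sqrt (∫ x,
        (l * φ x - Laplacian.laplacian φ x - locDrift ρ G a φ x - g x) ^ 2) ≤ δ := by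
  have hSm : ∀ φ, MemLp (resolventMap N l φ) 2 volume := fun φ =>
    (((φ.2 : IsTest _).const_mul l).sub (φ.2 : IsTest _).laplacian).memLp 2 volume
  have hDm : ∀ φ, MemLp (driftMap ρ G a φ) 2 volume := fun φ => (hD φ φ.2).1
  have hdense : Dense (Set.range (testToLp _ hSm - testToLp _ hDm)) := by
    refine dense_range_sub (fun z hz => ?_) fun φ => ?_
    · have h0 := eLpNorm_eq_zero_of_orthogonal (Lp.memLp z) hl fun φ hφ => by
        have h1 := hz ⟨φ, hφ⟩
        have h2 := integral_mul_eq_inner (hSm ⟨φ, hφ⟩) (Lp.memLp z)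
        rw [Lp.toLp_coeFn] at h2
        exact h2.trans h1
      rw [← norm_eq_zero, Lp.norm_def, h0, ENNReal.toReal_zero]
    · show ‖(hDm φ).toLp _‖ ≤ 1 / 2 * ‖(hSm φ).toLp _‖
      rw [norm_toLp_eq_sqrt, norm_toLp_eq_sqrt]
      refine Real.sqrt_le_iff.2 ⟨by positivity, ?_⟩
      rw [mul_pow, Real.sq_sqrt (integral_sq_nonneg _)]
      refine ((hD φ φ.2).2).trans (le_of_eq ?_)
      norm_num
      rfl
  obtain ⟨_, hφ, φ, rfl⟩ := Metric.dense_iff.1 hdense (hg.toLp g) δ hδ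
  have hm : MemLp (fun x => l * (φ : Space N → ℝ) x - Laplacian.laplacian (φ : Space N → ℝ) x -
      locDrift ρ G a φ x - g x) 2 volume := ((hSm φ).sub (hDm φ)).sub hg
  refine ⟨φ, φ.2, hm, ?_⟩
  rw [← norm_toLp_eq_sqrt hm]
  rw [mem_ball_iff_norm] at hφ
  refine le_trans (le_of_eq ?_) hφ.le
  rfl

end DenseRange

/-! ### Passing between `μ` and Lebesgue measure; the reciprocal density. -/

section Weighted

variable {N : ℕ} {ρ : Space N → ℝ} {G : Space N → Space N} {μ : Measure (Space N)}

theorem IsTest.exists_radius {η : Space N → ℝ} (h : IsTest η) :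
    ∃ a, 0 < a ∧ ∀ x, a ≤ ‖x‖ → x ∉ tsupport η := by
  obtain ⟨a, ha⟩ := h.compact.isBounded.subset_closedBall (0 : Space N)
  refine ⟨|a| + 1, by positivity, fun x hx hxs => ?_⟩
  have := ha hxs
  rw [mem_closedBall_zero_iff] at this
  linarith [le_abs_self a]

theorem pd_eq_zero_of_notMem {η : Space N → ℝ} {x : Space N} (hx : x ∉ tsupport η) (i : Fin N) :
    pd i η x = 0 := by
  unfold pd
  rw [fderiv_of_notMem_tsupport (𝕜 := ℝ) hx]
  rfl

theorem IsAdmissible.pos (h : IsAdmissible ρ G μ) : ∀ᵐ x, 0 < ρ x := by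
  have h1 : ∀ n : ℕ, ∀ᵐ x, ‖x‖ ≤ n → 0 < ρ x := fun n => by
    obtain ⟨c, hc, hh⟩ := h.exists_lower_bound n
    exact hh.mono fun x hx hxn => hc.trans_le (hx hxn)
  filter_upwards [ae_all_iff.2 h1] with x hx
  obtain ⟨n, hn⟩ := exists_nat_ge ‖x‖
  exact hx n hn

theorem IsAdmissible.absolutelyContinuous (h : IsAdmissible ρ G μ) : volume ≪ μ := by
  rw [h.measure_eq]
  refine withDensity_absolutelyContinuous'
    h.integrable.aestronglyMeasurable.aemeasurable.ennreal_ofReal ?_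
  exact h.pos.mono fun x hx => by simpa using hx

theorem IsAdmissible.absolutelyContinuous' (h : IsAdmissible ρ G μ) : μ ≪ volume := by
  rw [h.measure_eq]
  exact withDensity_absolutelyContinuous _ _

theorem IsAdmissible.integral_eq (h : IsAdmissible ρ G μ) (F : Space N → ℝ) :
    ∫ x, F x ∂μ = ∫ x, F x * ρ x := by
  rw [h.measure_eq, integral_withDensity_eq_integral_toReal_smul₀
    h.integrable.aestronglyMeasurable.aemeasurable.ennreal_ofReal
    (Eventually.of_forall fun x => ENNReal.ofReal_lt_top)]
  refine integral_congr_ae (h.nonneg.mono fun x hx => ?_)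
  simp only [ENNReal.toReal_ofReal hx, smul_eq_mul, mul_comm]

theorem IsAdmissible.integrable_iff (h : IsAdmissible ρ G μ) {F : Space N → ℝ} :
    Integrable F μ ↔ Integrable fun x => F x * ρ x := by
  rw [h.measure_eq, integrable_withDensity_iff_integrable_smul₀'
    h.integrable.aestronglyMeasurable.aemeasurable.ennreal_ofReal
    (Eventually.of_forall fun x => ENNReal.ofReal_lt_top)]
  refine integrable_congr (h.nonneg.mono fun x hx => ?_)
  simp only [ENNReal.toReal_ofReal hx, smul_eq_mul, mul_comm]

theorem IsAdmissible.integrable_sq_mul (h : IsAdmissible ρ G μ) {k : Space N → ℝ}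
    (hk : MemLp k 2 μ) : Integrable fun x => k x ^ 2 * ρ x :=
  h.integrable_iff.1 (integrable_sq_of_memLp hk)

theorem IsAdmissible.aestronglyMeasurable (h : IsAdmissible ρ G μ) {k : Space N → ℝ}
    (hk : MemLp k 2 μ) : AEStronglyMeasurable k volume :=
  hk.1.mono_ac h.absolutelyContinuous

theorem IsAdmissible.memLp_mul (h : IsAdmissible ρ G μ) {k : Space N → ℝ} (hk : MemLp k 2 μ)
    {η : Space N → ℝ} (hη : IsTest η) : MemLp (fun x => η x * k x) 2 volume := by
  obtain ⟨a, ha, hη0⟩ := hη.exists_radius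
  obtain ⟨C, hC0, hC⟩ := hη.exists_bound
  obtain ⟨c, hc, hcρ⟩ := h.exists_lower_bound a
  have hm : AEStronglyMeasurable (fun x => η x * k x) volume :=
    hη.continuous.aestronglyMeasurable.mul (h.aestronglyMeasurable hk)
  rw [memLp_two_iff_integrable_sq hm]
  refine ((h.integrable_sq_mul hk).const_mul (C ^ 2 * c⁻¹)).mono' (hm.pow 2) ?_
  filter_upwards [hcρ, h.nonneg] with x hx hx0
  rw [Real.norm_of_nonneg (sq_nonneg _)]
  have hC2 : η x ^ 2 ≤ C ^ 2 := sq_le_sq' (abs_le.1 (hC x)).1 (abs_le.1 (hC x)).2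
  rcases le_or_gt a ‖x‖ with hxa | hxa
  · rw [image_eq_zero_of_notMem_tsupport (hη0 x hxa)]
    have : 0 ≤ C ^ 2 * c⁻¹ * (k x ^ 2 * ρ x) := by positivity
    simpa using this
  · have h1 := hx hxa.le
    have h2 : 1 ≤ c⁻¹ * ρ x := by
      rw [inv_mul_eq_div, le_div_iff₀ hc]; linarith
    calc (η x * k x) ^ 2 = η x ^ 2 * k x ^ 2 * 1 := by ring
      _ ≤ C ^ 2 * k x ^ 2 * (c⁻¹ * ρ x) := by gcongr
      _ = _ := by ring

/-- For `k` in `L²_μ`, the lower bound on `ρ` only makes `k` locally square integrable; for `kρ` the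
local upper bound on `ρ` is essential. -/
theorem IsAdmissible.memLp_mul_mul (h : IsAdmissible ρ G μ) {k : Space N → ℝ} (hk : MemLp k 2 μ)
    {η : Space N → ℝ} (hη : IsTest η) : MemLp (fun x => η x * (k x * ρ x)) 2 volume := by
  obtain ⟨a, ha, hη0⟩ := hη.exists_radius
  obtain ⟨M, hM, hMρ⟩ := h.exists_upper_bound a
  refine MemLp.of_le_mul (c := M) (h.memLp_mul hk hη) (hη.continuous.aestronglyMeasurable.mul
    ((h.aestronglyMeasurable hk).mul h.integrable.aestronglyMeasurable)) ?_
  filter_upwards [hMρ, h.nonneg] with x hx hx0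
  rcases le_or_gt a ‖x‖ with hxa | hxa
  · simp [image_eq_zero_of_notMem_tsupport (hη0 x hxa)]
  · rw [← mul_assoc, norm_mul, Real.norm_of_nonneg hx0, mul_comm]
    exact mul_le_mul_of_nonneg_right (hx hxa) (norm_nonneg _)

theorem IsAdmissible.isFiniteMeasure (h : IsAdmissible ρ G μ) : IsFiniteMeasure μ := by
  rw [h.measure_eq]
  exact isFiniteMeasure_withDensity_ofReal h.integrable.2

theorem IsAdmissible.memLp_of_test (h : IsAdmissible ρ G μ) {φ : Space N → ℝ} (hφ : IsTest φ) :
    MemLp φ 2 μ := by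
  have := h.isFiniteMeasure
  exact hφ.memLp 2 μ

/-- Division by the density preserves square integrability on balls. -/
theorem IsAdmissible.exists_div_bound (h : IsAdmissible ρ G μ) (a : ℝ) :
    ∃ C, 0 ≤ C ∧ ∀ F : Space N → ℝ, MemLp F 2 volume → (∀ x, a ≤ ‖x‖ → F x = 0) →
      MemLp (fun x => F x / ρ x) 2 volume ∧
      Real.sqrt (∫ x, (F x / ρ x) ^ 2) ≤ C * Real.sqrt (∫ x, F x ^ 2) := by
  obtain ⟨c, hc, hcρ⟩ := h.exists_lower_bound a
  refine ⟨c⁻¹, by positivity, fun F hF hF0 => ?_⟩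
  have hle : ∀ᵐ x, ‖F x / ρ x‖ ≤ c⁻¹ * ‖F x‖ := by
    filter_upwards [hcρ] with x hx
    rcases le_or_gt a ‖x‖ with hxa | hxa
    · simp [hF0 x hxa]
    · have h1 := hx hxa.le
      rw [div_eq_inv_mul, norm_mul, norm_inv, Real.norm_of_nonneg (hc.le.trans h1)]
      gcongr
  have hL : MemLp (fun x => F x / ρ x) 2 volume :=
    MemLp.of_le_mul hF (hF.1.aemeasurable.div
      h.integrable.aestronglyMeasurable.aemeasurable).aestronglyMeasurable hle
  refine ⟨hL, ?_⟩
  rw [← norm_toLp_eq_sqrt hL, ← norm_toLp_eq_sqrt hF]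
  refine Lp.norm_le_mul_norm_of_ae_le_mul ?_
  filter_upwards [hle, hL.coeFn_toLp, hF.coeFn_toLp] with x h1 h2 h3
  rwa [h2, h3]

theorem IsTest.integral_pd_eq_zero {φ : Space N → ℝ} (h : IsTest φ) (i : Fin N) :
    ∫ x, BiKolmogorov.pd i φ x = 0 := by
  have := h.integral_mul_pd (contDiff_const (c := (1 : ℝ))) i
  simpa [BiKolmogorov.pd] using this

theorem isTest_div {Ψ P : Space N → ℝ} (hΨ : IsTest Ψ) (hP : ContDiff ℝ ∞ P)
    (h : ∀ x ∈ tsupport Ψ, P x ≠ 0) : IsTest fun x => Ψ x / P x := by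
  refine ⟨contDiff_iff_contDiffAt.2 fun x => ?_, ?_⟩
  · by_cases hx : x ∈ tsupport Ψ
    · exact hΨ.smooth.contDiffAt.div hP.contDiffAt (h x hx)
    · have : (fun x => Ψ x / P x) =ᶠ[𝓝 x] fun _ => 0 := by
        filter_upwards [notMem_tsupport_iff_eventuallyEq.1 hx] with y hy
        simp [hy]
      exact contDiffAt_const.congr_of_eventuallyEq this
  · simp only [div_eq_mul_inv]
    exact hΨ.compact.mul_right

theorem pd_div {Ψ P : Space N → ℝ} {x : Space N} (hΨ : DifferentiableAt ℝ Ψ x)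
    (hP : DifferentiableAt ℝ P x) (h : P x ≠ 0) (i : Fin N) :
    pd i (fun y => Ψ y / P y) x = pd i Ψ x / P x - Ψ x * (pd i P x / P x ^ 2) := by
  have h1 := (hΨ.hasFDerivAt.fun_mul ((hasDerivAt_inv h).comp_hasFDerivAt x hP.hasFDerivAt)).fderiv
  simp only [Function.comp_def] at h1
  unfold pd
  simp only [div_eq_mul_inv]
  rw [h1]
  simp
  field_simp
  ring

/-- The difference is linear in `P - w` and `p - q` up to factors bounded through `c`, so `L²`
convergence of a density approximation and its gradient carries over to derivatives of quotients. -/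
theorem abs_chain_sub_le {c P w p q s t : ℝ} (hc : 0 < c) (hP : c ≤ P) (hw : c ≤ w) :
    |(s / P - t * (p / P ^ 2)) - (s / w - t * (q / w ^ 2))| ≤
      (c ^ 2)⁻¹ * (|s| * |P - w|) + ((c ^ 2)⁻¹ * (|t| * |p - q|) +
        2 * (c ^ 3)⁻¹ * |t| * (|q| * |P - w|)) := by
  have hP0 : 0 < P := hc.trans_le hP
  have hw0 : 0 < w := hc.trans_le hw
  have i1 : P⁻¹ ≤ c⁻¹ := inv_anti₀ hc hP
  have i2 : w⁻¹ ≤ c⁻¹ := inv_anti₀ hc hw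
  have e : (s / P - t * (p / P ^ 2)) - (s / w - t * (q / w ^ 2)) =
      -(P⁻¹ * w⁻¹ * (s * (P - w))) + (-(P⁻¹ * P⁻¹ * (t * (p - q))) +
        (P⁻¹ * P⁻¹ * w⁻¹ + P⁻¹ * w⁻¹ * w⁻¹) * t * (q * (P - w))) := by
    field_simp
    ring
  rw [e]
  have e2 : (c ^ 2)⁻¹ = c⁻¹ * c⁻¹ := by rw [sq, mul_inv]
  have e3 : 2 * (c ^ 3)⁻¹ = c⁻¹ * c⁻¹ * c⁻¹ + c⁻¹ * c⁻¹ * c⁻¹ := by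
    rw [pow_succ, sq, mul_inv, mul_inv]; ring
  refine (abs_add_le _ _).trans (add_le_add ?_ ((abs_add_le _ _).trans (add_le_add ?_ ?_)))
  · rw [abs_neg, abs_mul, abs_mul s, e2, abs_of_pos (by positivity)]
    gcongr
  · rw [abs_neg, abs_mul, abs_mul t, e2, abs_of_pos (by positivity)]
    gcongr
  · rw [abs_mul, abs_mul, abs_mul q, e3, abs_of_pos (by positivity)]
    gcongr

/-- The chain rule for the reciprocal of the density. -/
theorem IsAdmissible.integral_pd_div (h : IsAdmissible ρ G μ) {Ψ : Space N → ℝ} (hΨ : IsTest Ψ)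
    (i : Fin N) : ∫ x, (pd i Ψ x / ρ x - Ψ x * (G x i / ρ x ^ 2)) = 0 := by
  obtain ⟨a, ha, hΨ0⟩ := hΨ.exists_radius
  obtain ⟨c, u, g, P, hc, hcρ, hu, hg, huρ, hgG, hP, hcP, hPu, hPg⟩ := h.exists_approx ha
  obtain ⟨C, hC0, hC⟩ := hΨ.exists_bound
  set F : ℕ → Space N → ℝ := fun j x => pd i Ψ x / P j x - Ψ x * (pd i (P j) x / P j x ^ 2)
  set F₀ : Space N → ℝ := fun x => pd i Ψ x / ρ x - Ψ x * (G x i / ρ x ^ 2)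
  have hT : ∀ j, IsTest fun x => Ψ x / P j x := fun j =>
    isTest_div hΨ (hP j).smooth fun x hx => by
      have : ‖x‖ < a := by
        by_contra hh
        exact hΨ0 x (not_lt.1 hh) hx
      exact (hc.trans_le (hcP j x this)).ne'
  -- Each `F j` is the derivative of a test function and integrates to zero; outside the ball, where
  -- `P j` may vanish, both sides are zero because `Ψ` is.
  have hF : ∀ j, pd i (fun x => Ψ x / P j x) = F j := fun j => by
    funext x
    rcases lt_or_ge ‖x‖ a with hx | hx
    · exact pd_div (hΨ.differentiable x) ((hP j).differentiable x)
        (hc.trans_le (hcP j x hx)).ne' i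
    · have h1 := hΨ0 x hx
      have h2 : x ∉ tsupport fun x => Ψ x / P j x := fun hh => h1 <| by
        simp only [div_eq_mul_inv] at hh
        exact tsupport_mul_subset_left hh
      rw [pd_eq_zero_of_notMem h2]
      simp [F, image_eq_zero_of_notMem_tsupport h1, pd_eq_zero_of_notMem h1]
  have hint : ∀ j, ∫ x, F j x = 0 := fun j => by
    rw [← hF]; exact (hT j).integral_pd_eq_zero i
  have hFi : ∀ j, Integrable (F j) := fun j => by
    rw [← hF]; exact ((hT j).pd i).integrable volume
  have hbound : ∀ j, ∀ᵐ x, ‖F j x - F₀ x‖ ≤ (c ^ 2)⁻¹ * (|pd i Ψ x| * |(P j - u) x|) +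
      ((c ^ 2)⁻¹ * (|Ψ x| * |(pd i (P j) - g i) x|) +
        2 * (c ^ 3)⁻¹ * C * (|g i x| * |(P j - u) x|)) := by
    intro j
    filter_upwards [hcρ] with x hx
    rcases lt_or_ge ‖x‖ a with hxa | hxa
    · refine (abs_chain_sub_le hc (hcP j x hxa) (hx hxa.le)).trans ?_
      simp only [Pi.sub_apply, huρ x hxa.le, hgG i x hxa]
      gcongr
      exact hC x
    · have h1 := hΨ0 x hxa
      have e : F j x - F₀ x = 0 := by
        simp [F, F₀, image_eq_zero_of_notMem_tsupport h1, pd_eq_zero_of_notMem h1]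
      rw [e, norm_zero]
      positivity
  have hpu : ∀ j, MemLp (fun x => |(P j - u) x|) 2 volume := fun j =>
    (((hP j).memLp 2 volume).sub hu).abs
  have hpg : ∀ j, MemLp (fun x => |(pd i (P j) - g i) x|) 2 volume := fun j =>
    ((((hP j).pd i).memLp 2 volume).sub (hg i)).abs
  have key : ∀ {D : ℕ → Space N → ℝ} {k : Space N → ℝ}, (∀ j, MemLp (fun x => |D j x|) 2 volume) →
      MemLp k 2 volume → Tendsto (fun j => eLpNorm (D j) 2 volume) atTop (𝓝 0) →
      Tendsto (fun j => ∫ x, |k x| * |D j x|) atTop (𝓝 0) := by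
    intro D k hD hk hl
    have h2 := tendsto_integral_mul_const (g := fun x => |k x|) (f₀ := fun _ => (0 : ℝ)) hD
      MemLp.zero' hk.abs (by
        refine hl.congr fun j => ?_
        have : ((fun x => |D j x|) - fun _ => (0 : ℝ)) = fun x => ‖D j x‖ := by
          funext x; simp
        rw [this, eLpNorm_norm])
    simpa [mul_comm] using h2
  have hpΨ := (hΨ.pd i).memLp 2 volume
  have hΨL := hΨ.memLp 2 volume
  have j1 : ∀ j, Integrable fun x => (c ^ 2)⁻¹ * (|pd i Ψ x| * |(P j - u) x|) := fun j =>
    (integrable_mul_of_memLp hpΨ.abs (hpu j)).const_mul _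
  have j2 : ∀ j, Integrable fun x => (c ^ 2)⁻¹ * (|Ψ x| * |(pd i (P j) - g i) x|) := fun j =>
    (integrable_mul_of_memLp hΨL.abs (hpg j)).const_mul _
  have j3 : ∀ j, Integrable fun x => 2 * (c ^ 3)⁻¹ * C * (|g i x| * |(P j - u) x|) := fun j =>
    (integrable_mul_of_memLp (hg i).abs (hpu j)).const_mul _
  have j23 : ∀ j, Integrable fun x => (c ^ 2)⁻¹ * (|Ψ x| * |(pd i (P j) - g i) x|) +
      2 * (c ^ 3)⁻¹ * C * (|g i x| * |(P j - u) x|) := fun j => (j2 j).add (j3 j)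
  have hρm := h.integrable.aestronglyMeasurable.aemeasurable
  have hGm : AEMeasurable fun x => G x i :=
    (h.gradient_memLpLoc.comp_apply i).locallyIntegrable.aestronglyMeasurable.aemeasurable
  have hF₀m : AEStronglyMeasurable F₀ volume :=
    (((hΨ.pd i).continuous.measurable.aemeasurable.div hρm).sub
      (hΨ.continuous.measurable.aemeasurable.mul
        (hGm.div (hρm.pow_const 2)))).aestronglyMeasurable
  have hd : ∀ j, Integrable fun x => F j x - F₀ x := fun j =>
    ((j1 j).add (j23 j)).mono' ((hFi j).1.sub hF₀m) (hbound j)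
  have hF₀i : Integrable F₀ := by
    refine ((hFi 0).sub (hd 0)).congr (Eventually.of_forall fun x => ?_)
    simp
  have hle : ∀ j, |∫ x, F₀ x| ≤ (c ^ 2)⁻¹ * (∫ x, |pd i Ψ x| * |(P j - u) x|) +
      ((c ^ 2)⁻¹ * (∫ x, |Ψ x| * |(pd i (P j) - g i) x|) +
        2 * (c ^ 3)⁻¹ * C * ∫ x, |g i x| * |(P j - u) x|) := by
    intro j
    have h1 : |∫ x, F₀ x| = ‖∫ x, (F j x - F₀ x)‖ := by
      rw [integral_sub (hFi j) hF₀i, hint j, zero_sub, norm_neg, Real.norm_eq_abs]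
    rw [h1]
    refine (norm_integral_le_of_norm_le ((j1 j).add (j23 j)) (hbound j)).trans (le_of_eq ?_)
    refine (integral_add (j1 j) (j23 j)).trans ?_
    rw [integral_add (j2 j) (j3 j), integral_const_mul, integral_const_mul, integral_const_mul]
  have hlim := ((key hpu hpΨ hPu).const_mul (c ^ 2)⁻¹).add
    (((key hpg hΨL (hPg i)).const_mul (c ^ 2)⁻¹).add
      ((key hpu (hg i) hPu).const_mul (2 * (c ^ 3)⁻¹ * C)))
  simp only [mul_zero, add_zero] at hlim
  exact abs_eq_zero.1 (le_antisymm (ge_of_tendsto' hlim hle) (abs_nonneg _))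

end Weighted

/-! ### Energy estimates for the localized equation. -/

section LocalRegularity

variable {N : ℕ}

/-- The energy `‖∇φ‖² + l ‖φ‖²`. -/
noncomputable def energy (l : ℝ) (φ : Space N → ℝ) : ℝ := gradSq φ + l * ∫ x, φ x ^ 2

theorem energy_nonneg {l : ℝ} (hl : 1 ≤ l) (φ : Space N → ℝ) : 0 ≤ energy l φ :=
  add_nonneg (gradSq_nonneg φ) (mul_nonneg (by linarith) (integral_sq_nonneg _))

theorem integral_sq_le_energy {l : ℝ} (hl : 1 ≤ l) (φ : Space N → ℝ) :
    ∫ x, φ x ^ 2 ≤ energy l φ := by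
  have := gradSq_nonneg φ
  have h0 := integral_sq_nonneg (ν := volume) φ
  unfold energy
  nlinarith

theorem integral_pd_sq_le_energy {l : ℝ} (hl : 1 ≤ l) (φ : Space N → ℝ) (i : Fin N) :
    ∫ x, pd i φ x ^ 2 ≤ energy l φ := by
  have h1 : ∫ x, pd i φ x ^ 2 ≤ gradSq φ :=
    Finset.single_le_sum (f := fun i => ∫ x, pd i φ x ^ 2) (fun _ _ => integral_sq_nonneg _)
      (Finset.mem_univ i)
  have h0 := integral_sq_nonneg (ν := volume) φ
  unfold energy
  nlinarith

variable {ρ : Space N → ℝ} {G : Space N → Space N} {μ : Measure (Space N)}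

theorem locDrift_mul_le (a : ℝ) (φ : Space N → ℝ) (x : Space N) :
    locDrift ρ G a φ x * φ x ≤
      (locWeight ρ G a x * φ x) ^ 2 + 1 / 4 * ∑ i, pd i φ x ^ 2 := by
  have h1 := norm_fderiv_sq_le φ x
  have h2 : |locDrift ρ G a φ x| ≤ ‖fderiv ℝ φ x‖ * |locWeight ρ G a x| := by
    by_cases hx : x ∈ Metric.ball (0 : Space N) a
    · rw [locDrift, locWeight, Set.indicator_of_mem hx, Set.indicator_of_mem hx, abs_norm]
      exact (fderiv ℝ φ x).le_opNorm _
    · simp [locDrift, locWeight, Set.indicator_of_notMem hx]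
  have h3 : locDrift ρ G a φ x * φ x ≤ ‖fderiv ℝ φ x‖ * |locWeight ρ G a x * φ x| := by
    refine (le_abs_self _).trans ?_
    rw [abs_mul, abs_mul, ← mul_assoc]
    gcongr
  have h4 := sq_abs (locWeight ρ G a x * φ x)
  nlinarith [sq_nonneg (|locWeight ρ G a x * φ x| - 1 / 2 * ‖fderiv ℝ φ x‖)]

/-- Coercivity: integrating by parts, the right-hand integral is the energy minus `∫ (β·∇φ) φ`. By
Young and the smallness of the weight this drift term is at most half the energy. -/
theorem energy_le {a l : ℝ} {φ : Space N → ℝ} (hφ : IsTest φ)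
    (hD : MemLp (locDrift ρ G a φ) 2 volume)
    (hW : MemLp (fun x => locWeight ρ G a x * φ x) 2 volume)
    (hW' : ∫ x, (locWeight ρ G a x * φ x) ^ 2 ≤ 1 / 4 * energy l φ) (hl : 1 ≤ l) :
    energy l φ ≤
      2 * ∫ x, (l * φ x - Laplacian.laplacian φ x - locDrift ρ G a φ x) * φ x := by
  have hφL := hφ.memLp 2 volume
  have i1 : Integrable fun x => l * φ x ^ 2 := (integrable_sq_of_memLp hφL).const_mul l
  have i2 : Integrable fun x => φ x * Laplacian.laplacian φ x :=
    integrable_mul_of_memLp hφL (hφ.laplacian.memLp 2 volume)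
  have i3 : Integrable fun x => locDrift ρ G a φ x * φ x := integrable_mul_of_memLp hD hφL
  have i4 : ∀ i, Integrable fun x => pd i φ x ^ 2 := fun i =>
    integrable_sq_of_memLp ((hφ.pd i).memLp 2 volume)
  have i12 : Integrable fun x => l * φ x ^ 2 - φ x * Laplacian.laplacian φ x := i1.sub i2
  have e : ∀ x, (l * φ x - Laplacian.laplacian φ x - locDrift ρ G a φ x) * φ x =
      (l * φ x ^ 2 - φ x * Laplacian.laplacian φ x) - locDrift ρ G a φ x * φ x :=
    fun x => by ring
  have h1 : ∫ x, locDrift ρ G a φ x * φ x ≤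
      (∫ x, (locWeight ρ G a x * φ x) ^ 2) + 1 / 4 * gradSq φ := by
    have i5 : Integrable fun x => 1 / 4 * ∑ i, pd i φ x ^ 2 :=
      (integrable_finsetSum _ fun i _ => i4 i).const_mul _
    refine (integral_mono i3 ((integrable_sq_of_memLp hW).add i5)
      (locDrift_mul_le a φ)).trans (le_of_eq ?_)
    refine (integral_add (integrable_sq_of_memLp hW) i5).trans ?_
    rw [integral_const_mul, integral_finsetSum _ fun i _ => i4 i, gradSq]
  simp only [e]
  rw [integral_sub i12 i3, integral_sub i1 i2, integral_const_mul,
    hφ.integral_mul_laplacian hφ.smooth]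
  have h2 : ∑ i, ∫ x, pd i φ x * pd i φ x = gradSq φ := by simp only [gradSq, sq]
  rw [h2]
  have h0 : 0 ≤ l * ∫ x, φ x ^ 2 := mul_nonneg (by linarith) (integral_sq_nonneg _)
  have h3 := gradSq_nonneg φ
  unfold energy at hW' ⊢
  linarith

theorem IsAdmissible.memLp_div (h : IsAdmissible ρ G μ) {F : Space N → ℝ} (hF : IsTest F) :
    MemLp (fun x => F x / ρ x) 2 volume := by
  obtain ⟨a, -, ha⟩ := hF.exists_radius
  obtain ⟨C, -, hC⟩ := h.exists_div_bound a
  exact (hC F (hF.memLp 2 volume) fun x hx => image_eq_zero_of_notMem_tsupport (ha x hx)).1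

theorem abs_apply_le_locWeight {a : ℝ} {x : Space N} (hx : ‖x‖ < a) (i : Fin N) :
    |(ρ x)⁻¹ * G x i| ≤ locWeight ρ G a x := by
  rw [locWeight, Set.indicator_of_mem (mem_ball_zero_iff.2 hx)]
  exact PiLp.norm_apply_le ((ρ x)⁻¹ • G x) i

theorem sq_add_three_le (x y z : ℝ) : (x + y + z) ^ 2 ≤ 3 * (x ^ 2 + y ^ 2 + z ^ 2) := by
  nlinarith [sq_nonneg (x - y), sq_nonneg (y - z), sq_nonneg (x - z)]

/-- Integration by parts against the reciprocal density. -/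
theorem IsAdmissible.exists_dual_bound (h : IsAdmissible ρ G μ) {a : ℝ} {ζ : Space N → ℝ}
    (hζ : IsTest ζ) (hζa : ∀ x, a ≤ ‖x‖ → x ∉ tsupport ζ) :
    ∃ C, 0 ≤ C ∧ ∀ {l : ℝ} {φ ψ : Space N → ℝ}, 1 ≤ l → IsTest φ →
      MemLp (fun x => locWeight ρ G a x * φ x) 2 volume →
      ∫ x, (locWeight ρ G a x * φ x) ^ 2 ≤ 1 / 4 * energy l φ → IsTest ψ → ∀ i,
      |∫ x, ζ x * pd i ψ x / ρ x * φ x| ≤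
        C * Real.sqrt (∫ x, ψ x ^ 2) * Real.sqrt (energy l φ) := by
  obtain ⟨K, hK0, hK⟩ := h.exists_div_bound a
  obtain ⟨B, hB0, hB⟩ := hζ.exists_bound
  choose B' hB'0 hB' using fun i => (hζ.pd i).exists_bound
  set D := B + ∑ i, B' i
  have hB'D : ∀ i, B' i ≤ D := fun i =>
    (Finset.single_le_sum (f := B') (fun i _ => hB'0 i) (Finset.mem_univ i)).trans (by
      simp only [D]; linarith)
  have hBD : B ≤ D := by
    have : 0 ≤ ∑ i, B' i := Finset.sum_nonneg fun i _ => hB'0 i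
    simp only [D]; linarith
  have hD0 : 0 ≤ D := hB0.trans hBD
  refine ⟨K * Real.sqrt (9 * D ^ 2), by positivity, fun {l φ ψ} hl hφ hW hW' hψ i => ?_⟩
  set Φ : Space N → ℝ := fun x => ζ x * φ x
  have hΦ : IsTest Φ := hζ.mul_right hφ.smooth
  have hΨ : IsTest fun x => Φ x * ψ x := hΦ.mul_right hψ.smooth
  -- Integrating `∂ᵢ(Φψ/ρ)` to zero moves the derivative off `ψ` and turns the left-hand integral
  -- into `∫ ψ F/ρ`, where `F` contains at most first derivatives of `φ`.
  set F : Space N → ℝ := fun x => Φ x * ((ρ x)⁻¹ * G x i) - pd i Φ x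
  have hpdΦ : ∀ x, pd i Φ x = ζ x * pd i φ x + pd i ζ x * φ x := fun x =>
    pd_mul i (hζ.differentiable x) (hφ.differentiable x)
  have hζ0 : ∀ x, a ≤ ‖x‖ → ζ x = 0 ∧ pd i ζ x = 0 := fun x hx =>
    ⟨image_eq_zero_of_notMem_tsupport (hζa x hx), pd_eq_zero_of_notMem (hζa x hx) i⟩
  have hF0 : ∀ x, a ≤ ‖x‖ → F x = 0 := fun x hx => by
    simp [F, Φ, hpdΦ, (hζ0 x hx).1, (hζ0 x hx).2]
  have hFle : ∀ x, |F x| ≤ D * |locWeight ρ G a x * φ x| + D * |pd i φ x| + D * |φ x| := by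
    intro x
    rcases le_or_gt a ‖x‖ with hx | hx
    · rw [hF0 x hx, abs_zero]; positivity
    have h1 : |Φ x * ((ρ x)⁻¹ * G x i)| ≤ D * |locWeight ρ G a x * φ x| := by
      have h2 := (abs_apply_le_locWeight (ρ := ρ) (G := G) hx i).trans (le_abs_self _)
      calc |Φ x * ((ρ x)⁻¹ * G x i)| = |ζ x| * (|(ρ x)⁻¹ * G x i| * |φ x|) := by
            simp only [Φ]; rw [abs_mul, abs_mul]; ring
        _ ≤ D * (|locWeight ρ G a x| * |φ x|) := by
            gcongr
            exact (hB x).trans hBD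
        _ = _ := by rw [abs_mul]
    have h2 : |pd i Φ x| ≤ D * |pd i φ x| + D * |φ x| := by
      rw [hpdΦ]
      refine (abs_add_le _ _).trans ?_
      rw [abs_mul, abs_mul]
      gcongr
      · exact (hB x).trans hBD
      · exact (hB' i x).trans (hB'D i)
    calc |F x| ≤ |Φ x * ((ρ x)⁻¹ * G x i)| + |pd i Φ x| := abs_sub _ _
      _ ≤ _ := by linarith
  have hρm := h.integrable.aestronglyMeasurable.aemeasurable
  have hGm : AEMeasurable fun x => G x i :=
    (h.gradient_memLpLoc.comp_apply i).locallyIntegrable.aestronglyMeasurable.aemeasurable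
  have hFm : AEStronglyMeasurable F volume :=
    ((hΦ.continuous.measurable.aemeasurable.mul (hρm.inv.mul hGm)).sub
      (hΦ.pd i).continuous.measurable.aemeasurable).aestronglyMeasurable
  have hsq : ∀ x, F x ^ 2 ≤
      3 * D ^ 2 * ((locWeight ρ G a x * φ x) ^ 2 + pd i φ x ^ 2 + φ x ^ 2) := by
    intro x
    have h1 := pow_le_pow_left₀ (abs_nonneg _) (hFle x) 2
    rw [sq_abs] at h1
    refine h1.trans ((sq_add_three_le _ _ _).trans (le_of_eq ?_))
    simp only [mul_pow, sq_abs]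
    ring
  have k1 := integrable_sq_of_memLp hW
  have k2 := integrable_sq_of_memLp ((hφ.pd i).memLp 2 volume)
  have k3 := integrable_sq_of_memLp (hφ.memLp 2 volume)
  have k12 : Integrable fun x => (locWeight ρ G a x * φ x) ^ 2 + pd i φ x ^ 2 := k1.add k2
  have k : Integrable fun x =>
      3 * D ^ 2 * ((locWeight ρ G a x * φ x) ^ 2 + pd i φ x ^ 2 + φ x ^ 2) :=
    (k12.add k3).const_mul _
  have hFL : MemLp F 2 volume := by
    rw [memLp_two_iff_integrable_sq hFm]
    exact k.mono' (hFm.pow 2) (Eventually.of_forall fun x => by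
      rw [Real.norm_of_nonneg (sq_nonneg _)]; exact hsq x)
  have hE0 := energy_nonneg hl φ
  -- The factor `9` is `3` from squaring a sum of three terms, times three terms each bounded by the
  -- energy.
  have hFE : ∫ x, F x ^ 2 ≤ 9 * D ^ 2 * energy l φ := by
    refine (integral_mono (integrable_sq_of_memLp hFL) k hsq).trans ?_
    rw [integral_const_mul, integral_add k12 k3, integral_add k1 k2]
    have := integral_sq_le_energy hl φ
    have := integral_pd_sq_le_energy hl φ i
    nlinarith [sq_nonneg D]
  obtain ⟨hX, hX'⟩ := hK F hFL hF0
  have hL : MemLp (fun x => ζ x * pd i ψ x / ρ x) 2 volume :=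
    h.memLp_div (hζ.mul_right (hψ.pd i).smooth)
  have e : ∀ᵐ x, pd i (fun x => Φ x * ψ x) x / ρ x - Φ x * ψ x * (G x i / ρ x ^ 2) =
      ζ x * pd i ψ x / ρ x * φ x - ψ x * (F x / ρ x) := by
    filter_upwards [h.pos] with x hx
    rw [pd_mul i (hΦ.differentiable x) (hψ.differentiable x)]
    simp only [F, Φ]
    field_simp
    ring
  have h0 := h.integral_pd_div hΨ i
  rw [integral_congr_ae e, integral_sub (integrable_mul_of_memLp hL (hφ.memLp 2 volume))
    (integrable_mul_of_memLp (hψ.memLp 2 volume) hX), sub_eq_zero] at h0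
  rw [h0]
  refine (abs_integral_mul_le (hψ.memLp 2 volume) hX).trans ?_
  calc _ ≤ Real.sqrt (∫ x, ψ x ^ 2) * (K * Real.sqrt (9 * D ^ 2 * energy l φ)) := by
        gcongr
        exact hX'.trans (by gcongr)
    _ = _ := by rw [Real.sqrt_mul (by positivity)]; ring

theorem laplacian_mul {φ ψ : Space N → ℝ} (hφ : ContDiff ℝ ∞ φ) (hψ : ContDiff ℝ ∞ ψ)
    (x : Space N) : Laplacian.laplacian (fun y => φ y * ψ y) x =
      φ x * Laplacian.laplacian ψ x + 2 * (∑ i, pd i φ x * pd i ψ x) +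
        Laplacian.laplacian φ x * ψ x := by
  have d : ∀ {φ : Space N → ℝ}, ContDiff ℝ ∞ φ → ∀ x, DifferentiableAt ℝ φ x :=
    fun h x => h.differentiable (by simp) x
  rw [laplacian_eq_sum_pd (hφ.mul hψ), laplacian_eq_sum_pd hφ, laplacian_eq_sum_pd hψ,
    Finset.mul_sum, Finset.mul_sum, Finset.sum_mul, ← Finset.sum_add_distrib,
    ← Finset.sum_add_distrib]
  refine Finset.sum_congr rfl fun i _ => ?_
  have e : pd i (fun y => φ y * ψ y) = fun y => φ y * pd i ψ y + pd i φ y * ψ y :=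
    funext fun y => pd_mul i (d hφ y) (d hψ y)
  rw [e, pd_add i (d (hφ.mul (contDiff_pd hψ i)) x) (d ((contDiff_pd hφ i).mul hψ) x),
    pd_mul i (d hφ x) (d (contDiff_pd hψ i) x), pd_mul i (d (contDiff_pd hφ i) x) (d hψ x)]
  ring

theorem diffExpr_mul {φ ψ : Space N → ℝ} (hφ : ContDiff ℝ ∞ φ) (hψ : ContDiff ℝ ∞ ψ)
    (x : Space N) : diffExpr ρ G (fun y => φ y * ψ y) x =
      φ x * diffExpr ρ G ψ x + 2 * (∑ i, pd i φ x * pd i ψ x) + diffExpr ρ G φ x * ψ x := by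
  unfold diffExpr
  rw [laplacian_mul hφ hψ, fderiv_fun_mul (hφ.differentiable (by simp) x)
    (hψ.differentiable (by simp) x)]
  simp
  ring

end LocalRegularity

/-! ### Interior gradient estimates for weak solutions, by duality. -/

section WeakSolutions

variable {N : ℕ} {ρ : Space N → ℝ} {G : Space N → Space N} {μ : Measure (Space N)}

/-- `L h = f` in the sense of distributions with respect to `μ`. -/
def IsWeakSolution (ρ : Space N → ℝ) (G : Space N → Space N) (μ : Measure (Space N))
    (h f : Space N → ℝ) : Prop :=
  ∀ φ : Space N → ℝ, IsTest φ → ∫ x, diffExpr ρ G φ x * h x ∂μ = ∫ x, φ x * f x ∂μ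

theorem diffExpr_eq (φ : Space N → ℝ) (x : Space N) :
    diffExpr ρ G φ x = Laplacian.laplacian φ x + ∑ i, (ρ x)⁻¹ * G x i * pd i φ x := by
  rw [diffExpr, fderiv_eq_sum_pd]
  rfl

theorem laplacian_eq_zero_of_notMem {η : Space N → ℝ} (hη : ContDiff ℝ ∞ η) {x : Space N}
    (hx : x ∉ tsupport η) : Laplacian.laplacian η x = 0 := by
  rw [laplacian_eq_sum_pd hη]
  refine Finset.sum_eq_zero fun i _ => pd_eq_zero_of_notMem ?_ i
  rw [notMem_tsupport_iff_eventuallyEq]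
  filter_upwards [(isClosed_tsupport η).isOpen_compl.mem_nhds hx] with y hy
  exact pd_eq_zero_of_notMem hy i

/-- The drift of a test function is square integrable for Lebesgue measure by the weight bound;
local boundedness of `ρ` transfers this to `μ`. -/
theorem IsAdmissible.memLp_diffExpr (h : IsAdmissible ρ G μ) {φ : Space N → ℝ} (hφ : IsTest φ) :
    MemLp (diffExpr ρ G φ) 2 μ := by
  obtain ⟨a, -, ha⟩ := hφ.exists_radius
  obtain ⟨M, hM, hMρ⟩ := h.exists_upper_bound a
  obtain ⟨l, -, hl⟩ := h.exists_large a
  have e : diffExpr ρ G φ = fun x => Laplacian.laplacian φ x + locDrift ρ G a φ x := by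
    funext x
    rcases le_or_gt a ‖x‖ with hx | hx
    · have hx' : x ∉ Metric.ball (0 : Space N) a := by simpa using hx
      simp [diffExpr, locDrift, hx', fderiv_of_notMem_tsupport (𝕜 := ℝ) (ha x hx)]
    · have hx' : x ∈ Metric.ball (0 : Space N) a := mem_ball_zero_iff.2 hx
      simp [diffExpr, locDrift, hx']
  rw [e]
  refine (h.memLp_of_test hφ.laplacian).add ?_
  have hm : AEStronglyMeasurable (locDrift ρ G a φ) volume :=
    h.aestronglyMeasurable_locDrift a hφ.smooth
  rw [memLp_two_iff_integrable_sq (hm.mono_ac h.absolutelyContinuous'), h.integrable_iff]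
  refine ((integrable_sq_of_memLp (hl φ hφ).1).const_mul M).mono'
    ((hm.pow 2).mul h.integrable.aestronglyMeasurable) ?_
  filter_upwards [hMρ, h.nonneg] with x hx hx0
  rw [Real.norm_of_nonneg (by positivity), mul_comm]
  rcases le_or_gt a ‖x‖ with hxa | hxa
  · have hx' : x ∉ Metric.ball (0 : Space N) a := by simpa using hxa
    simp [locDrift, hx']
  · gcongr
    exact hx hxa

/-- By Leibniz, `η Lφ = L(ηφ) - 2∇η·∇φ - φ Lη`. The weak equation turns `L(ηφ)` into a zero-order
term in `φ`; all the others contain at most first derivatives of `φ`, or `βφ`, and are bounded by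
the square root of the energy. -/
theorem IsAdmissible.exists_functional_bound (hadm : IsAdmissible ρ G μ) {h f : Space N → ℝ}
    (hh : MemLp h 2 μ) (hf : MemLp f 2 μ) (hw : IsWeakSolution ρ G μ h f) {a : ℝ}
    {η : Space N → ℝ} (hη : IsTest η) (hηa : ∀ x, a ≤ ‖x‖ → x ∉ tsupport η) {l : ℝ}
    (hl : 1 ≤ l) :
    ∃ C, 0 ≤ C ∧ ∀ φ, IsTest φ → MemLp (fun x => locWeight ρ G a x * φ x) 2 volume →
      ∫ x, (locWeight ρ G a x * φ x) ^ 2 ≤ 1 / 4 * energy l φ →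
      |∫ x, (l * φ x - Laplacian.laplacian φ x - locDrift ρ G a φ x) * (η x * (h x * ρ x))| ≤
        C * Real.sqrt (energy l φ) := by
  have m1 := hadm.memLp_mul_mul hh hη
  have m2 := hadm.memLp_mul_mul hf hη
  have m3 := fun i => hadm.memLp_mul_mul hh (hη.pd i)
  have m4 := hadm.memLp_mul_mul hh hη.laplacian
  set n1 := Real.sqrt (∫ x, (η x * (h x * ρ x)) ^ 2)
  set n2 := Real.sqrt (∫ x, (η x * (f x * ρ x)) ^ 2)
  set n3 : Fin N → ℝ := fun i => Real.sqrt (∫ x, (pd i η x * (h x * ρ x)) ^ 2)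
  set n4 := Real.sqrt (∫ x, (Laplacian.laplacian η x * (h x * ρ x)) ^ 2)
  have hn3 : ∀ i, 0 ≤ n3 i := fun i => Real.sqrt_nonneg _
  refine ⟨l * n1 + n2 + ∑ i, 2 * n3 i + n4 + ∑ i, n3 i, ?_, fun φ hφ hW hW' => ?_⟩
  · have := Finset.sum_nonneg fun i (_ : i ∈ Finset.univ) => hn3 i
    have := Finset.sum_nonneg fun i (_ : i ∈ Finset.univ) => mul_nonneg zero_le_two (hn3 i)
    positivity
  set E := Real.sqrt (energy l φ)
  have hφL := hφ.memLp 2 volume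
  have hE1 : Real.sqrt (∫ x, φ x ^ 2) ≤ E := Real.sqrt_le_sqrt (integral_sq_le_energy hl φ)
  have hE2 : ∀ i, Real.sqrt (∫ x, pd i φ x ^ 2) ≤ E := fun i =>
    Real.sqrt_le_sqrt (integral_pd_sq_le_energy hl φ i)
  set c : Fin N → Space N → ℝ := fun i =>
    (Metric.ball 0 a).indicator fun x => (ρ x)⁻¹ * G x i
  have hcle : ∀ i x, |c i x * φ x| ≤ |locWeight ρ G a x * φ x| := by
    intro i x
    rw [abs_mul, abs_mul]
    refine mul_le_mul_of_nonneg_right ?_ (abs_nonneg _)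
    by_cases hx : x ∈ Metric.ball (0 : Space N) a
    · simp only [c, Set.indicator_of_mem hx]
      exact (abs_apply_le_locWeight (mem_ball_zero_iff.1 hx) i).trans (le_abs_self _)
    · simp [c, Set.indicator_of_notMem hx]
  have hcm : ∀ i, AEStronglyMeasurable (c i) volume := fun i =>
    ((hadm.integrable.aestronglyMeasurable.aemeasurable.inv.mul
      (hadm.gradient_memLpLoc.comp_apply i).locallyIntegrable.aestronglyMeasurable.aemeasurable
      ).aestronglyMeasurable).indicator measurableSet_ball
  have hcL : ∀ i, MemLp (fun x => c i x * φ x) 2 volume := fun i =>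
    MemLp.of_le hW ((hcm i).mul hφ.continuous.aestronglyMeasurable)
      (Eventually.of_forall fun x => hcle i x)
  have hE3 : ∀ i, Real.sqrt (∫ x, (c i x * φ x) ^ 2) ≤ E := fun i => by
    refine Real.sqrt_le_sqrt ((integral_mono (integrable_sq_of_memLp (hcL i))
      (integrable_sq_of_memLp hW) fun x => sq_le_sq.2 (hcle i x)).trans (hW'.trans ?_))
    linarith [energy_nonneg hl φ]
  have hηφ : IsTest fun x => η x * φ x := hη.mul_right hφ.smooth
  have i1 := (integrable_mul_of_memLp hφL m1).const_mul l
  have i3 := fun i => (integrable_mul_of_memLp ((hφ.pd i).memLp 2 volume) (m3 i)).const_mul 2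
  have i4 := integrable_mul_of_memLp hφL m4
  have i5 := fun i => integrable_mul_of_memLp (hcL i) (m3 i)
  have s3 := integrable_finsetSum Finset.univ fun i _ => i3 i
  have s5 := integrable_finsetSum Finset.univ fun i _ => i5 i
  have j2 : Integrable fun x => diffExpr ρ G (fun y => η y * φ y) x * h x * ρ x := by
    have := integrable_mul_of_memLp (hadm.memLp_diffExpr hηφ) hh
    exact hadm.integrable_iff.1 this
  have e : ∀ x, (l * φ x - Laplacian.laplacian φ x - locDrift ρ G a φ x) *
      (η x * (h x * ρ x)) =
      (((l * (φ x * (η x * (h x * ρ x))) -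
        diffExpr ρ G (fun y => η y * φ y) x * h x * ρ x) +
        ∑ i, 2 * (pd i φ x * (pd i η x * (h x * ρ x)))) +
        φ x * (Laplacian.laplacian η x * (h x * ρ x))) +
        ∑ i, c i x * φ x * (pd i η x * (h x * ρ x)) := by
    intro x
    rw [diffExpr_mul hη.smooth hφ.smooth, diffExpr_eq η]
    rcases le_or_gt a ‖x‖ with hx | hx
    · simp [image_eq_zero_of_notMem_tsupport (hηa x hx), pd_eq_zero_of_notMem (hηa x hx),
        laplacian_eq_zero_of_notMem hη.smooth (hηa x hx)]
    · have hx' : x ∈ Metric.ball (0 : Space N) a := mem_ball_zero_iff.2 hx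
      have e1 : ∑ i, 2 * (pd i φ x * (pd i η x * (h x * ρ x))) =
          2 * (∑ i, pd i η x * pd i φ x) * (h x * ρ x) := by
        rw [Finset.mul_sum, Finset.sum_mul]
        exact Finset.sum_congr rfl fun i _ => by ring
      have e2 : ∑ i, c i x * φ x * (pd i η x * (h x * ρ x)) =
          (∑ i, (ρ x)⁻¹ * G x i * pd i η x) * (φ x * (h x * ρ x)) := by
        rw [Finset.sum_mul]
        refine Finset.sum_congr rfl fun i _ => ?_
        simp only [c, Set.indicator_of_mem hx']
        ring
      rw [e1, e2]
      simp only [locDrift, Set.indicator_of_mem hx', diffExpr]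
      ring
  have k1 : Integrable fun x => l * (φ x * (η x * (h x * ρ x))) -
      diffExpr ρ G (fun y => η y * φ y) x * h x * ρ x := i1.sub j2
  have k2 := k1.add s3
  have k3 := k2.add i4
  have hweak : ∫ x, diffExpr ρ G (fun y => η y * φ y) x * h x * ρ x =
      ∫ x, φ x * (η x * (f x * ρ x)) := by
    have := hw _ hηφ
    rw [hadm.integral_eq, hadm.integral_eq] at this
    rw [this]
    congr 1
    funext x
    ring
  have hA : ∫ x, (l * φ x - Laplacian.laplacian φ x - locDrift ρ G a φ x) *
      (η x * (h x * ρ x)) = l * (∫ x, φ x * (η x * (h x * ρ x))) -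
        (∫ x, φ x * (η x * (f x * ρ x))) +
        (∑ i, 2 * ∫ x, pd i φ x * (pd i η x * (h x * ρ x))) +
        (∫ x, φ x * (Laplacian.laplacian η x * (h x * ρ x))) +
        ∑ i, ∫ x, c i x * φ x * (pd i η x * (h x * ρ x)) := by
    simp only [e]
    refine (integral_add k3 s5).trans ?_
    rw [integral_finsetSum _ fun i _ => i5 i]
    congr 1
    refine (integral_add k2 i4).trans ?_
    congr 1
    refine (integral_add k1 s3).trans ?_
    rw [integral_finsetSum _ fun i _ => i3 i]
    simp only [integral_const_mul]
    rw [integral_sub i1 j2, integral_const_mul, hweak]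
  have b : ∀ {p q : Space N → ℝ} (hp : MemLp p 2 volume) (hq : MemLp q 2 volume),
      Real.sqrt (∫ x, p x ^ 2) ≤ E → |∫ x, p x * q x| ≤ Real.sqrt (∫ x, q x ^ 2) * E :=
    fun hp hq hpE => (abs_integral_mul_le hp hq).trans (by
      rw [mul_comm]; exact mul_le_mul_of_nonneg_left hpE (Real.sqrt_nonneg _))
  rw [hA]
  have b1 := b hφL m1 hE1
  have b2 := b hφL m2 hE1
  have b4 := b hφL m4 hE1
  have b3 : |∑ i, 2 * ∫ x, pd i φ x * (pd i η x * (h x * ρ x))| ≤ (∑ i, 2 * n3 i) * E := by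
    rw [Finset.sum_mul]
    refine (Finset.abs_sum_le_sum_abs _ _).trans (Finset.sum_le_sum fun i _ => ?_)
    rw [abs_mul, abs_two, mul_assoc]
    exact mul_le_mul_of_nonneg_left (b ((hφ.pd i).memLp 2 volume) (m3 i) (hE2 i)) zero_le_two
  have b5 : |∑ i, ∫ x, c i x * φ x * (pd i η x * (h x * ρ x))| ≤ (∑ i, n3 i) * E := by
    rw [Finset.sum_mul]
    exact (Finset.abs_sum_le_sum_abs _ _).trans
      (Finset.sum_le_sum fun i _ => b (hcL i) (m3 i) (hE3 i))
  have b1' : |l * ∫ x, φ x * (η x * (h x * ρ x))| ≤ l * (n1 * E) := by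
    rw [abs_mul, abs_of_nonneg (by linarith)]
    exact mul_le_mul_of_nonneg_left b1 (by linarith)
  refine (abs_add_le _ _).trans ?_
  refine (add_le_add_left ((abs_add_le _ _).trans (add_le_add_left ((abs_add_le _ _).trans
    (add_le_add_left (abs_sub _ _) _)) _)) _).trans ?_
  calc _ ≤ l * (n1 * E) + n2 * E + (∑ i, 2 * n3 i) * E + n4 * E + (∑ i, n3 i) * E := by
        gcongr
    _ = _ := by ring

/-- Weak solutions have a square integrable local gradient: the functional bound. -/
theorem IsAdmissible.exists_gradient_bound (hadm : IsAdmissible ρ G μ) {h f : Space N → ℝ}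
    (hh : MemLp h 2 μ) (hf : MemLp f 2 μ) (hw : IsWeakSolution ρ G μ h f)
    {η : Space N → ℝ} (hη : IsTest η) :
    ∃ C, 0 ≤ C ∧ ∀ ψ, IsTest ψ → ∀ i,
      |∫ x, η x * h x * pd i ψ x| ≤ C * Real.sqrt (∫ x, ψ x ^ 2) := by
  obtain ⟨a₀, ha₀, hηa₀⟩ := hη.exists_radius
  obtain ⟨ζ, hζ, hζ1, -⟩ := exists_cutoff (N := N) ha₀
  obtain ⟨a₁, ha₁, hζa₁⟩ := hζ.exists_radius
  -- The ball must contain the supports of both `η` and `ζ`, so that the localized drift is the true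
  -- one wherever either cutoff lives.
  set a := max a₀ a₁
  have hηa : ∀ x, a ≤ ‖x‖ → x ∉ tsupport η := fun x hx => hηa₀ x ((le_max_left _ _).trans hx)
  have hζa : ∀ x, a ≤ ‖x‖ → x ∉ tsupport ζ := fun x hx => hζa₁ x ((le_max_right _ _).trans hx)
  obtain ⟨l, hl, hlφ⟩ := hadm.exists_large a
  obtain ⟨C₁, hC₁, h1⟩ := hadm.exists_functional_bound hh hf hw hη hηa hl
  obtain ⟨C₂, hC₂, h2⟩ := hadm.exists_dual_bound hζ hζa
  refine ⟨2 * C₁ * C₂, by positivity, fun ψ hψ i => ?_⟩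
  have hv := hadm.memLp_mul_mul hh hη
  have hg : MemLp (fun x => ζ x * pd i ψ x / ρ x) 2 volume :=
    hadm.memLp_div (hζ.mul_right (hψ.pd i).smooth)
  set v : Space N → ℝ := fun x => η x * (h x * ρ x)
  set g : Space N → ℝ := fun x => ζ x * pd i ψ x / ρ x
  set s := Real.sqrt (∫ x, ψ x ^ 2)
  set n := Real.sqrt (∫ x, v x ^ 2)
  -- On the support of `η` the cutoff `ζ` is `1`, so dividing and multiplying by `ρ` is free; `g` is
  -- the right-hand side of the dual problem.
  have e : ∫ x, η x * h x * pd i ψ x = ∫ x, g x * v x := by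
    refine integral_congr_ae (hadm.pos.mono fun x hx => ?_)
    simp only [g, v]
    rcases le_or_gt a₀ ‖x‖ with hxa | hxa
    · simp [image_eq_zero_of_notMem_tsupport (hηa₀ x hxa)]
    · rw [hζ1 x hxa.le]
      field_simp
  rw [e]
  -- Test functions solve the dual equation only up to an `L²` error `δ`; the bound is uniform and
  -- `δ → 0` at the end.
  have key : ∀ δ : ℝ, 0 < δ → |∫ x, g x * v x| ≤ 2 * C₁ * C₂ * s + (2 * C₁ + n) * δ := by
    intro δ hδ
    obtain ⟨φ, hφ, hRL, hR⟩ := exists_approx_solution (a := a) (by linarith : 0 < l)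
      (fun φ hφ => ⟨(hlφ φ hφ).1, (hlφ φ hφ).2.1⟩) hg hδ
    obtain ⟨hD, -, hW, hW'⟩ := hlφ φ hφ
    set S : Space N → ℝ := fun x => l * φ x - Laplacian.laplacian φ x - locDrift ρ G a φ x
    set R : Space N → ℝ := fun x =>
      l * φ x - Laplacian.laplacian φ x - locDrift ρ G a φ x - g x
    have hφL := hφ.memLp 2 volume
    set E := Real.sqrt (energy l φ)
    have hE1 : Real.sqrt (∫ x, φ x ^ 2) ≤ E := Real.sqrt_le_sqrt (integral_sq_le_energy hl φ)
    have hEE : E * E = energy l φ := Real.mul_self_sqrt (energy_nonneg hl φ)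
    have hE0 : 0 ≤ E := Real.sqrt_nonneg _
    have c1 := energy_le hφ hD hW hW' hl
    have c2 : ∫ x, S x * φ x = (∫ x, g x * φ x) + ∫ x, R x * φ x := by
      rw [← integral_add (integrable_mul_of_memLp hg hφL) (integrable_mul_of_memLp hRL hφL)]
      congr 1
      funext x
      simp only [S, R]
      ring
    have c3 := h2 hl hφ hW hW' hψ i
    have c4 : |∫ x, R x * φ x| ≤ δ * E := (abs_integral_mul_le hRL hφL).trans (by gcongr)
    -- Coercivity gives `E² ≤ 2 ∫ (g + R) φ ≤ 2 (C₂ s + δ) E`, and one factor `E` is cancelled.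
    have c5 : E ≤ 2 * (C₂ * s + δ) := by
      have h3 : E * E ≤ 2 * (C₂ * s + δ) * E := by
        rw [hEE]
        refine c1.trans ?_
        rw [c2]
        linarith [le_abs_self (∫ x, g x * φ x), le_abs_self (∫ x, R x * φ x)]
      rcases hE0.eq_or_lt with h0 | h0
      · rw [← h0]; positivity
      · exact le_of_mul_le_mul_right h3 h0
    have hSL : MemLp S 2 volume := by
      have : S = fun x => R x + g x := by funext x; simp only [S, R]; ring
      rw [this]
      exact hRL.add hg
    have c6 : ∫ x, g x * v x = (∫ x, S x * v x) - ∫ x, R x * v x := by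
      rw [← integral_sub (integrable_mul_of_memLp hSL hv) (integrable_mul_of_memLp hRL hv)]
      congr 1
      funext x
      simp only [S, R]
      ring
    have c7 : |∫ x, S x * v x| ≤ C₁ * E := h1 φ hφ hW hW'
    have c8 : |∫ x, R x * v x| ≤ δ * n := (abs_integral_mul_le hRL hv).trans (by gcongr)
    rw [c6]
    refine (abs_sub _ _).trans ?_
    have c9 : C₁ * E ≤ C₁ * (2 * (C₂ * s + δ)) := by gcongr
    linarith
  have hlim : Tendsto (fun δ : ℝ => 2 * C₁ * C₂ * s + (2 * C₁ + n) * δ) (𝓝[>] 0)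
      (𝓝 (2 * C₁ * C₂ * s + (2 * C₁ + n) * 0)) := by
    refine Tendsto.mono_left ?_ nhdsWithin_le_nhds
    exact Continuous.tendsto (by fun_prop) 0
  rw [mul_zero, add_zero] at hlim
  exact ge_of_tendsto hlim (eventually_mem_nhdsWithin.mono key)

end WeakSolutions

/-! ### Representation of bounded functionals; weak derivatives. -/

section Riesz

/-- A functional bounded by the norm of a linear image is represented by a vector. -/
theorem exists_inner_eq {V H : Type*} [AddCommGroup V] [Module ℝ V] [NormedAddCommGroup H]
    [InnerProductSpace ℝ H] [CompleteSpace H] (T : V →ₗ[ℝ] H) (f : V →ₗ[ℝ] ℝ) {C : ℝ}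
    (h : ∀ v, |f v| ≤ C * ‖T v‖) : ∃ g : H, ∀ v, f v = inner ℝ g (T v) := by
  have hk : LinearMap.ker T ≤ LinearMap.ker f := fun v hv => by
    have := h v
    rw [LinearMap.mem_ker.1 hv, norm_zero, mul_zero] at this
    exact abs_eq_zero.1 (le_antisymm this (abs_nonneg _))
  -- The bound makes `f` vanish on the kernel of `T`, so it descends to the range; Hahn–Banach
  -- extends it to `H`, and Riesz represents it.
  let F : LinearMap.range T →ₗ[ℝ] ℝ :=
    ((LinearMap.ker T).liftQ f hk) ∘ₗ T.quotKerEquivRange.symm.toLinearMap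
  have hF : ∀ v, F ⟨T v, v, rfl⟩ = f v := fun v => by
    have e : T.quotKerEquivRange.symm ⟨T v, v, rfl⟩ = (LinearMap.ker T).mkQ v := by
      rw [LinearEquiv.symm_apply_eq]
      rfl
    simp [F, e]
  obtain ⟨g, hg, -⟩ := exists_extension_norm_eq _ (F.mkContinuous C (by
    rintro ⟨_, v, rfl⟩
    rw [hF]
    exact h v))
  refine ⟨(InnerProductSpace.toDual ℝ H).symm g, fun v => ?_⟩
  rw [InnerProductSpace.toDual_symm_apply, hg ⟨T v, v, rfl⟩]
  exact (hF v).symm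

variable {N : ℕ}

theorem exists_weak_derivative {u : Space N → ℝ} (hu : MemLp u 2 volume) {i : Fin N} {C : ℝ}
    (h : ∀ ψ, IsTest ψ → |∫ x, u x * pd i ψ x| ≤ C * Real.sqrt (∫ x, ψ x ^ 2)) :
    ∃ g, MemLp g 2 volume ∧ ∀ ψ, IsTest ψ → ∫ x, u x * pd i ψ x = -∫ x, g x * ψ x := by
  have hm : ∀ φ : testSpace N, MemLp ((testSpace N).subtype φ) 2 volume := fun φ =>
    (φ.2 : IsTest _).memLp 2 volume
  have hi : ∀ φ : testSpace N, Integrable fun x => u x * pd i (φ : Space N → ℝ) x := fun φ =>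
    integrable_mul_of_memLp hu (((φ.2 : IsTest _).pd i).memLp 2 volume)
  let f : testSpace N →ₗ[ℝ] ℝ :=
    { toFun := fun φ => ∫ x, u x * pd i (φ : Space N → ℝ) x
      map_add' := fun φ ψ => by
        rw [← integral_add (hi φ) (hi ψ)]
        congr 1
        funext x
        have := pd_add i ((φ.2 : IsTest _).differentiable x) ((ψ.2 : IsTest _).differentiable x)
        rw [← mul_add, ← this]
        rfl
      map_smul' := fun c φ => by
        rw [RingHom.id_apply, smul_eq_mul, ← integral_const_mul]
        congr 1
        funext x
        have : pd i ((c • φ : testSpace N) : Space N → ℝ) x = c * pd i (φ : Space N → ℝ) x := by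
          unfold pd
          rw [Submodule.coe_smul, fderiv_const_smul ((φ.2 : IsTest _).differentiable x)]
          rfl
        rw [this]
        ring }
  obtain ⟨g, hg⟩ := exists_inner_eq (testToLp _ hm) f (C := C) fun φ => by
    refine (h φ φ.2).trans (le_of_eq ?_)
    show _ = C * ‖(hm φ).toLp _‖
    rw [norm_toLp_eq_sqrt]
    rfl
  refine ⟨fun x => -g x, (Lp.memLp g).neg, fun ψ hψ => ?_⟩
  have h1 := hg ⟨ψ, hψ⟩
  have h2 := integral_mul_eq_inner (Lp.memLp g) (hm ⟨ψ, hψ⟩)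
  rw [Lp.toLp_coeFn] at h2
  simp only [neg_mul, integral_neg, neg_neg]
  exact h1.trans h2.symm

end Riesz

/-! ### First-order weak formulation, Caccioppoli estimate and vanishing mean. -/

section MeanZero

variable {N : ℕ} {ρ : Space N → ℝ} {G : Space N → Space N} {μ : Measure (Space N)}

theorem IsAdmissible.memLp_density_mul (h : IsAdmissible ρ G μ) {φ : Space N → ℝ}
    (hφ : IsTest φ) : MemLp (fun x => ρ x * φ x) 2 volume := by
  have := h.memLpLoc.mul_isTest hφ
  simpa only [mul_comm] using this

theorem IsAdmissible.memLp_gradient_mul (h : IsAdmissible ρ G μ) {φ : Space N → ℝ}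
    (hφ : IsTest φ) (i : Fin N) : MemLp (fun x => G x i * φ x) 2 volume := by
  have := (h.gradient_memLpLoc.comp_apply i).mul_isTest hφ
  simpa only [mul_comm] using this

theorem IsAdmissible.integral_divergence (h : IsAdmissible ρ G μ) {φ ψ : Space N → ℝ}
    (hφ : IsTest φ) (hψ : IsTest ψ) (i : Fin N) :
    ∫ x, (ρ x * pd i (pd i φ) x + G x i * pd i φ x) * ψ x =
      -∫ x, ρ x * pd i φ x * pd i ψ x := by
  have h1 := h.weak ((hφ.pd i).mul_right hψ.smooth) i
  have e : ∀ x, ρ x * pd i (fun y => pd i φ y * ψ y) x =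
      ρ x * pd i φ x * pd i ψ x + ρ x * pd i (pd i φ) x * ψ x := fun x => by
    rw [pd_mul i ((hφ.pd i).differentiable x) (hψ.differentiable x)]
    ring
  have i1 : Integrable fun x => ρ x * pd i φ x * pd i ψ x :=
    integrable_mul_of_memLp (h.memLp_density_mul (hφ.pd i)) ((hψ.pd i).memLp 2 volume)
  have i2 : Integrable fun x => ρ x * pd i (pd i φ) x * ψ x :=
    integrable_mul_of_memLp (h.memLp_density_mul ((hφ.pd i).pd i)) (hψ.memLp 2 volume)
  have i3 : Integrable fun x => G x i * pd i φ x * ψ x :=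
    integrable_mul_of_memLp (h.memLp_gradient_mul (hφ.pd i) i) (hψ.memLp 2 volume)
  simp only [e] at h1
  rw [integral_add i1 i2] at h1
  have h2 : ∫ x, G x i * (pd i φ x * ψ x) = ∫ x, G x i * pd i φ x * ψ x := by
    simp only [mul_assoc]
  rw [h2] at h1
  simp only [add_mul]
  rw [integral_add i2 i3]
  linarith

theorem IsAdmissible.diffExpr_mul_density (h : IsAdmissible ρ G μ) {φ : Space N → ℝ}
    (hφ : IsTest φ) (k : Space N → ℝ) : ∀ᵐ x, diffExpr ρ G φ x * k x * ρ x =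
      ∑ i, (ρ x * pd i (pd i φ) x + G x i * pd i φ x) * k x := by
  filter_upwards [h.pos] with x hx
  rw [diffExpr_eq, laplacian_eq_sum_pd hφ.smooth, ← Finset.sum_add_distrib, Finset.sum_mul,
    Finset.sum_mul]
  refine Finset.sum_congr rfl fun i _ => ?_
  field_simp

/-- Symmetry of the operator on test functions. -/
theorem IsAdmissible.integral_diffExpr_mul (h : IsAdmissible ρ G μ) {φ ψ : Space N → ℝ}
    (hφ : IsTest φ) (hψ : IsTest ψ) :
    ∫ x, diffExpr ρ G φ x * ψ x ∂μ = -∑ i, ∫ x, ρ x * pd i φ x * pd i ψ x := by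
  rw [h.integral_eq, integral_congr_ae (h.diffExpr_mul_density hφ ψ),
    integral_finsetSum, ← Finset.sum_neg_distrib]
  · exact Finset.sum_congr rfl fun i _ => h.integral_divergence hφ hψ i
  · intro i _
    exact integrable_mul_of_memLp ((h.memLp_density_mul ((hφ.pd i).pd i)).add
      (h.memLp_gradient_mul (hφ.pd i) i)) (hψ.memLp 2 volume)

/-- The first order weak formulation. -/
theorem IsAdmissible.integral_first_order (hadm : IsAdmissible ρ G μ) {h f u : Space N → ℝ}
    (hw : IsWeakSolution ρ G μ h f) (hu : MemLp u 2 volume) (huc : HasCompactSupport u)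
    {g : Fin N → Space N → ℝ} (hg : ∀ i, MemLp (g i) 2 volume)
    (hug : ∀ i ψ, IsTest ψ → ∫ x, u x * pd i ψ x = -∫ x, g i x * ψ x)
    {Φ : Space N → ℝ} (hΦ : IsTest Φ) (hΦu : ∀ x ∈ tsupport Φ, u x = h x) :
    ∫ x, Φ x * f x ∂μ = -∑ i, ∫ x, ρ x * pd i Φ x * g i x := by
  have hul : LocallyIntegrable u := hu.locallyIntegrable (by norm_num)
  have ht : ∀ m, IsTest (mollify m u) := fun m => isTest_mollify m hul huc
  have hL : ∀ i, MemLp (fun x => ρ x * pd i (pd i Φ) x + G x i * pd i Φ x) 2 volume := fun i =>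
    (hadm.memLp_density_mul ((hΦ.pd i).pd i)).add (hadm.memLp_gradient_mul (hΦ.pd i) i)
  -- The divergence identity is known for two test functions; it reaches `u` through mollifications,
  -- which converge in `L²` together with their derivatives.
  have key : ∀ i, ∫ x, (ρ x * pd i (pd i Φ) x + G x i * pd i Φ x) * u x =
      -∫ x, ρ x * pd i Φ x * g i x := by
    intro i
    have l1 := tendsto_integral_mul_const (fun m => (ht m).memLp 2 volume) hu (hL i)
      (tendsto_eLpNorm_mollify hu)
    have l2 := tendsto_integral_mul_const (fun m => memLp_mollify m (hg i)) (hg i)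
      (hadm.memLp_density_mul (hΦ.pd i)) (tendsto_eLpNorm_mollify (hg i))
    simp only [mul_comm (mollify _ _ _), mul_comm (u _), mul_comm (g i _)] at l1 l2
    refine tendsto_nhds_unique l1 (l2.neg.congr fun m => ?_)
    rw [hadm.integral_divergence hΦ (ht m) i, pd_mollify_of_weak m hul (hug i)]
  rw [← hw Φ hΦ, hadm.integral_eq]
  have e : ∀ᵐ x, diffExpr ρ G Φ x * h x * ρ x =
      ∑ i, (ρ x * pd i (pd i Φ) x + G x i * pd i Φ x) * u x := by
    filter_upwards [hadm.diffExpr_mul_density hΦ u] with x hx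
    rw [← hx]
    by_cases hxs : x ∈ tsupport Φ
    · rw [hΦu x hxs]
    · simp [diffExpr_eq, laplacian_eq_zero_of_notMem hΦ.smooth hxs, pd_eq_zero_of_notMem hxs]
  rw [integral_congr_ae e, integral_finsetSum _ fun i _ => integrable_mul_of_memLp (hL i) hu,
    ← Finset.sum_neg_distrib]
  exact Finset.sum_congr rfl fun i _ => key i

theorem IsAdmissible.memLp_density_mul_mul (h : IsAdmissible ρ G μ) {χ g : Space N → ℝ}
    (hχ : IsTest χ) (hg : MemLp g 2 volume) : MemLp (fun x => ρ x * χ x * g x) 2 volume := by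
  obtain ⟨a, -, hχa⟩ := hχ.exists_radius
  obtain ⟨M, hM, hMρ⟩ := h.exists_upper_bound a
  obtain ⟨C, hC0, hC⟩ := hχ.exists_bound
  refine MemLp.of_le_mul (c := M * C) hg ((h.integrable.aestronglyMeasurable.mul
    hχ.continuous.aestronglyMeasurable).mul hg.1) ?_
  filter_upwards [hMρ, h.nonneg] with x hx hx0
  rw [norm_mul, norm_mul, Real.norm_of_nonneg hx0]
  rcases le_or_gt a ‖x‖ with hxa | hxa
  · rw [image_eq_zero_of_notMem_tsupport (hχa x hxa)]
    simp only [norm_zero, mul_zero, zero_mul]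
    positivity
  · gcongr
    · exact hx hxa
    · exact hC x

theorem abs_integral_le_of_abs_le {α : Type*} [MeasurableSpace α] {ν : Measure α} {F k : α → ℝ}
    (hk : Integrable k ν) (h : ∀ᵐ x ∂ν, |F x| ≤ k x) : |∫ x, F x ∂ν| ≤ ∫ x, k x ∂ν := by
  rw [← Real.norm_eq_abs]
  exact norm_integral_le_of_norm_le hk h

theorem pd_sq_mul {χ φ : Space N → ℝ} (hχ : IsTest χ) (hφ : ContDiff ℝ ∞ φ) (i : Fin N)
    (x : Space N) : pd i (fun x => χ x * χ x * φ x) x =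
      χ x * χ x * pd i φ x + 2 * (χ x * pd i χ x) * φ x := by
  rw [pd_mul i ((hχ.mul_left hχ.smooth).differentiable x) (hφ.differentiable (by simp) x),
    pd_mul i (hχ.differentiable x) (hχ.differentiable x)]
  ring

/-- Caccioppoli-type estimate and its consequence for cutoff means. -/
theorem IsAdmissible.abs_integral_cutoff_le (hadm : IsAdmissible ρ G μ) {h f : Space N → ℝ}
    (hh : MemLp h 2 μ) (hf : MemLp f 2 μ) (hw : IsWeakSolution ρ G μ h f)
    {χ : Space N → ℝ} (hχ : IsTest χ) (hχ1 : ∀ x, |χ x| ≤ 1) {C ε : ℝ} (hε : 0 < ε) (hε1 : ε ≤ 1)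
    (hC : 0 ≤ C) (hχd : ∀ i x, |pd i χ x| ≤ C * ε) :
    |∫ x, χ x ^ 2 * f x ∂μ| ≤ ε * (2 * (∫ x, |h x * f x| ∂μ) + 4 * N * C ^ 2 * (∫ x, h x ^ 2 ∂μ) +
      N * C ^ 2 * ∫ x, ρ x) := by
  obtain ⟨a, ha, hχa⟩ := hχ.exists_radius
  obtain ⟨η, hη, hη1, -⟩ := exists_cutoff (N := N) ha
  obtain ⟨K, hK0, hK⟩ := hadm.exists_gradient_bound hh hf hw hη
  have hu : MemLp (fun x => η x * h x) 2 volume := hadm.memLp_mul hh hη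
  choose g hg hug using fun i => exists_weak_derivative hu (i := i) (C := K) fun ψ hψ => hK ψ hψ i
  set u : Space N → ℝ := fun x => η x * h x
  have huc : HasCompactSupport u := hη.compact.mul_right
  have huh : ∀ x ∈ tsupport χ, u x = h x := fun x hx => by
    have : ‖x‖ ≤ a := by
      by_contra hh
      exact hχa x (not_le.1 hh).le hx
    simp [u, hη1 x this]
  have hul : LocallyIntegrable u := hu.locallyIntegrable (by norm_num)
  have ht : ∀ m, IsTest (mollify m u) := fun m => isTest_mollify m hul huc
  have hχχ : IsTest fun x => χ x * χ x := hχ.mul_left hχ.smooth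
  have hχp : ∀ i, IsTest fun x => χ x * pd i χ x := fun i => hχ.mul_right (hχ.pd i).smooth
  have hsub : ∀ φ : Space N → ℝ, ∀ x ∈ tsupport (fun x => χ x * χ x * φ x), u x = h x := by
    intro φ x hx
    exact huh x (tsupport_mul_subset_left (tsupport_mul_subset_left hx))
  have hone := hadm.integral_first_order hw hu huc hg hug hχχ fun x hx =>
    huh x (tsupport_mul_subset_left hx)
  have a1 : ∀ i, MemLp (fun x => ρ x * (χ x * χ x) * g i x) 2 volume := fun i =>
    hadm.memLp_density_mul_mul hχχ (hg i)
  have a2 : ∀ i, MemLp (fun x => ρ x * (χ x * pd i χ x) * g i x) 2 volume := fun i =>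
    hadm.memLp_density_mul_mul (hχp i) (hg i)
  have a3 : MemLp (fun x => χ x * χ x * (f x * ρ x)) 2 volume := hadm.memLp_mul_mul hf hχχ
  -- The equation is tested with `χ² u`, realised as the limit of `χ²` times mollifications of `u`.
  have hen : ∫ x, u x * (χ x * χ x * (f x * ρ x)) =
      -∑ i, ((∫ x, g i x * (ρ x * (χ x * χ x) * g i x)) +
        2 * ∫ x, u x * (ρ x * (χ x * pd i χ x) * g i x)) := by
    have l1 := tendsto_integral_mul_const (fun m => (ht m).memLp 2 volume) hu a3
      (tendsto_eLpNorm_mollify hu)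
    have l2 := fun i => tendsto_integral_mul_const (fun m => memLp_mollify m (hg i)) (hg i)
      (a1 i) (tendsto_eLpNorm_mollify (hg i))
    have l3 := fun i => tendsto_integral_mul_const (fun m => (ht m).memLp 2 volume) hu (a2 i)
      (tendsto_eLpNorm_mollify hu)
    have l4 := (tendsto_finsetSum Finset.univ fun i _ => (l2 i).add ((l3 i).const_mul 2)).neg
    refine tendsto_nhds_unique l1 (l4.congr fun m => ?_)
    have e := hadm.integral_first_order hw hu huc hg hug (hχχ.mul_right (ht m).smooth)
      (hsub _)
    rw [hadm.integral_eq] at e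
    have e1 : ∫ x, mollify m u x * (χ x * χ x * (f x * ρ x)) =
        ∫ x, χ x * χ x * mollify m u x * f x * ρ x := by
      congr 1; funext x; ring
    rw [e1, e]
    congr 1
    refine Finset.sum_congr rfl fun i _ => ?_
    rw [← integral_const_mul, ← integral_add (integrable_mul_of_memLp (memLp_mollify m (hg i)) (a1 i))
      ((integrable_mul_of_memLp ((ht m).memLp 2 volume) (a2 i)).const_mul 2)]
    congr 1
    funext x
    rw [pd_sq_mul hχ (ht m).smooth, pd_mollify_of_weak m hul (hug i)]
    ring
  have hI : ∀ i, Integrable fun x => g i x * (ρ x * (χ x * χ x) * g i x) := fun i =>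
    integrable_mul_of_memLp (hg i) (a1 i)
  have hB : Integrable fun x => h x ^ 2 * ρ x := hadm.integrable_sq_mul hh
  have hA : Integrable fun x => |h x * f x| * ρ x :=
    hadm.integrable_iff.1 (integrable_mul_of_memLp hh hf).abs
  set A := ∫ x, |h x * f x| ∂μ with hAd
  set B := ∫ x, h x ^ 2 ∂μ with hBd
  rw [hadm.integral_eq] at hAd hBd
  set I : Fin N → ℝ := fun i => ∫ x, g i x * (ρ x * (χ x * χ x) * g i x)
  have b1 : |∫ x, u x * (χ x * χ x * (f x * ρ x))| ≤ A := by
    rw [hAd]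
    refine abs_integral_le_of_abs_le hA ?_
    filter_upwards [hadm.nonneg] with x hx
    by_cases hxs : x ∈ tsupport χ
    · rw [huh x hxs]
      calc |h x * (χ x * χ x * (f x * ρ x))| = |χ x| * |χ x| * (|h x * f x| * ρ x) := by
            simp only [abs_mul, abs_of_nonneg hx]; ring
        _ ≤ 1 * (|h x * f x| * ρ x) := by
            gcongr
            exact mul_le_one₀ (hχ1 x) (abs_nonneg _) (hχ1 x)
        _ = _ := one_mul _
    · rw [image_eq_zero_of_notMem_tsupport hxs]
      simp only [mul_zero, zero_mul, abs_zero]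
      positivity
  have hCε : C * ε ≤ C := mul_le_of_le_one_right hC hε1
  -- Young's inequality; only `|∂ᵢχ| ≤ C`, from `ε ≤ 1`, is used. The coefficient `1/2` lets `I i`
  -- be absorbed on the left in the next estimate.
  have b2 : ∀ i, |2 * ∫ x, u x * (ρ x * (χ x * pd i χ x) * g i x)| ≤
      1 / 2 * I i + 2 * C ^ 2 * B := by
    intro i
    have e : 1 / 2 * I i + 2 * C ^ 2 * B =
        ∫ x, (1 / 2 * (g i x * (ρ x * (χ x * χ x) * g i x)) + 2 * C ^ 2 * (h x ^ 2 * ρ x)) := by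
      rw [integral_add ((hI i).const_mul _) (hB.const_mul _), integral_const_mul,
        integral_const_mul, hBd]
    rw [e, ← integral_const_mul]
    refine abs_integral_le_of_abs_le (((hI i).const_mul (1 / 2)).add (hB.const_mul (2 * C ^ 2))) ?_
    filter_upwards [hadm.nonneg] with x hx
    by_cases hxs : x ∈ tsupport χ
    · rw [huh x hxs]
      have h2 := (hχd i x).trans hCε
      have h3 : pd i χ x ^ 2 ≤ C ^ 2 := sq_le_sq' (abs_le.1 h2).1 (abs_le.1 h2).2
      have h4 : |2 * (h x * (χ x * pd i χ x) * g i x)| ≤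
          1 / 2 * (χ x * g i x) ^ 2 + 2 * C ^ 2 * h x ^ 2 := by
        rw [abs_le]
        constructor
        · nlinarith [sq_nonneg (χ x * g i x + 2 * (pd i χ x * h x)),
            mul_le_mul_of_nonneg_right h3 (sq_nonneg (h x))]
        · nlinarith [sq_nonneg (χ x * g i x - 2 * (pd i χ x * h x)),
            mul_le_mul_of_nonneg_right h3 (sq_nonneg (h x))]
      have e1 : 2 * (h x * (ρ x * (χ x * pd i χ x) * g i x)) =
          2 * (h x * (χ x * pd i χ x) * g i x) * ρ x := by ring
      rw [e1, abs_mul, abs_of_nonneg hx]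
      refine (mul_le_mul_of_nonneg_right h4 hx).trans (le_of_eq ?_)
      ring
    · rw [image_eq_zero_of_notMem_tsupport hxs]
      simp only [mul_zero, zero_mul, abs_zero]
      positivity
  have b3 : ∑ i, I i ≤ 2 * A + 4 * N * C ^ 2 * B := by
    have h1 : ∑ i, I i = -(∫ x, u x * (χ x * χ x * (f x * ρ x))) -
        ∑ i, 2 * ∫ x, u x * (ρ x * (χ x * pd i χ x) * g i x) := by
      rw [hen, Finset.sum_add_distrib]
      ring
    have h2 : -∑ i, 2 * ∫ x, u x * (ρ x * (χ x * pd i χ x) * g i x) ≤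
        ∑ i, (1 / 2 * I i + 2 * C ^ 2 * B) := by
      rw [← Finset.sum_neg_distrib]
      exact Finset.sum_le_sum fun i _ => (neg_le_abs _).trans (b2 i)
    have h3 : ∑ i, (1 / 2 * I i + 2 * C ^ 2 * B) = 1 / 2 * ∑ i, I i + N * (2 * C ^ 2 * B) := by
      rw [Finset.sum_add_distrib, ← Finset.mul_sum, Finset.sum_const, Finset.card_univ,
        Fintype.card_fin, nsmul_eq_mul]
    rw [h3] at h2
    linarith [neg_le_abs (∫ x, u x * (χ x * χ x * (f x * ρ x)))]
  -- Now the test function is `χ²` alone, whose derivative `2χ ∂ᵢχ` is of size `ε`: this is the gain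
  -- over `b3`. The remaining `χ gᵢ` is absorbed by `I i` and the finite mass of `ρ`.
  have b4 : ∀ i, |∫ x, ρ x * pd i (fun x => χ x * χ x) x * g i x| ≤
      ε * (I i + C ^ 2 * ∫ x, ρ x) := by
    intro i
    have e : ε * (I i + C ^ 2 * ∫ x, ρ x) =
        ∫ x, ε * (g i x * (ρ x * (χ x * χ x) * g i x) + C ^ 2 * ρ x) := by
      rw [integral_const_mul, integral_add (hI i) (hadm.integrable.const_mul _),
        integral_const_mul]
    rw [e]
    refine abs_integral_le_of_abs_le
      (((hI i).add (hadm.integrable.const_mul _)).const_mul _) ?_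
    filter_upwards [hadm.nonneg] with x hx
    have e1 : ρ x * pd i (fun x => χ x * χ x) x * g i x =
        ρ x * (2 * (pd i χ x * (χ x * g i x))) := by
      rw [pd_mul i (hχ.differentiable x) (hχ.differentiable x)]
      ring
    rw [e1, abs_mul, abs_of_nonneg hx, abs_mul, abs_two, abs_mul]
    have h2 : 2 * (|pd i χ x| * |χ x * g i x|) ≤ ε * ((χ x * g i x) ^ 2 + C ^ 2) := by
      calc 2 * (|pd i χ x| * |χ x * g i x|) ≤ 2 * (C * ε * |χ x * g i x|) := by
            gcongr
            exact hχd i x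
        _ = ε * (2 * C * |χ x * g i x|) := by ring
        _ ≤ _ := by
            gcongr
            rw [← sq_abs (χ x * g i x)]
            nlinarith [sq_nonneg (C - |χ x * g i x|)]
    refine (mul_le_mul_of_nonneg_left h2 hx).trans (le_of_eq ?_)
    ring
  have e : ∫ x, χ x ^ 2 * f x ∂μ = ∫ x, χ x * χ x * f x ∂μ := by simp only [sq]
  rw [e, hone, abs_neg]
  refine (Finset.abs_sum_le_sum_abs _ _).trans ((Finset.sum_le_sum fun i _ => b4 i).trans ?_)
  rw [← Finset.mul_sum, Finset.sum_add_distrib, Finset.sum_const, Finset.card_univ,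
    Fintype.card_fin, nsmul_eq_mul]
  refine mul_le_mul_of_nonneg_left ?_ hε.le
  linarith

/-- The range of the operator consists, in the weak sense, of functions of mean zero. -/
theorem IsAdmissible.integral_eq_zero (hadm : IsAdmissible ρ G μ) {h f : Space N → ℝ}
    (hh : MemLp h 2 μ) (hf : MemLp f 2 μ) (hw : IsWeakSolution ρ G μ h f) (hfi : Integrable f μ) :
    ∫ x, f x ∂μ = 0 := by
  obtain ⟨χ, C, hC, hχ, hχ1, hχd, hχl⟩ := exists_cutoff_seq N
  have l1 := (tendsto_integral_cutoff hχ hχ1 hχl hfi).abs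
  have l2 := (tendsto_one_div_add_atTop_nhds_zero_nat (𝕜 := ℝ)).mul_const
    (2 * (∫ x, |h x * f x| ∂μ) + 4 * N * C ^ 2 * (∫ x, h x ^ 2 ∂μ) + N * C ^ 2 * ∫ x, ρ x)
  rw [zero_mul] at l2
  refine abs_eq_zero.1 (le_antisymm (le_of_tendsto_of_tendsto' l1 l2 fun n => ?_) (abs_nonneg _))
  refine hadm.abs_integral_cutoff_le hh hf hw (hχ n) (hχ1 n) (by positivity) ?_ hC fun i x => ?_
  · rw [div_le_one (by positivity)]
    linarith [(n.cast_nonneg : (0 : ℝ) ≤ n)]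
  · rw [mul_one_div]
    exact hχd n i x

end MeanZero

/-! ### Real and complex scalars; closability and density of the domain. -/

section Scalars

variable {𝕜 : Type*} [RCLike 𝕜] {N : ℕ} {ρ : Space N → ℝ} {G : Space N → Space N}
  {μ : Measure (Space N)}

/-- The coefficients are real, so real-linear maps commute with the expression; applied to `re`,
`im` and the inclusion of `ℝ`, it reduces `𝕜`-valued statements to real test functions. -/
theorem diffExpr_comp {𝕜' : Type*} [RCLike 𝕜'] (A : 𝕜 →L[ℝ] 𝕜') {φ : Space N → 𝕜}
    (hφ : ContDiff ℝ ∞ φ) (x : Space N) :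
    diffExpr ρ G (fun y => A (φ y)) x = A (diffExpr ρ G φ x) := by
  have h1 := (hφ.of_le (m := 2) (by norm_cast)).contDiffAt (x := x)
  have h2 := h1.laplacian_CLM_comp_left (l := A)
  have h3 : fderiv ℝ (fun y => A (φ y)) x = A ∘L fderiv ℝ φ x :=
    (A.hasFDerivAt.comp x (hφ.differentiable (by simp) x).hasFDerivAt).fderiv
  have h4 : Laplacian.laplacian (fun y => A (φ y)) x = A (Laplacian.laplacian φ x) := h2
  rw [diffExpr, diffExpr, h3, h4, map_add]
  rfl

theorem IsTest.re_comp {φ : Space N → 𝕜} (h1 : ContDiff ℝ ∞ φ) (h2 : HasCompactSupport φ) :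
    IsTest fun x => RCLike.re (φ x) :=
  ⟨(RCLike.reCLM (K := 𝕜)).contDiff.comp h1, h2.comp_left (g := RCLike.re) (by simp)⟩

theorem IsTest.im_comp {φ : Space N → 𝕜} (h1 : ContDiff ℝ ∞ φ) (h2 : HasCompactSupport φ) :
    IsTest fun x => RCLike.im (φ x) :=
  ⟨(RCLike.imCLM (K := 𝕜)).contDiff.comp h1, h2.comp_left (g := RCLike.im) (by simp)⟩

theorem re_diffExpr {φ : Space N → 𝕜} (hφ : ContDiff ℝ ∞ φ) (x : Space N) :
    RCLike.re (diffExpr ρ G φ x) = diffExpr ρ G (fun y => RCLike.re (φ y)) x :=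
  (diffExpr_comp (RCLike.reCLM (K := 𝕜)) hφ x).symm

theorem im_diffExpr {φ : Space N → 𝕜} (hφ : ContDiff ℝ ∞ φ) (x : Space N) :
    RCLike.im (diffExpr ρ G φ x) = diffExpr ρ G (fun y => RCLike.im (φ y)) x :=
  (diffExpr_comp (RCLike.imCLM (K := 𝕜)) hφ x).symm

/-- A real square integrable function as an element of `L²` with scalars `𝕜`. -/
noncomputable def coeLp (𝕜 : Type*) [RCLike 𝕜] {k : Space N → ℝ} (hk : MemLp k 2 μ) : Lp 𝕜 2 μ :=
  (hk.ofReal (K := 𝕜)).toLp fun x => (k x : 𝕜)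

theorem re_inner_coeLp {k : Space N → ℝ} (hk : MemLp k 2 μ) (f : Lp 𝕜 2 μ) :
    RCLike.re (inner 𝕜 (coeLp 𝕜 hk) f) = ∫ x, RCLike.re (f x) * k x ∂μ := by
  rw [L2.inner_def, ← integral_re (L2.integrable_inner _ f)]
  refine integral_congr_ae ?_
  filter_upwards [(hk.ofReal (K := 𝕜)).coeFn_toLp] with x hx
  rw [coeLp, hx]
  simp [RCLike.mul_re]

theorem im_inner_coeLp {k : Space N → ℝ} (hk : MemLp k 2 μ) (f : Lp 𝕜 2 μ) :
    RCLike.im (inner 𝕜 (coeLp 𝕜 hk) f) = ∫ x, RCLike.im (f x) * k x ∂μ := by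
  rw [L2.inner_def, ← integral_im (L2.integrable_inner _ f)]
  refine integral_congr_ae ?_
  filter_upwards [(hk.ofReal (K := 𝕜)).coeFn_toLp] with x hx
  rw [coeLp, hx]
  simp [RCLike.mul_im]

theorem IsAdmissible.coeLp_mem_minimalGraph (h : IsAdmissible ρ G μ) {φ : Space N → ℝ}
    (hφ : IsTest φ) : (coeLp 𝕜 (h.memLp_of_test hφ), coeLp 𝕜 (h.memLp_diffExpr hφ)) ∈
      minimalGraph 𝕜 ρ G μ := by
  refine ⟨fun x => (φ x : 𝕜), (RCLike.ofRealCLM (K := 𝕜)).contDiff.comp hφ.smooth,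
    hφ.compact.comp_left (g := fun r : ℝ => (r : 𝕜)) (by simp),
    (h.memLp_of_test hφ).ofReal.coeFn_toLp,
    ((h.memLp_diffExpr hφ).ofReal (K := 𝕜)).coeFn_toLp.trans (Eventually.of_forall fun x => ?_)⟩
  exact (diffExpr_comp (RCLike.ofRealCLM (K := 𝕜)) hφ.smooth x).symm

theorem IsAdmissible.ae_eq_zero_of_integral (h : IsAdmissible ρ G μ) {k : Space N → ℝ}
    (hk : MemLp k 2 μ) (h0 : ∀ ψ, IsTest ψ → ∫ x, k x * ψ x ∂μ = 0) : ∀ᵐ x ∂μ, k x = 0 := by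
  have hfin := h.isFiniteMeasure
  have hki : Integrable k μ := hk.integrable (by norm_num)
  have h1 : ∀ᵐ x, k x * ρ x = 0 := by
    refine ae_eq_zero_of_integral_contDiff_smul_eq_zero
      (h.integrable_iff.1 hki).locallyIntegrable fun ψ hs hc => ?_
    rw [← h0 ψ ⟨hs, hc⟩, h.integral_eq]
    congr 1
    funext x
    simp only [smul_eq_mul]
    ring
  refine h.absolutelyContinuous'.ae_le ?_
  filter_upwards [h1, h.pos] with x hx hx0
  exact (mul_eq_zero.1 hx).resolve_right hx0.ne'

theorem IsAdmissible.eq_zero_of_inner (h : IsAdmissible ρ G μ) {z : Lp 𝕜 2 μ}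
    (h0 : ∀ ψ (hψ : IsTest ψ), inner 𝕜 (coeLp 𝕜 (h.memLp_of_test hψ)) z = 0) : z = 0 := by
  have h1 := h.ae_eq_zero_of_integral (Lp.memLp z).re fun ψ hψ => by
    rw [← re_inner_coeLp (h.memLp_of_test hψ), h0 ψ hψ, map_zero]
  have h2 := h.ae_eq_zero_of_integral (Lp.memLp z).im fun ψ hψ => by
    rw [← im_inner_coeLp (h.memLp_of_test hψ), h0 ψ hψ, map_zero]
  rw [Lp.eq_zero_iff_ae_eq_zero]
  filter_upwards [h1, h2] with x hx1 hx2
  exact RCLike.ext (by simpa using hx1) (by simpa using hx2)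

/-- Symmetry of the operator, tested with real functions, on the closure of its graph. -/
theorem IsAdmissible.inner_closure (h : IsAdmissible ρ G μ) {p : Lp 𝕜 2 μ × Lp 𝕜 2 μ}
    (hp : p ∈ closure (minimalGraph 𝕜 ρ G μ : Set (Lp 𝕜 2 μ × Lp 𝕜 2 μ)))
    {ψ : Space N → ℝ} (hψ : IsTest ψ) :
    inner 𝕜 (coeLp 𝕜 (h.memLp_of_test hψ)) p.2 = inner 𝕜 (coeLp 𝕜 (h.memLp_diffExpr hψ)) p.1 := by
  have hc : IsClosed {p : Lp 𝕜 2 μ × Lp 𝕜 2 μ | inner 𝕜 (coeLp 𝕜 (h.memLp_of_test hψ)) p.2 =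
      inner 𝕜 (coeLp 𝕜 (h.memLp_diffExpr hψ)) p.1} :=
    isClosed_eq (by fun_prop) (by fun_prop)
  refine hc.closure_subset_iff.2 ?_ hp
  have key : ∀ {φ : Space N → ℝ}, IsTest φ →
      ∫ x, diffExpr ρ G φ x * ψ x ∂μ = ∫ x, φ x * diffExpr ρ G ψ x ∂μ := by
    intro φ hφ
    have h1 := h.integral_diffExpr_mul hψ hφ
    simp only [mul_comm (diffExpr ρ G ψ _)] at h1
    rw [h1, h.integral_diffExpr_mul hφ hψ]
    simp only [mul_right_comm]
  rintro ⟨u, w⟩ ⟨φ, hs, hcs, hu, hw⟩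
  refine RCLike.ext ?_ ?_
  · rw [re_inner_coeLp, re_inner_coeLp]
    have e1 : ∫ x, RCLike.re (w x) * ψ x ∂μ =
        ∫ x, diffExpr ρ G (fun y => RCLike.re (φ y)) x * ψ x ∂μ :=
      integral_congr_ae (hw.mono fun x hx => by
        simp only [← re_diffExpr hs]; exact congrArg (fun z => RCLike.re z * ψ x) hx)
    have e2 : ∫ x, RCLike.re (u x) * diffExpr ρ G ψ x ∂μ =
        ∫ x, RCLike.re (φ x) * diffExpr ρ G ψ x ∂μ :=
      integral_congr_ae (hu.mono fun x hx =>
        congrArg (fun z => RCLike.re z * diffExpr ρ G ψ x) hx)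
    exact e1.trans ((key (IsTest.re_comp hs hcs)).trans e2.symm)
  · rw [im_inner_coeLp, im_inner_coeLp]
    have e1 : ∫ x, RCLike.im (w x) * ψ x ∂μ =
        ∫ x, diffExpr ρ G (fun y => RCLike.im (φ y)) x * ψ x ∂μ :=
      integral_congr_ae (hw.mono fun x hx => by
        simp only [← im_diffExpr hs]; exact congrArg (fun z => RCLike.im z * ψ x) hx)
    have e2 : ∫ x, RCLike.im (u x) * diffExpr ρ G ψ x ∂μ =
        ∫ x, RCLike.im (φ x) * diffExpr ρ G ψ x ∂μ :=
      integral_congr_ae (hu.mono fun x hx =>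
        congrArg (fun z => RCLike.im z * diffExpr ρ G ψ x) hx)
    exact e1.trans ((key (IsTest.im_comp hs hcs)).trans e2.symm)

/-- Symmetry on the closure makes `p.2` orthogonal to every real test function. This is closability.
-/
theorem IsAdmissible.snd_eq_zero (h : IsAdmissible ρ G μ) {p : Lp 𝕜 2 μ × Lp 𝕜 2 μ}
    (hp : p ∈ closure (minimalGraph 𝕜 ρ G μ : Set (Lp 𝕜 2 μ × Lp 𝕜 2 μ))) (h0 : p.1 = 0) :
    p.2 = 0 :=
  h.eq_zero_of_inner fun ψ hψ => by rw [h.inner_closure hp hψ, h0, inner_zero_right]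

theorem IsAdmissible.minimalOperator_graph (h : IsAdmissible ρ G μ) :
    (minimalOperator 𝕜 ρ G μ).graph = minimalGraph 𝕜 ρ G μ :=
  Submodule.toLinearPMap_graph_eq _ fun _ hx hx' => h.snd_eq_zero (subset_closure hx) hx'

theorem IsAdmissible.isClosable (h : IsAdmissible ρ G μ) :
    (minimalOperator 𝕜 ρ G μ).IsClosable := by
  refine ⟨(minimalGraph 𝕜 ρ G μ).topologicalClosure.toLinearPMap, ?_⟩
  rw [h.minimalOperator_graph, Submodule.toLinearPMap_graph_eq]
  intro p hp hp'
  exact h.snd_eq_zero hp hp'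

theorem IsAdmissible.mem_graph_iff (h : IsAdmissible ρ G μ) {p : Lp 𝕜 2 μ × Lp 𝕜 2 μ} :
    p ∈ (kolmogorovOperator 𝕜 ρ G μ).graph ↔
      p ∈ closure (minimalGraph 𝕜 ρ G μ : Set (Lp 𝕜 2 μ × Lp 𝕜 2 μ)) := by
  rw [kolmogorovOperator, ← (h.isClosable (𝕜 := 𝕜)).graph_closure_eq_closure_graph,
    h.minimalOperator_graph]
  rfl

theorem IsAdmissible.isClosed_kolmogorovOperator (h : IsAdmissible ρ G μ) :
    (kolmogorovOperator 𝕜 ρ G μ).IsClosed := h.isClosable.closure_isClosed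

theorem IsAdmissible.dense_domain (h : IsAdmissible ρ G μ) :
    Dense ((kolmogorovOperator 𝕜 ρ G μ).domain : Set (Lp 𝕜 2 μ)) := by
  rw [Submodule.dense_iff_topologicalClosure_eq_top, Submodule.topologicalClosure_eq_top_iff,
    Submodule.eq_bot_iff]
  intro z hz
  refine h.eq_zero_of_inner fun ψ hψ => (Submodule.mem_orthogonal _ _).1 hz _ ?_
  have h1 := h.mem_graph_iff.2 (subset_closure (h.coeLp_mem_minimalGraph (𝕜 := 𝕜) hψ))
  exact LinearPMap.mem_domain_of_mem_graph h1

end Scalars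

/-! ### The kernel consists of constants. -/

section Kernel

variable {𝕜 : Type*} [RCLike 𝕜] {N : ℕ} {ρ : Space N → ℝ} {G : Space N → Space N}
  {μ : Measure (Space N)}

/-- A locally integrable function with vanishing weak gradient is constant. -/
theorem exists_const_of_weak_gradient_eq_zero {v : Space N → ℝ} (hv : LocallyIntegrable v)
    (h : ∀ i ψ, IsTest ψ → ∫ x, v x * pd i ψ x = 0) : ∃ c : ℝ, ∀ᵐ x, v x = c := by
  have h1 : ∀ n, ∃ c : ℝ, ∀ x, mollify n v x = c := fun n => by
    refine ⟨mollify n v 0, fun x => ?_⟩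
    refine is_const_of_fderiv_eq_zero (𝕜 := ℝ) ((contDiff_mollify n hv).differentiable (by simp))
      (fun y => ?_) x 0
    have h2 : ∀ i, pd i (mollify n v) y = 0 := fun i => by
      rw [pd_mollify_of_weak n hv (g := fun _ => 0) fun ψ hψ => by simpa using h i ψ hψ]
      simp [mollify]
    ext w
    rw [fderiv_eq_sum_pd]
    simp [h2]
  choose c hc using h1
  have h3 : ∀ᵐ x, Tendsto (fun n => mollify n v x) atTop (𝓝 (v x)) := by
    refine ContDiffBump.ae_convolution_tendsto_right_of_locallyIntegrable (φ := bump N) (K := 2)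
      ?_ (Eventually.of_forall fun n => ?_) hv
    · exact tendsto_one_div_add_atTop_nhds_zero_nat
    -- Almost everywhere convergence needs the outer radius of the bumps bounded by a fixed multiple
    -- of the inner one; here `K = 2` works.
    · show 1 / ((n : ℝ) + 1) ≤ 2 * (1 / ((n : ℝ) + 2))
      rw [mul_one_div, div_le_div_iff₀ (by positivity) (by positivity)]
      linarith [(n.cast_nonneg : (0 : ℝ) ≤ n)]
  simp only [hc] at h3
  obtain ⟨x₀, hx₀⟩ := h3.exists
  exact ⟨v x₀, h3.mono fun x hx => tendsto_nhds_unique hx hx₀⟩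

theorem IsAdmissible.memLp_div_measure (h : IsAdmissible ρ G μ) {ψ : Space N → ℝ}
    (hψ : IsTest ψ) : MemLp (fun x => ψ x / ρ x) 2 μ := by
  have := h.isFiniteMeasure
  obtain ⟨a, -, hψa⟩ := hψ.exists_radius
  obtain ⟨c, hc, hcρ⟩ := h.exists_lower_bound a
  obtain ⟨C, hC0, hC⟩ := hψ.exists_bound
  have hm : AEStronglyMeasurable (fun x => ψ x / ρ x) volume :=
    (hψ.continuous.measurable.aemeasurable.div
      h.integrable.aestronglyMeasurable.aemeasurable).aestronglyMeasurable
  refine MemLp.of_bound (hm.mono_ac h.absolutelyContinuous') (C / c)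
    (h.absolutelyContinuous'.ae_le ?_)
  filter_upwards [hcρ] with x hx
  rcases le_or_gt a ‖x‖ with hxa | hxa
  · rw [image_eq_zero_of_notMem_tsupport (hψa x hxa)]
    simp only [zero_div, norm_zero]
    positivity
  · have h1 := hx hxa.le
    rw [norm_div, Real.norm_of_nonneg (hc.le.trans h1)]
    gcongr
    exact hC x

theorem IsAdmissible.integral_mul_div (h : IsAdmissible ρ G μ) (k ψ : Space N → ℝ) :
    ∫ x, k x * (ψ x / ρ x) ∂μ = ∫ x, k x * ψ x := by
  rw [h.integral_eq]
  refine integral_congr_ae (h.pos.mono fun x hx => ?_)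
  field_simp

theorem IsAdmissible.locallyIntegrable (h : IsAdmissible ρ G μ) {k : Space N → ℝ}
    (hk : MemLp k 2 μ) : LocallyIntegrable k := by
  have := h.isFiniteMeasure
  have hki : Integrable k μ := hk.integrable (by norm_num)
  rw [locallyIntegrable_iff]
  intro K hK
  obtain ⟨c, hc, hcρ⟩ := h.locally_bounded_below K hK
  refine (((h.integrable_iff.1 hki).norm.const_mul c⁻¹).restrict (s := K)).mono'
    (h.aestronglyMeasurable hk).restrict ?_
  filter_upwards [hcρ] with x hx
  rw [norm_mul, Real.norm_of_nonneg (hc.le.trans hx)]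
  have : 1 ≤ c⁻¹ * ρ x := by rw [inv_mul_eq_div, le_div_iff₀ hc]; linarith
  calc ‖k x‖ = ‖k x‖ * 1 := (mul_one _).symm
    _ ≤ ‖k x‖ * (c⁻¹ * ρ x) := by gcongr
    _ = _ := by ring

theorem sqrt_integral_re_sq_le (f : Lp 𝕜 2 μ) :
    Real.sqrt (∫ x, RCLike.re (f x) ^ 2 ∂μ) ≤ ‖f‖ := by
  have hm : MemLp (fun x => RCLike.re (f x)) 2 μ := (Lp.memLp f).re
  rw [← norm_toLp_eq_sqrt hm, Lp.norm_def, Lp.norm_def]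
  refine ENNReal.toReal_mono (Lp.eLpNorm_ne_top f) ?_
  refine eLpNorm_mono_ae (hm.coeFn_toLp.mono fun x hx => ?_)
  rw [hx]
  exact RCLike.norm_re_le_norm _

theorem IsAdmissible.integral_pd_sq_le (h : IsAdmissible ρ G μ) {r : Space N → ℝ} (hr : IsTest r)
    (i : Fin N) : ∫ x, pd i r x ^ 2 ∂μ ≤
      Real.sqrt (∫ x, diffExpr ρ G r x ^ 2 ∂μ) * Real.sqrt (∫ x, r x ^ 2 ∂μ) := by
  have h1 := h.integral_diffExpr_mul hr hr
  have h2 : ∀ i, ∫ x, ρ x * pd i r x * pd i r x = ∫ x, pd i r x ^ 2 ∂μ := fun i => by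
    rw [h.integral_eq]
    congr 1
    funext x
    ring
  simp only [h2] at h1
  have h3 : ∫ x, pd i r x ^ 2 ∂μ ≤ ∑ i, ∫ x, pd i r x ^ 2 ∂μ :=
    Finset.single_le_sum (f := fun i => ∫ x, pd i r x ^ 2 ∂μ) (fun _ _ => integral_sq_nonneg _)
      (Finset.mem_univ i)
  have h4 := abs_integral_mul_le (h.memLp_diffExpr hr) (h.memLp_of_test hr)
  rw [h1, abs_neg] at h4
  exact h3.trans ((le_abs_self _).trans h4)

/-- The bound `∫ |∂ᵢr|² dμ ≤ ‖Lr‖ ‖r‖` involves a derivative of `r`; moved onto `ψ` and paired with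
`∂ᵢψ/ρ`, it becomes a closed condition on `(u, Lu)` in `L²_μ`. At `Lu = 0` it annihilates the weak
gradient. -/
theorem IsAdmissible.sq_inner_pd_le (h : IsAdmissible ρ G μ) {p : Lp 𝕜 2 μ × Lp 𝕜 2 μ}
    (hp : p ∈ closure (minimalGraph 𝕜 ρ G μ : Set (Lp 𝕜 2 μ × Lp 𝕜 2 μ)))
    {ψ : Space N → ℝ} (hψ : IsTest ψ) (i : Fin N) :
    RCLike.re (inner 𝕜 (coeLp 𝕜 (h.memLp_div_measure (hψ.pd i))) p.1) ^ 2 ≤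
      ‖p.2‖ * ‖p.1‖ * ∫ x, (ψ x / ρ x) ^ 2 ∂μ := by
  have hc : IsClosed {p : Lp 𝕜 2 μ × Lp 𝕜 2 μ |
      RCLike.re (inner 𝕜 (coeLp 𝕜 (h.memLp_div_measure (hψ.pd i))) p.1) ^ 2 ≤
        ‖p.2‖ * ‖p.1‖ * ∫ x, (ψ x / ρ x) ^ 2 ∂μ} := by
    refine isClosed_le ((RCLike.continuous_re.comp ?_).pow 2) (by fun_prop)
    fun_prop
  refine hc.closure_subset_iff.2 ?_ hp
  rintro ⟨u, w⟩ ⟨φ, hs, hcs, hu, hw⟩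
  have hr : IsTest fun x => RCLike.re (φ x) := IsTest.re_comp hs hcs
  have e1 : ∫ x, RCLike.re (u x) * (pd i ψ x / ρ x) ∂μ =
      -∫ x, pd i (fun y => RCLike.re (φ y)) x * (ψ x / ρ x) ∂μ := by
    have : ∫ x, RCLike.re (u x) * (pd i ψ x / ρ x) ∂μ =
        ∫ x, RCLike.re (φ x) * (pd i ψ x / ρ x) ∂μ :=
      integral_congr_ae (hu.mono fun x hx =>
        congrArg (fun z => RCLike.re z * (pd i ψ x / ρ x)) hx)
    rw [this, h.integral_mul_div, h.integral_mul_div, hψ.integral_mul_pd hr.smooth]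
  have e2 : ∫ x, diffExpr ρ G (fun y => RCLike.re (φ y)) x ^ 2 ∂μ =
      ∫ x, RCLike.re (w x) ^ 2 ∂μ :=
    integral_congr_ae (hw.mono fun x hx => by
      simp only [← re_diffExpr hs]
      exact (congrArg (fun z => RCLike.re z ^ 2) hx).symm)
  have e3 : ∫ x, RCLike.re (φ x) ^ 2 ∂μ = ∫ x, RCLike.re (u x) ^ 2 ∂μ :=
    integral_congr_ae (hu.mono fun x hx => (congrArg (fun z => RCLike.re z ^ 2) hx).symm)
  have h1 := h.integral_pd_sq_le hr i
  rw [e2, e3] at h1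
  have h2 := abs_integral_mul_le (h.memLp_of_test (hr.pd i)) (h.memLp_div_measure hψ)
  have h3 := pow_le_pow_left₀ (abs_nonneg _) h2 2
  rw [mul_pow, Real.sq_sqrt (integral_sq_nonneg _), Real.sq_sqrt (integral_sq_nonneg _),
    sq_abs] at h3
  show RCLike.re (inner 𝕜 (coeLp 𝕜 (h.memLp_div_measure (hψ.pd i))) u) ^ 2 ≤ _
  rw [re_inner_coeLp, e1, neg_sq]
  refine h3.trans (mul_le_mul_of_nonneg_right (h1.trans ?_) (integral_sq_nonneg _))
  exact mul_le_mul (sqrt_integral_re_sq_le w) (sqrt_integral_re_sq_le u) (Real.sqrt_nonneg _)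
    (norm_nonneg _)

theorem IsAdmissible.exists_re_const (h : IsAdmissible ρ G μ) {u : Lp 𝕜 2 μ}
    (hu : (u, 0) ∈ closure (minimalGraph 𝕜 ρ G μ : Set (Lp 𝕜 2 μ × Lp 𝕜 2 μ))) :
    ∃ c : ℝ, ∀ᵐ x ∂μ, RCLike.re (u x) = c := by
  have hm : MemLp (fun x => RCLike.re (u x)) 2 μ := (Lp.memLp u).re
  obtain ⟨c, hc⟩ := exists_const_of_weak_gradient_eq_zero (h.locallyIntegrable hm)
    fun i ψ hψ => by
      have h1 := h.sq_inner_pd_le hu hψ i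
      rw [norm_zero, zero_mul, zero_mul, re_inner_coeLp, h.integral_mul_div] at h1
      exact pow_eq_zero_iff two_ne_zero |>.1 (le_antisymm h1 (sq_nonneg _))
  exact ⟨c, h.absolutelyContinuous'.ae_le hc⟩

/-- The kernel of the closed operator consists of the constants. -/
theorem IsAdmissible.exists_eq_const (h : IsAdmissible ρ G μ) [IsFiniteMeasure μ] {u : Lp 𝕜 2 μ}
    (hu : (u, 0) ∈ (kolmogorovOperator 𝕜 ρ G μ).graph) :
    ∃ c : 𝕜, u = c • (Lp.const 2 μ (1 : 𝕜)) := by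
  rw [h.mem_graph_iff] at hu
  obtain ⟨a, ha⟩ := h.exists_re_const hu
  -- The real part of `I • u` is `-im u`, also when `I = 0`, so the imaginary part is covered by the
  -- same lemma.
  have hu' : ((RCLike.I : 𝕜) • u, 0) ∈
      closure (minimalGraph 𝕜 ρ G μ : Set (Lp 𝕜 2 μ × Lp 𝕜 2 μ)) := by
    have h1 := (minimalGraph 𝕜 ρ G μ).topologicalClosure.smul_mem (RCLike.I : 𝕜) hu
    rw [Prod.smul_mk, smul_zero] at h1
    exact h1
  obtain ⟨b, hb⟩ := h.exists_re_const hu'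
  refine ⟨(a : 𝕜) + ((-b : ℝ) : 𝕜) * RCLike.I, ?_⟩
  refine Lp.ext ?_
  filter_upwards [ha, hb, Lp.coeFn_smul (RCLike.I : 𝕜) u, Lp.coeFn_const (p := 2) (μ := μ) (1 : 𝕜),
    Lp.coeFn_smul ((a : 𝕜) + ((-b : ℝ) : 𝕜) * RCLike.I) (Lp.const 2 μ (1 : 𝕜))]
    with x h1 h2 h3 h4 h5
  rw [h3, Pi.smul_apply, smul_eq_mul, RCLike.I_mul_re] at h2
  rw [h5, Pi.smul_apply, h4, Function.const_apply, smul_eq_mul, mul_one, ← h1, ← h2, neg_neg]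
  exact (RCLike.re_add_im _).symm

end Kernel

/-! ### The constants lie in the domain. -/

section ConstantMem

variable {𝕜 : Type*} [RCLike 𝕜] {N : ℕ} {ρ : Space N → ℝ} {G : Space N → Space N}
  {μ : Measure (Space N)}

/-- Membership in the closure of a subspace of a product of Hilbert spaces, by duality. -/
theorem mem_closure_of_inner {H : Type*} [NormedAddCommGroup H] [InnerProductSpace 𝕜 H]
    [CompleteSpace H] {M : Submodule 𝕜 (H × H)} {q : H × H}
    (h : ∀ a b : H, (∀ p ∈ M, inner 𝕜 a p.1 + inner 𝕜 b p.2 = 0) →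
      inner 𝕜 a q.1 + inner 𝕜 b q.2 = 0) : q ∈ closure (M : Set (H × H)) := by
  by_contra hq
  have hcl : IsClosed (M.topologicalClosure : Set (H × H)) := M.isClosed_topologicalClosure
  have hq0 : ‖M.topologicalClosure.mkQL q‖ ≠ 0 := by
    rw [norm_ne_zero_iff]
    intro h0
    rw [Submodule.mkQL_apply, Submodule.mkQ_apply, Submodule.Quotient.mk_eq_zero] at h0
    exact hq h0
  -- The product carries the sup norm, so in place of an orthogonal projection a functional on the
  -- quotient by the closure separates `q`; Riesz is applied in each factor.
  obtain ⟨g, -, hg⟩ := exists_dual_vector 𝕜 _ hq0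
  let f : StrongDual 𝕜 (H × H) := g.comp M.topologicalClosure.mkQL
  let a := (InnerProductSpace.toDual 𝕜 H).symm (f.comp (ContinuousLinearMap.inl 𝕜 H H))
  let b := (InnerProductSpace.toDual 𝕜 H).symm (f.comp (ContinuousLinearMap.inr 𝕜 H H))
  have hf : ∀ p, inner 𝕜 a p.1 + inner 𝕜 b p.2 = f p := fun p => by
    rw [InnerProductSpace.toDual_symm_apply, InnerProductSpace.toDual_symm_apply]
    show f (p.1, 0) + f (0, p.2) = f p
    rw [← map_add, Prod.mk_add_mk, add_zero, zero_add]
  have h1 := h a b fun p hp => by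
    rw [hf]
    have : M.topologicalClosure.mkQL p = 0 := by
      rw [Submodule.mkQL_apply, Submodule.mkQ_apply, Submodule.Quotient.mk_eq_zero]
      exact M.le_topologicalClosure hp
    show g (M.topologicalClosure.mkQL p) = 0
    rw [this, map_zero]
  rw [hf] at h1
  have h2 : f q = (‖M.topologicalClosure.mkQL q‖ : 𝕜) := hg
  rw [h1] at h2
  exact hq0 (by exact_mod_cast h2.symm)

/-- The constants belong to the kernel of the closed operator. -/
theorem IsAdmissible.const_mem_graph (h : IsAdmissible ρ G μ) [IsFiniteMeasure μ] :
    (Lp.const 2 μ (1 : 𝕜), 0) ∈ (kolmogorovOperator 𝕜 ρ G μ).graph := by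
  rw [h.mem_graph_iff]
  refine mem_closure_of_inner fun a b hab => ?_
  -- A pair `(a, b)` annihilating the minimal graph says that `b` solves `Lb = -a` weakly.
  -- Annihilating `(1, 0)` means `∫ a dμ = 0`, which is `IsAdmissible.integral_eq_zero` on real and
  -- imaginary parts.
  have h1 : ∀ ψ (hψ : IsTest ψ), inner 𝕜 (coeLp 𝕜 (h.memLp_diffExpr hψ)) b =
      -inner 𝕜 (coeLp 𝕜 (h.memLp_of_test hψ)) a := fun ψ hψ => by
    have h2 := congrArg (starRingEnd 𝕜) (hab _ (h.coeLp_mem_minimalGraph hψ))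
    rw [map_add, inner_conj_symm, inner_conj_symm, map_zero] at h2
    exact eq_neg_of_add_eq_zero_right h2
  have hwr : IsWeakSolution ρ G μ (fun x => RCLike.re (b x)) fun x => -RCLike.re (a x) := by
    intro ψ hψ
    have h2 := congrArg RCLike.re (h1 ψ hψ)
    rw [map_neg, re_inner_coeLp, re_inner_coeLp] at h2
    simp only [neg_mul, integral_neg, mul_comm (diffExpr _ _ _ _), mul_comm (ψ _)]
    exact h2
  have hwi : IsWeakSolution ρ G μ (fun x => RCLike.im (b x)) fun x => -RCLike.im (a x) := by
    intro ψ hψ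
    have h2 := congrArg RCLike.im (h1 ψ hψ)
    rw [map_neg, im_inner_coeLp, im_inner_coeLp] at h2
    simp only [neg_mul, integral_neg, mul_comm (diffExpr _ _ _ _), mul_comm (ψ _)]
    exact h2
  have har : MemLp (fun x => RCLike.re (a x)) 2 μ := (Lp.memLp a).re
  have hai : MemLp (fun x => RCLike.im (a x)) 2 μ := (Lp.memLp a).im
  have z1 := h.integral_eq_zero (Lp.memLp b).re har.neg hwr
    (har.integrable (by norm_num)).neg
  have z2 := h.integral_eq_zero (Lp.memLp b).im hai.neg hwi
    (hai.integrable (by norm_num)).neg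
  simp only [Pi.neg_apply, integral_neg, neg_eq_zero] at z1 z2
  have hone : MemLp (fun _ : Space N => (1 : ℝ)) 2 μ := memLp_const 1
  have e : coeLp 𝕜 hone = Lp.const 2 μ (1 : 𝕜) := by
    refine Lp.ext ?_
    filter_upwards [(hone.ofReal (K := 𝕜)).coeFn_toLp, Lp.coeFn_const (p := 2) (μ := μ) (1 : 𝕜)]
      with x hx1 hx2
    rw [hx2, coeLp, hx1]
    simp
  rw [inner_zero_right, add_zero, ← inner_conj_symm, ← e]
  have : inner 𝕜 (coeLp 𝕜 hone) a = 0 := by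
    refine RCLike.ext ?_ ?_
    · rw [re_inner_coeLp, map_zero]
      simpa using z1
    · rw [im_inner_coeLp, map_zero]
      simpa using z2
  rw [this, map_zero]

end ConstantMem

/-! ### The mean as a projection, and irreducibility. -/

section Constants

variable {𝕜 : Type*} [RCLike 𝕜] {N : ℕ} {ρ : Space N → ℝ} {G : Space N → Space N}
  {μ : Measure (Space N)} [IsProbabilityMeasure μ]

theorem norm_const_one : ‖Lp.const 2 μ (1 : 𝕜)‖ = 1 := by
  rw [Lp.norm_const' 2 μ (1 : 𝕜) (by simp) (by simp)]
  simp

theorem inner_const_one_smul (f : Lp 𝕜 2 μ) :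
    inner 𝕜 (Lp.const 2 μ (1 : 𝕜)) f • Lp.const 2 μ (1 : 𝕜) = Lp.const 2 μ (∫ x, f x ∂μ) := by
  have h1 : inner 𝕜 (Lp.const 2 μ (1 : 𝕜)) f = ∫ x, f x ∂μ := by
    rw [L2.inner_def]
    refine integral_congr_ae ?_
    filter_upwards [Lp.coeFn_const (p := 2) (μ := μ) (1 : 𝕜)] with x hx
    rw [hx]
    simp
  have h2 := (Lp.constₗ 2 μ 𝕜 : 𝕜 →ₗ[𝕜] Lp 𝕜 2 μ).map_smul (∫ x, f x ∂μ) 1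
  rw [h1]
  simpa using h2.symm

theorem IsAdmissible.const_integral_mem_positivePart (h : IsAdmissible ρ G μ) {f : Lp 𝕜 2 μ}
    (hf : f ∈ positivePart 𝕜 μ) : Lp.const 2 μ (∫ x, f x ∂μ) ∈ positivePart 𝕜 μ := by
  obtain ⟨h0, S, hS, hvS, hSf⟩ := hf
  have hfi : Integrable f μ := (Lp.memLp f).integrable (by norm_num)
  have him : RCLike.im (∫ x, f x ∂μ) = 0 := by
    rw [← integral_im hfi]
    exact integral_eq_zero_of_ae (h0.mono fun x hx => hx.2)
  have hre : 0 < RCLike.re (∫ x, f x ∂μ) := by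
    rw [← integral_re hfi, integral_pos_iff_support_of_nonneg_ae (h0.mono fun x hx => hx.1) hfi.re]
    -- Positivity of `ρ` almost everywhere gives `volume ≪ μ`, so a set of positive Lebesgue measure
    -- is not `μ`-null and the mean is strictly positive.
    have hμS : μ S ≠ 0 := fun hh => hvS.ne' (h.absolutelyContinuous hh)
    refine (pos_iff_ne_zero.2 hμS).trans_le (measure_mono_ae ?_)
    exact hSf.mono fun x hx hxS => (hx hxS).ne'
  refine ⟨?_, Set.univ, MeasurableSet.univ, ?_, ?_⟩
  · filter_upwards [Lp.coeFn_const (p := 2) (μ := μ) (∫ x, f x ∂μ)] with x hx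
    rw [hx]
    exact ⟨hre.le, him⟩
  · exact hvS.trans_le (measure_mono (Set.subset_univ S))
  · filter_upwards [Lp.coeFn_const (p := 2) (μ := μ) (∫ x, f x ∂μ)] with x hx _
    rw [hx]
    exact hre

/-- The limit `∫ f dμ` lies in the cone itself, so the distance is at most that from `T t f` to its
limit. -/
theorem IsAdmissible.isAsymptoticallyIrreducible (h : IsAdmissible ρ G μ)
    {T : ℝ≥0 → Lp 𝕜 2 μ →L[𝕜] Lp 𝕜 2 μ}
    (hT : ∀ f, Tendsto (fun t => T t f) atTop (𝓝 (Lp.const 2 μ (∫ x, f x ∂μ)))) :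
    IsAsymptoticallyIrreducible T := by
  intro f hf
  refine squeeze_zero (fun _ => Metric.infDist_nonneg) (fun t =>
    Metric.infDist_le_dist_of_mem (h.const_integral_mem_positivePart hf)) ?_
  exact tendsto_iff_dist_tendsto_zero.1 (hT f)

end Constants

end BiKolmogorov
-- The abstract theorem `formOperator_generation` with `e` the constant `1`, whose projection is the
-- mean by `inner_const_one_smul`.
theorem mainTheorem9 {𝕜 : Type*} [RCLike 𝕜] (N : ℕ) (hN : 1 ≤ N)
    (ρ : BiKolmogorov.Space N → ℝ) (G : BiKolmogorov.Space N → BiKolmogorov.Space N)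
    (μ : Measure (BiKolmogorov.Space N)) [IsProbabilityMeasure μ]
    (hμ : BiKolmogorov.IsAdmissible ρ G μ) :
    (∃! T : ℝ≥0 → Lp 𝕜 2 μ →L[𝕜] Lp 𝕜 2 μ,
      BiKolmogorov.IsSemigroupGeneratedBy T (-BiKolmogorov.biKolmogorovOperator 𝕜 ρ G μ)) ∧
    (∀ T : ℝ≥0 → Lp 𝕜 2 μ →L[𝕜] Lp 𝕜 2 μ,
      BiKolmogorov.IsSemigroupGeneratedBy T (-BiKolmogorov.biKolmogorovOperator 𝕜 ρ G μ) →
      (∀ f : Lp 𝕜 2 μ,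
        Tendsto (fun t => T t f) atTop (𝓝 (Lp.const 2 μ (∫ x, f x ∂μ)))) ∧
      BiKolmogorov.IsAsymptoticallyIrreducible T) ∧
    (∃ R : ℝ → Lp 𝕜 2 μ →L[𝕜] Lp 𝕜 2 μ,
      (∀ l : ℝ, 0 < l →
        BiKolmogorov.IsResolventOf (-BiKolmogorov.biKolmogorovOperator 𝕜 ρ G μ) (l : 𝕜) (R l)) ∧
      ∀ f : Lp 𝕜 2 μ,
        Tendsto (fun l : ℝ => (l : 𝕜) • R l f) (𝓝[>] 0)
          (𝓝 (Lp.const 2 μ (∫ x, f x ∂μ)))) := by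
  obtain ⟨h1, h2, R, h3, h4⟩ := BiKolmogorov.formOperator_generation
    (hμ.isClosed_kolmogorovOperator (𝕜 := 𝕜)) hμ.dense_domain BiKolmogorov.norm_const_one
    hμ.const_mem_graph fun u hu => hμ.exists_eq_const hu
  simp only [BiKolmogorov.inner_const_one_smul] at h2 h4
  exact ⟨h1, fun T hT => ⟨h2 T hT, hμ.isAsymptoticallyIrreducible (h2 T hT)⟩, R, h3, h4⟩
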